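/- **Setting.** In $\mathbb R^3_{xyz}$ identify the unit disc of the $zx$-plane with centre $(\sqrt2,0,0)$ with the closed unit disc of $\mathbb C$ (real axis = $x$-direction, imaginary axis = $z$-direction). For $t\in\mathbb R$ and $|w|\le 1$ put $$\delta(t,w)=\bigl((\sqrt2+\operatorname{Re}z)\cos t,\ (\sqrt2+\operatorname{Re}z)\sin t,\ \operatorname{Im}z\bigr),\qquad z=e^{it/2}w ,$$ i.e. revolve the disc about the $z$-axis while rotating it by half the angle anticlockwise about its centre. The image is the solid donut $SD$. Let $K_0=\{\delta(t,\pm1)\}$, a $(2,-1)$ torus knot on $\partial SD$. For $0<\varphi<\pi$ let $\alpha_\varphi$ be the arc in the closed unit disc, with endpoints $e^{\pm i\varphi}$, of the circle centred on the real axis and orthogonal to the unit circle (for $\varphi=\pi/2$: the vertical diameter). Let $A_\varphi=\{\delta(t,w): t\in\mathbb R,\ w\in\alpha_\varphi\cup\alpha_{\pi-\varphi}\}$ and let $M=\{\delta(t,w): t\in\mathbb R,\ w\in\alpha_{\pi/2}\}$, a Möbius band. Let $\rho$ be a $C^\infty$ immersion of the closed unit disc in $\mathbb R^3$, with image $D_0$,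 that maps the unit circle bijectively onto $K_0$ and meets $\partial SD$ along $K_0$ orthogonally and from the outside of $SD$. Let $R_\theta$ be the rotation by $\theta$ about the $z$-axis, $D_\theta=R_\theta(D_0)$, and $$S_\theta=D_{-\theta}\cup A_{\theta/2}\cup D_\theta\qquad(0<\theta<2\pi).$$ A regular homotopy is a family of immersions $S^2\to\mathbb R^3$ that is jointly of class $C^1$ in time and position. **Proposition.** For every such $\rho$ and every $\theta_0\in(0,\pi)$, the family $S_\theta$, $\theta\in[\theta_0,2\pi-\theta_0]$, is a regular homotopy from $S_{\theta_0}$ to itself with orientation reversed. Precisely, divide the unit sphere $S^2$ into an upper cap $\{z\ge\frac35\}$, a lower cap $\{z\le-\frac35\}$ and the closed band $B$ between them, and let $c(x,y,z)=\frac54(x+iy)$, which identifies each cap with the closed unit disc. There are a family of maps $F_\theta:S^2\to\mathbb R^3$, $\theta\in[\theta_0,2\pi-\theta_0]$, and an orientation-reversing $C^\infty$ diffeomorphism $r$ of $S^2$ such that: 1. $F$ is jointly $C^1$ in $(\theta,x)$, each $F_\theta$ is an immersion, and $F$ is jointly $C^\infty$ on $[\theta_0,2\pi-\theta_0]\times P$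 for each of the three closed pieces $P$ (the two caps and the band). 2. $F_\theta(S^2)=S_\theta$; moreover $F_\theta=R_\theta\circ\rho\circ c$ on the upper cap and $F_\theta=R_{-\theta}\circ\rho\circ c$ on the lower cap (the two discs $D_{\pm\theta}$ rotate rigidly in opposite directions), $F_\theta(B)=A_{\theta/2}$, and $F_\theta$ is injective on $B$ for $\theta\neq\pi$. 3. $F_{2\pi-\theta_0}=F_{\theta_0}\circ r$. 4. $r=\sigma\circ D$, where $\sigma(x,y,z)=(x,y,-z)$ and $D$ is a left- or right-handed Dehn twist about $B$: $D$ rotates the circle of $S^2$ at height $z$ by an angle $u(z)$, where $u$ is $C^\infty$, $u(z)=0$ for $z\ge\frac35$, and $u(z)=2\pi$ for all $z\le-\frac35$, or $u(z)=-2\pi$ for all $z\le-\frac35$. In particular $D$ is the identity on the caps. Thus the two discs trade places and the annulus comes back after a Dehn twist. 5. The sphere $S_\pi$ double covers the immersed projective plane $M\cup D_\pi$: there are a $C^\infty$ diffeomorphism $\psi$ of $S^2$ with $\psi(r(x))=-\psi(x)$ for all $x$, and an immersion $g:\mathbb{RP}^2=S^2/\{\pm1\}\to\mathbb R^3$ with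 image $M\cup D_\pi$, such that $F_\pi(x)=g([\psi(x)])$ for all $x\in S^2$. 6. At $\theta=\pi$ the annulus double covers the Möbius band: $F_\pi(B)=M$ and, for $x,y\in B$, $F_\pi(x)=F_\pi(y)$ if and only if $y=x$ or $y=r(x)$. -/

import Mathlib

open Set Metric
open scoped Manifold ContDiff Real

namespace Holiverse

noncomputable section

/-! ### Immersions of the sphere, regular homotopies, orientation -/

/-- Euclidean three-space. -/
abbrev E3 : Type := EuclideanSpace ℝ (Fin 3)

/-- The round two-sphere, with its standard smooth structure. -/
abbrev S2 : Type := Metric.sphere (0 : E3) 1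

/-- `C¹` immersions of the sphere in three-space. -/
def IsImmersedSphere (f : S2 → E3) : Prop :=
  ContMDiff (𝓡 2) 𝓘(ℝ, E3) 1 f ∧
    ∀ x, Function.Injective (mfderiv (𝓡 2) 𝓘(ℝ, E3) f x)

/-- `F`, with time running through `[a, b]`, is a regular homotopy from `f` to `g`: it is jointly
of class `C¹` in time and position, and it is an immersion at every time. -/
structure IsRegularHomotopy (a b : ℝ) (F : ℝ → S2 → E3) (f g : S2 → E3) : Prop where
  le : a ≤ b
  contMDiffOn : ContMDiffOn (𝓘(ℝ, ℝ).prod (𝓡 2)) 𝓘(ℝ, E3) 1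
    (fun q : ℝ × S2 => F q.1 q.2) (Icc a b ×ˢ univ)
  immersed : ∀ t ∈ Icc a b, IsImmersedSphere (F t)
  source : F a = f
  target : F b = g

/-- The derivative at `x` of the inclusion of the sphere in three-space, applied to `v`. -/
def tangentVec (x : S2) (v : TangentSpace (𝓡 2) x) : E3 :=
  mfderiv (𝓡 2) 𝓘(ℝ, E3) (fun y : S2 => (y : E3)) x v

/-- The area form `det (x, v, w)` of the unit sphere, for its standard orientation. -/
def areaForm (x : S2) (v w : TangentSpace (𝓡 2) x) : ℝ :=
  (EuclideanSpace.basisFun (Fin 3) ℝ).toBasis.det ![(x : E3), tangentVec x v, tangentVec x w]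

/-- A self-map of the sphere reverses orientation: its derivatives take positively oriented
tangent frames to negatively oriented ones. -/
def ReversesOrientation (r : S2 → S2) : Prop :=
  ∀ (x : S2) (v w : TangentSpace (𝓡 2) x), 0 < areaForm x v w →
    areaForm (r x) (mfderiv (𝓡 2) (𝓡 2) r x v) (mfderiv (𝓡 2) (𝓡 2) r x w) < 0

/-! ### The projective plane -/

/-- Two points of the sphere are identified when they are equal or antipodal. -/
def antipodalSetoid : Setoid S2 where
  r x y := y = x ∨ y = -x
  iseqv :=
    { refl := fun _ => Or.inl rfl
      symm := by
        rintro x y (h | h)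
        · exact Or.inl h.symm
        · exact Or.inr (by rw [h, neg_neg])
      trans := by
        rintro x y z (h | h) (h' | h')
        · exact Or.inl (by rw [h', h])
        · exact Or.inr (by rw [h', h])
        · exact Or.inr (by rw [h', h])
        · exact Or.inl (by rw [h', h, neg_neg]) }

/-- The real projective plane, as the quotient of the sphere by the antipodal map. -/
def RP2 : Type := Quotient antipodalSetoid

/-- The standard double covering of the projective plane by the sphere. -/
def toRP2 (x : S2) : RP2 := Quotient.mk antipodalSetoid x

/-- Immersions of the projective plane in three-space. Since `toRP2` is a local diffeomorphism,
they are the maps whose composition with `toRP2` is an immersion. -/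
def IsImmersedRP2 (g : RP2 → E3) : Prop := IsImmersedSphere (fun x => g (toRP2 x))

/-! ### The solid donut, the knot, the annuli, the Möbius band -/

/-- Rotation of three-space about the third axis by the angle `θ`. -/
def rotZ (θ : ℝ) (p : E3) : E3 :=
  !₂[Real.cos θ * p 0 - Real.sin θ * p 1, Real.sin θ * p 0 + Real.cos θ * p 1, p 2]

/-- The unit disc of the half-plane over the `+x`-axis with centre `(√2, 0, 0)` is identified with
the unit disc of `ℂ`, the real axis being the `x`-direction and the imaginary axis the
`z`-direction. `donut t w` is where the point `w` of that disc has arrived after a revolution by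
`t` about the `z`-axis, during which the disc has rotated about its centre, at constant rate,
by `t / 2` anticlockwise. -/
def donut (t : ℝ) (w : ℂ) : E3 :=
  let z : ℂ := Complex.exp (((t / 2 : ℝ) : ℂ) * Complex.I) * w
  !₂[(√2 + z.re) * Real.cos t, (√2 + z.re) * Real.sin t, z.im]

/-- For `‖w‖ = 1`, the outward unit normal of the boundary torus of the solid donut at the point
`donut t w`. -/
def donutNormal (t : ℝ) (w : ℂ) : E3 :=
  let z : ℂ := Complex.exp (((t / 2 : ℝ) : ℂ) * Complex.I) * w
  !₂[z.re * Real.cos t, z.re * Real.sin t, z.im]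

/-- The `(2,-1)` torus knot `K₀`, swept out by the two ends `-1` and `1` of the diameter of the
disc on the `x`-axis. -/
def knot : Set E3 := {p | ∃ t : ℝ, p = donut t 1 ∨ p = donut t (-1)}

/-- The arc `α_φ`, for `0 < φ < π`: the part in the closed unit disc of the circle that has its
centre on the real axis and crosses the unit circle at right angles in the two points of angles
`φ` and `-φ`; for `φ = π / 2` the arc is the vertical diameter. -/
def arc (φ : ℝ) : Set ℂ := {w | ‖w‖ ≤ 1 ∧ Real.cos φ * (‖w‖ ^ 2 + 1) = 2 * w.re}

/-- Away from `φ = π / 2`, the arc lies on the circle with centre `1 / cos φ` and radius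
`|tan φ|`, which is the circle orthogonal to the unit circle in the points of angles `φ`, `-φ`. -/
theorem arc_eq_circle {φ : ℝ} (h : Real.cos φ ≠ 0) :
    arc φ = {w : ℂ | ‖w‖ ≤ 1 ∧ ‖w - ((1 / Real.cos φ : ℝ) : ℂ)‖ = |Real.tan φ|} := by
  ext w
  have hsc := Real.sin_sq_add_cos_sq φ
  have key : ‖w - ((1 / Real.cos φ : ℝ) : ℂ)‖ = |Real.tan φ| ↔
      Real.cos φ * (‖w‖ ^ 2 + 1) = 2 * w.re := by
    rw [← abs_norm, ← sq_eq_sq_iff_abs_eq_abs, Complex.sq_norm, Complex.sq_norm,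
      Complex.normSq_apply, Complex.normSq_apply, Real.tan_eq_sin_div_cos]
    simp only [Complex.sub_re, Complex.sub_im, Complex.ofReal_re, Complex.ofReal_im]
    have e : Real.sin φ ^ 2 = 1 - Real.cos φ ^ 2 := by linarith
    rw [div_pow, e]
    field_simp
    constructor
    · intro k
      refine mul_left_cancel₀ h ?_
      linarith
    · intro k
      linear_combination Real.cos φ * k
  simp only [arc, mem_ofPred_eq, key]

/-- The annulus `A_φ`, swept out by the arcs `α_φ` and `α_{π-φ}`. -/
def annulus (φ : ℝ) : Set E3 := {p | ∃ t : ℝ, ∃ w ∈ arc φ ∪ arc (π - φ), p = donut t w}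

/-- The Möbius band `M`, swept out by the vertical diameter. -/
def moebius : Set E3 := {p | ∃ t : ℝ, ∃ w : ℂ, w.re = 0 ∧ ‖w‖ ≤ 1 ∧ p = donut t w}

/-! ### The immersed disc and the spheres -/

/-- `ρ` parametrizes, by the closed unit disc, a smoothly immersed disc `D₀` that is bounded by the
knot `K₀` and that meets the boundary torus of the solid donut along `K₀` orthogonally and from
the outside. -/
structure IsSpanningDisc (ρ : ℂ → E3) : Prop where
  smooth : ContDiffOn ℝ ∞ ρ (closedBall 0 1)
  immersed : ∀ x ∈ closedBall (0 : ℂ) 1,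
    Function.Injective (fderivWithin ℝ ρ (closedBall 0 1) x)
  boundary : BijOn ρ (sphere 0 1) knot
  /-- The tangent plane of the disc at a boundary point contains the normal of the torus. -/
  orthogonal : ∀ e ∈ sphere (0 : ℂ) 1, ∀ t : ℝ, ρ e = donut t 1 →
    ∃ v : ℂ, fderivWithin ℝ ρ (closedBall 0 1) e v = donutNormal t 1
  /-- Along the radius that ends at a boundary point, the disc arrives at the torus from the
  outside of the solid donut. -/
  outside : ∀ e ∈ sphere (0 : ℂ) 1, ∀ t : ℝ, ρ e = donut t 1 →
    inner ℝ (fderivWithin ℝ ρ (closedBall 0 1) e e) (donutNormal t 1) < 0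

/-- The rotated disc `D_θ`, as a subset of space. -/
def disc (ρ : ℂ → E3) (θ : ℝ) : Set E3 := rotZ θ '' (ρ '' closedBall 0 1)

/-- The sphere `S_θ = D_{-θ} ∪ A_{θ/2} ∪ D_θ`, as a subset of space. -/
def sphereImage (ρ : ℂ → E3) (θ : ℝ) : Set E3 :=
  disc ρ (-θ) ∪ annulus (θ / 2) ∪ disc ρ θ

/-- The upper cap of the round sphere. -/
def upperCap : Set S2 := {x | 3 / 5 ≤ (x : E3) 2}

/-- The lower cap of the round sphere. -/
def lowerCap : Set S2 := {x | (x : E3) 2 ≤ -(3 / 5)}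

/-- The closed band of the round sphere between the two caps. -/
def band : Set S2 := {x | |(x : E3) 2| ≤ 3 / 5}

/-- The vertical projection, scaled so that it identifies each cap with the closed unit disc. -/
def capCoord (x : S2) : ℂ := ⟨5 / 4 * (x : E3) 0, 5 / 4 * (x : E3) 1⟩

/-- `f` is a parametrization of `S_θ`: it takes the upper cap to `D_θ` and the lower cap to `D_{-θ}`
by the rigidly rotated parametrization of `D₀`, and it takes the band to `A_{θ/2}`; the band is
embedded unless `θ = π`. -/
structure Parametrizes (ρ : ℂ → E3) (θ : ℝ) (f : S2 → E3) : Prop where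
  range_eq : range f = sphereImage ρ θ
  upper : ∀ x ∈ upperCap, f x = rotZ θ (ρ (capCoord x))
  lower : ∀ x ∈ lowerCap, f x = rotZ (-θ) (ρ (capCoord x))
  band_image : f '' band = annulus (θ / 2)
  band_injOn : θ ≠ π → InjOn f band

/-- The reflection of the sphere in its equator, which interchanges the caps. -/
def mirror (x : S2) : S2 :=
  ⟨!₂[(x : E3) 0, (x : E3) 1, -(x : E3) 2], by
    have h : ‖(x : E3)‖ = 1 := by simp
    rw [EuclideanSpace.norm_eq, Fin.sum_univ_three] at h
    rw [mem_sphere_zero_iff_norm, EuclideanSpace.norm_eq, Fin.sum_univ_three]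
    simpa using h⟩

/-- `D` is a (left- or right-handed) Dehn twist about the band: it rotates the circle at height `z`
by an angle `u z` that depends smoothly on `z`, is `0` on the upper cap and is one full turn `± 2π`
on the lower cap. In particular `D` is the identity on both caps. -/
def IsDehnTwist (D : S2 → S2) : Prop :=
  ∃ (u : ℝ → ℝ) (ε : ℝ), ContDiff ℝ ∞ u ∧ (ε = 1 ∨ ε = -1) ∧
    (∀ z, 3 / 5 ≤ z → u z = 0) ∧ (∀ z, z ≤ -(3 / 5) → u z = ε * (2 * π)) ∧
    ∀ x : S2, (D x : E3) = rotZ (u ((x : E3) 2)) x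

end

end Holiverse

/-! One revolution turns the disc by only half a turn, so `donut (t + 2π) w = donut t (-w)`. Since
also `α_{π-φ} = -α_φ`, the annuli `A_φ` and `A_{π-φ}` coincide, and each is swept out by the single
arc `α_φ` while `t` runs through an interval of length `4π`. As `R_{2π}` is the identity, `D_{2π-θ}
= D_{-θ}`. Hence `S_{2π-θ}` and `S_θ` are the same set with the two discs interchanged. The task is
to parametrize so well that this becomes an identity `F_{2π-θ} = F_θ ∘ r` for all `θ`, with one
fixed involution `r` (`Collar.Fits.sphereMap_deck`). At `θ = θ₀` it gives the reversal, at `θ = π`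
the double covering.

The rotation `R_θ` advances `t` by `θ` without turning the disc, so it carries `donut t 1` to `donut
(t + θ) (e^{-iθ/2})`: the ends of `α_{θ/2}` trace the boundaries of `D_{±θ}`. If `ρ (e^{is}) = donut
(τ s) 1`, the angle of revolution has to go from `τ s - θ` to `τ s + θ` across the band. Where the
Dehn twist is not a whole number of turns, the symmetry requires an angle linear in `s`; so the
angle is built on `τ s` near the rims and on `2ηs` in the middle, `η = ±1` being the direction in
which the knot is run through (`Collar.angle_twist`, `Collar.bandMap_twist`).

For a `C¹` junction the derivatives transverse to the rim must agree. By orthogonality the radial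
derivative of `ρ` lies in the plane of the torus normal and the knot tangent, with a strict sign on
the normal. The arc also meets the torus along the normal, at speed `sin (θ/2)`. It remains to match
one length and one tangential drift, by means of `steepen`, `bandHeight` and `ripple`, whose
parameters are chosen so that no monotonicity is lost (`exists_collar`). The factor `sin (θ/2)`
cancels, so the junction holds for all `θ` at once (`Collar.hasDerivAt_bandMap_one`,
`Collar.Fits.fderiv_eq`).

Because `1 < √2`, the donut map is an immersion on the closed disc and its only coincidences are the
evident ones (`donut_eq_donut_iff`). Both `w` and `-w` lie on `α_{θ/2}` only for `θ = π`, which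
accounts for all double points of the band. Regularity is checked away from the lower cap and
carried there by the symmetry. Finally, half of the Dehn twist conjugates `r` to the antipodal map.
-/

namespace Holiverse

noncomputable section

/-! ### One-variable profiles -/

/-- A smooth even cutoff, `0` for `|p| ≤ 1/2` and `1` for `|p| ≥ 3/4`. -/
def cutoff (p : ℝ) : ℝ := Real.smoothTransition (4 * p ^ 2 - 1)

/-- A smooth odd function, `-1` for `p ≤ -1/2` and `1` for `p ≥ 1/2`. -/
def sweep (p : ℝ) : ℝ := 2 * Real.smoothTransition (p + 1 / 2) - 1

theorem cutoff_nonneg (p : ℝ) : 0 ≤ cutoff p := Real.smoothTransition.nonneg _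

theorem cutoff_le_one (p : ℝ) : cutoff p ≤ 1 := Real.smoothTransition.le_one _

theorem cutoff_neg (p : ℝ) : cutoff (-p) = cutoff p := by simp [cutoff]

theorem cutoff_eq_zero {p : ℝ} (hp : |p| ≤ 1 / 2) : cutoff p = 0 := by
  refine Real.smoothTransition.zero_of_nonpos ?_
  have := sq_le_sq' (abs_le.1 hp).1 (abs_le.1 hp).2
  nlinarith

theorem cutoff_eq_one {p : ℝ} (hp : 3 / 4 ≤ |p|) : cutoff p = 1 := by
  refine Real.smoothTransition.one_of_one_le ?_
  rw [← sq_abs]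
  nlinarith

theorem contDiff_cutoff : ContDiff ℝ ∞ cutoff :=
  Real.smoothTransition.contDiff.comp (by fun_prop)

theorem contDiff_sweep : ContDiff ℝ ∞ sweep :=
  (contDiff_const.mul (Real.smoothTransition.contDiff.comp (by fun_prop))).sub contDiff_const

theorem hasDerivAt_cutoff (p : ℝ) :
    HasDerivAt cutoff (deriv Real.smoothTransition (4 * p ^ 2 - 1) * (8 * p)) p := by
  have h1 : HasDerivAt Real.smoothTransition (deriv Real.smoothTransition (4 * p ^ 2 - 1))
      (4 * p ^ 2 - 1) :=
    (Real.smoothTransition.contDiff (n := 1)).differentiable one_ne_zero _ |>.hasDerivAt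
  have h2 : HasDerivAt (fun p : ℝ => 4 * p ^ 2 - 1) (8 * p) p := by
    refine (((hasDerivAt_pow 2 p).const_mul 4).sub_const 1).congr_deriv ?_
    norm_num
    ring
  exact h1.comp p h2

theorem sweep_eq_one {p : ℝ} (hp : 1 / 2 ≤ p) : sweep p = 1 := by
  rw [sweep, Real.smoothTransition.one_of_one_le (by linarith)]
  norm_num

theorem sweep_eq_neg_one {p : ℝ} (hp : p ≤ -(1 / 2)) : sweep p = -1 := by
  rw [sweep, Real.smoothTransition.zero_of_nonpos (by linarith)]
  norm_num

/-- The two transition values at `x` and `1 - x` are fractions with a common denominator, to which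
their numerators add up. -/
theorem sweep_neg (p : ℝ) : sweep (-p) = -sweep p := by
  have h : Real.smoothTransition (-p + 1 / 2) = 1 - Real.smoothTransition (p + 1 / 2) := by
    have hd := (Real.smoothTransition.pos_denom (p + 1 / 2)).ne'
    have e : (1 : ℝ) - (-p + 1 / 2) = p + 1 / 2 := by ring
    have e' : (1 : ℝ) - (p + 1 / 2) = -p + 1 / 2 := by ring
    rw [e'] at hd
    rw [Real.smoothTransition, Real.smoothTransition, e, e', eq_sub_iff_add_eq,
      add_comm (expNegInvGlue (-p + 1 / 2)), ← add_div, add_comm (expNegInvGlue (-p + 1 / 2)),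
      div_self hd]
  rw [sweep, sweep, h]
  ring

/-- An odd reparametrization of `[-1, 1]` that is the identity on `[-1/2, 1/2]` and has
slope `1 + 2 m` at `± 1`. -/
def bandHeight (m h : ℝ) : ℝ := h / (1 + m * cutoff h * (1 - h ^ 2))

theorem bandHeight_denom_pos {m h : ℝ} (hm : -(1 / 2) < m) (hh : |h| ≤ 1) :
    0 < 1 + m * cutoff h * (1 - h ^ 2) := by
  have h1 : h ^ 2 ≤ 1 := by rw [← sq_abs]; nlinarith [abs_nonneg h]
  have h2 : 0 ≤ cutoff h * (1 - h ^ 2) := mul_nonneg (cutoff_nonneg h) (by linarith)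
  have h3 : cutoff h * (1 - h ^ 2) ≤ 1 := by
    nlinarith [cutoff_nonneg h, cutoff_le_one h, sq_nonneg h]
  nlinarith

theorem bandHeight_neg (m h : ℝ) : bandHeight m (-h) = -bandHeight m h := by
  simp [bandHeight, cutoff_neg, neg_div]

theorem bandHeight_eq_self (m : ℝ) {h : ℝ} (hh : |h| ≤ 1 / 2) : bandHeight m h = h := by
  simp [bandHeight, cutoff_eq_zero hh]

theorem bandHeight_one (m : ℝ) : bandHeight m 1 = 1 := by simp [bandHeight]

theorem abs_bandHeight_le_one {m h : ℝ} (hm : -(1 / 2) < m) (hh : |h| ≤ 1) :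
    |bandHeight m h| ≤ 1 := by
  have hd := bandHeight_denom_pos hm hh
  rw [bandHeight, abs_div, abs_of_pos hd, div_le_one hd]
  have h0 := abs_nonneg h
  have h1 : 0 ≤ 1 - h ^ 2 := by rw [← sq_abs]; nlinarith
  -- With this bound `-1/2 < m` is enough for the denominator to stay above `|h|`.
  have h2 : 1 - h ^ 2 ≤ 2 * (1 - |h|) := by rw [← sq_abs]; nlinarith [sq_nonneg (1 - |h|)]
  have h3 : cutoff h * (1 - h ^ 2) ≤ 1 - h ^ 2 := by nlinarith [cutoff_le_one h]
  have h4 : 0 ≤ cutoff h * (1 - h ^ 2) := mul_nonneg (cutoff_nonneg h) h1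
  nlinarith

theorem hasDerivAt_bandHeight {m h : ℝ} (hd : 1 + m * cutoff h * (1 - h ^ 2) ≠ 0) :
    HasDerivAt (bandHeight m)
      ((1 + m * cutoff h * (1 + h ^ 2)
        - m * (deriv Real.smoothTransition (4 * h ^ 2 - 1) * (8 * h ^ 2)) * (1 - h ^ 2))
        / (1 + m * cutoff h * (1 - h ^ 2)) ^ 2) h := by
  have h1 : HasDerivAt (fun h : ℝ => 1 - h ^ 2) (-(2 * h)) h := by
    simpa using (hasDerivAt_pow 2 h).const_sub 1
  have h2 := (((hasDerivAt_cutoff h).const_mul m).mul h1).const_add 1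
  refine ((hasDerivAt_id h).div h2 hd).congr_deriv ?_
  simp only [id, Pi.mul_apply]
  congr 1
  ring

theorem deriv_smoothTransition_nonneg (x : ℝ) : 0 ≤ deriv Real.smoothTransition x :=
  Real.smoothTransition.monotone.deriv_nonneg

/-- For `m ≤ 0` the term with the derivative of the cutoff has the favourable sign, so its size does
not matter; what remains is at least `1 + 2 m`. -/
theorem bandHeight_deriv_pos {m h : ℝ} (hm : -(1 / 2) < m) (hm' : m ≤ 0) (hh : |h| ≤ 1) :
    0 < (1 + m * cutoff h * (1 + h ^ 2)
        - m * (deriv Real.smoothTransition (4 * h ^ 2 - 1) * (8 * h ^ 2)) * (1 - h ^ 2))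
        / (1 + m * cutoff h * (1 - h ^ 2)) ^ 2 := by
  refine div_pos ?_ (pow_pos (bandHeight_denom_pos hm hh) 2)
  have h1 : 0 ≤ 1 - h ^ 2 := by rw [← sq_abs]; nlinarith [abs_nonneg h]
  have h2 : 0 ≤ (-m) * (deriv Real.smoothTransition (4 * h ^ 2 - 1) * (8 * h ^ 2)) * (1 - h ^ 2) :=
    mul_nonneg (mul_nonneg (by linarith)
      (mul_nonneg (deriv_smoothTransition_nonneg _) (by positivity))) h1
  have h3 : cutoff h * (1 + h ^ 2) ≤ 2 := by
    nlinarith [cutoff_nonneg h, cutoff_le_one h, sq_nonneg h]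
  nlinarith

theorem strictMonoOn_bandHeight {m : ℝ} (hm : -(1 / 2) < m) (hm' : m ≤ 0) :
    StrictMonoOn (bandHeight m) (Icc (-1) 1) := by
  have hd : ∀ h ∈ Icc (-1 : ℝ) 1, 1 + m * cutoff h * (1 - h ^ 2) ≠ 0 := fun h hh =>
    (bandHeight_denom_pos hm (abs_le.2 hh)).ne'
  refine strictMonoOn_of_deriv_pos (convex_Icc _ _)
    (fun h hh => (hasDerivAt_bandHeight (hd h hh)).continuousAt.continuousWithinAt) fun h hh => ?_
  have hh' := interior_subset hh
  rw [(hasDerivAt_bandHeight (hd h hh')).deriv]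
  exact bandHeight_deriv_pos hm hm' (abs_le.2 hh')

theorem exists_bandHeight_eq {m : ℝ} (hm : -(1 / 2) < m) {p : ℝ} (hp : |p| ≤ 1) :
    ∃ h, |h| ≤ 1 ∧ bandHeight m h = p := by
  have hc : ContinuousOn (bandHeight m) (Icc (-1) 1) := fun h hh =>
    (hasDerivAt_bandHeight (bandHeight_denom_pos hm (abs_le.2 hh)).ne').continuousAt.continuousWithinAt
  have h1 := intermediate_value_Icc (by norm_num : (-1 : ℝ) ≤ 1) hc
  rw [bandHeight_neg, bandHeight_one] at h1
  obtain ⟨h, hh, e⟩ := h1 (abs_le.1 hp)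
  exact ⟨h, abs_le.2 hh, e⟩

theorem hasDerivAt_bandHeight_one (m : ℝ) : HasDerivAt (bandHeight m) (1 + 2 * m) 1 := by
  refine (hasDerivAt_bandHeight (by simp)).congr_deriv ?_
  have : cutoff 1 = 1 := cutoff_eq_one (by norm_num)
  simp only [this]
  norm_num
  ring

/-- For `m ≤ 0` the denominator is at most `1`, so heights are pushed outwards and never re-enter
the zone where `sweep` varies. -/
theorem abs_le_abs_bandHeight {m h : ℝ} (hm : -(1 / 2) < m) (hm' : m ≤ 0) (hh : |h| ≤ 1) :
    |h| ≤ |bandHeight m h| := by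
  have hd := bandHeight_denom_pos hm hh
  rw [bandHeight, abs_div, abs_of_pos hd, le_div_iff₀ hd]
  have h1 : 0 ≤ 1 - h ^ 2 := by rw [← sq_abs]; nlinarith [abs_nonneg h]
  have h4 : 0 ≤ cutoff h * (1 - h ^ 2) := mul_nonneg (cutoff_nonneg h) h1
  nlinarith [abs_nonneg h, mul_nonneg h4 (abs_nonneg h)]

theorem bandHeight_pos_iff {m h : ℝ} (hm : -(1 / 2) < m) (hh : |h| ≤ 1) :
    0 < bandHeight m h ↔ 0 < h := by
  rw [bandHeight, div_pos_iff_of_pos_right (bandHeight_denom_pos hm hh)]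

/-- The two heights have the same sweep: they agree on the part where `sweep` varies. -/
theorem sweep_bandHeight {m h : ℝ} (hm : -(1 / 2) < m) (hm' : m ≤ 0) (hh : |h| ≤ 1) :
    sweep (bandHeight m h) = sweep h := by
  by_cases h2 : |h| ≤ 1 / 2
  · rw [bandHeight_eq_self m h2]
  push Not at h2
  have h3 := h2.le.trans (abs_le_abs_bandHeight hm hm' hh)
  rcases lt_or_ge 0 h with h0 | h0
  · have h4 := (bandHeight_pos_iff hm hh).2 h0
    rw [abs_of_pos h0] at h2
    rw [abs_of_pos h4] at h3
    rw [sweep_eq_one h3, sweep_eq_one h2.le]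
  · have h4 := not_lt.1 (mt (bandHeight_pos_iff hm hh).1 h0.not_gt)
    rw [abs_of_nonpos h0] at h2
    rw [abs_of_nonpos h4] at h3
    rw [sweep_eq_neg_one (by linarith), sweep_eq_neg_one (by linarith)]

/-- An even function that vanishes at `± 1`, with slope `-1` at `1`, and is at most `1 / (2 N)`. -/
def ripple (N p : ℝ) : ℝ := (1 - p ^ 2) / (2 * (1 + N * (1 - p ^ 2)))

theorem ripple_denom_pos {N p : ℝ} (hN : 0 ≤ N) (hp : |p| ≤ 1) : 0 < 1 + N * (1 - p ^ 2) := by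
  have h1 : 0 ≤ 1 - p ^ 2 := by rw [← sq_abs]; nlinarith [abs_nonneg p]
  positivity

theorem ripple_nonneg {N p : ℝ} (hN : 0 ≤ N) (hp : |p| ≤ 1) : 0 ≤ ripple N p := by
  have h1 : 0 ≤ 1 - p ^ 2 := by rw [← sq_abs]; nlinarith [abs_nonneg p]
  have := ripple_denom_pos hN hp
  unfold ripple
  positivity

/-- This bound prevents the tangential correction in `Collar.angle` from outweighing half of the
speed of `τ`. -/
theorem two_mul_ripple_lt {N p : ℝ} (hN : 0 ≤ N) (hp : |p| ≤ 1) : 2 * (N * ripple N p) < 1 := by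
  have := ripple_denom_pos hN hp
  have e : 2 * (N * ripple N p) = N * (1 - p ^ 2) / (1 + N * (1 - p ^ 2)) := by
    unfold ripple
    field_simp
  rw [e, div_lt_one this]
  linarith

theorem ripple_neg (N p : ℝ) : ripple N (-p) = ripple N p := by simp [ripple]

theorem ripple_one (N : ℝ) : ripple N 1 = 0 := by simp [ripple]

theorem hasDerivAt_ripple_one (N : ℝ) : HasDerivAt (ripple N) (-1) 1 := by
  have h1 : HasDerivAt (fun h : ℝ => 1 - h ^ 2) (-2) 1 := by
    simpa using (hasDerivAt_pow 2 (1 : ℝ)).const_sub 1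
  refine (h1.div (((h1.const_mul N).const_add 1).const_mul 2) (by norm_num)).congr_deriv ?_
  norm_num

/-- An odd reparametrization of `[-1, 1]` with slope `1 + 2 l` at `± 1`. -/
def steepen (l p : ℝ) : ℝ := p / (1 + l * (1 - p ^ 2))

theorem steepen_neg (l p : ℝ) : steepen l (-p) = -steepen l p := by simp [steepen, neg_div]

theorem steepen_one (l : ℝ) : steepen l 1 = 1 := by simp [steepen]

theorem hasDerivAt_steepen {l p : ℝ} (hd : 1 + l * (1 - p ^ 2) ≠ 0) :
    HasDerivAt (steepen l) ((1 + l * (1 + p ^ 2)) / (1 + l * (1 - p ^ 2)) ^ 2) p := by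
  have h1 : HasDerivAt (fun h : ℝ => 1 - h ^ 2) (-(2 * p)) p := by
    simpa using (hasDerivAt_pow 2 p).const_sub 1
  refine ((hasDerivAt_id p).div ((h1.const_mul l).const_add 1) hd).congr_deriv ?_
  simp only [id]
  congr 1
  ring

theorem steepen_deriv_pos {l p : ℝ} (hl : 0 ≤ l) (hp : |p| ≤ 1) :
    0 < (1 + l * (1 + p ^ 2)) / (1 + l * (1 - p ^ 2)) ^ 2 := by
  have := ripple_denom_pos hl hp
  positivity

theorem strictMonoOn_steepen {l : ℝ} (hl : 0 ≤ l) : StrictMonoOn (steepen l) (Icc (-1) 1) := by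
  have hd : ∀ h ∈ Icc (-1 : ℝ) 1, 1 + l * (1 - h ^ 2) ≠ 0 := fun h hh =>
    (ripple_denom_pos hl (abs_le.2 hh)).ne'
  refine strictMonoOn_of_deriv_pos (convex_Icc _ _)
    (fun h hh => (hasDerivAt_steepen (hd h hh)).continuousAt.continuousWithinAt) fun h hh => ?_
  have hh' := interior_subset hh
  rw [(hasDerivAt_steepen (hd h hh')).deriv]
  exact steepen_deriv_pos hl (abs_le.2 hh')

theorem abs_steepen_le_one {l p : ℝ} (hl : 0 ≤ l) (hp : |p| ≤ 1) : |steepen l p| ≤ 1 := by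
  have hm := (strictMonoOn_steepen hl).monotoneOn
  have hp' := abs_le.1 hp
  have h1 := hm (left_mem_Icc.2 (by norm_num)) hp' hp'.1
  have h2 := hm hp' (right_mem_Icc.2 (by norm_num)) hp'.2
  rw [steepen_neg, steepen_one] at h1
  rw [steepen_one] at h2
  exact abs_le.2 ⟨h1, h2⟩

theorem exists_steepen_eq {l : ℝ} (hl : 0 ≤ l) {q : ℝ} (hq : |q| ≤ 1) :
    ∃ p, |p| ≤ 1 ∧ steepen l p = q := by
  have hc : ContinuousOn (steepen l) (Icc (-1) 1) := fun h hh =>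
    (hasDerivAt_steepen (ripple_denom_pos hl (abs_le.2 hh)).ne').continuousAt.continuousWithinAt
  have h1 := intermediate_value_Icc (by norm_num : (-1 : ℝ) ≤ 1) hc
  rw [steepen_neg, steepen_one] at h1
  obtain ⟨h, hh, e⟩ := h1 (abs_le.1 hq)
  exact ⟨h, abs_le.2 hh, e⟩

/-! ### The donut map -/

theorem hasDerivAt_euclidean {n : ℕ} {f : ℝ → EuclideanSpace ℝ (Fin n)}
    {f' : EuclideanSpace ℝ (Fin n)} {x : ℝ} :
    HasDerivAt f f' x ↔ ∀ i, HasDerivAt (fun x => f x i) (f' i) x := by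
  rw [← hasDerivWithinAt_univ, hasDerivWithinAt_iff_hasFDerivWithinAt, hasFDerivWithinAt_euclidean]
  refine forall_congr' fun i => ?_
  rw [← hasDerivWithinAt_univ, hasDerivWithinAt_iff_hasFDerivWithinAt]
  refine iff_of_eq (congrArg (fun L => HasFDerivWithinAt (fun x => f x i) L univ x) ?_)
  ext
  simp

theorem exp_half_mul_re (t : ℝ) (w : ℂ) :
    (Complex.exp (((t / 2 : ℝ) : ℂ) * Complex.I) * w).re =
      Real.cos (t / 2) * w.re - Real.sin (t / 2) * w.im := by
  rw [Complex.mul_re, Complex.exp_ofReal_mul_I_re, Complex.exp_ofReal_mul_I_im]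

theorem exp_half_mul_im (t : ℝ) (w : ℂ) :
    (Complex.exp (((t / 2 : ℝ) : ℂ) * Complex.I) * w).im =
      Real.cos (t / 2) * w.im + Real.sin (t / 2) * w.re := by
  rw [Complex.mul_im, Complex.exp_ofReal_mul_I_re, Complex.exp_ofReal_mul_I_im]

/-- The point of the half-plane over the `+x`-axis, before the revolution. -/
def sliceRe (t : ℝ) (w : ℂ) : ℝ := Real.cos (t / 2) * w.re - Real.sin (t / 2) * w.im

/-- The height of `donut t w`. -/
def sliceIm (t : ℝ) (w : ℂ) : ℝ := Real.cos (t / 2) * w.im + Real.sin (t / 2) * w.re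

theorem donut_eq (t : ℝ) (w : ℂ) : donut t w =
    !₂[(√2 + sliceRe t w) * Real.cos t, (√2 + sliceRe t w) * Real.sin t, sliceIm t w] := by
  simp only [donut, exp_half_mul_re, exp_half_mul_im, sliceRe, sliceIm]

theorem donutNormal_eq (t : ℝ) (w : ℂ) : donutNormal t w =
    !₂[sliceRe t w * Real.cos t, sliceRe t w * Real.sin t, sliceIm t w] := by
  simp only [donutNormal, exp_half_mul_re, exp_half_mul_im, sliceRe, sliceIm]

theorem sliceRe_sq_add_sliceIm_sq (t : ℝ) (w : ℂ) :
    sliceRe t w ^ 2 + sliceIm t w ^ 2 = ‖w‖ ^ 2 := by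
  rw [Complex.sq_norm, Complex.normSq_apply, sliceRe, sliceIm]
  linear_combination (w.re ^ 2 + w.im ^ 2) * Real.sin_sq_add_cos_sq (t / 2)

/-- The radius `1` of the disc is less than the distance `√2` of its centre from the axis. -/
theorem radius_pos {t : ℝ} {w : ℂ} (hw : ‖w‖ ≤ 1) : 0 < √2 + sliceRe t w := by
  have h1 : sliceRe t w ^ 2 ≤ 1 := by
    have := sliceRe_sq_add_sliceIm_sq t w
    nlinarith [norm_nonneg w, sq_nonneg (sliceIm t w)]
  have h2 : -1 ≤ sliceRe t w := by nlinarith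
  have h3 : 1 < √2 := by
    rw [Real.lt_sqrt zero_le_one]
    norm_num
  linarith

/-- A full revolution rotates the disc by `π`, which is multiplication by `-1`. This is the source
of the period `4π` and of the Möbius band. -/
theorem donut_two_pi (t : ℝ) (w : ℂ) : donut (t + 2 * π) w = donut t (-w) := by
  have e : (t + 2 * π) / 2 = t / 2 + π := by ring
  simp [donut_eq, sliceRe, sliceIm, e, Real.cos_add_pi, Real.sin_add_pi]

theorem donut_periodic (w : ℂ) : Function.Periodic (fun t => donut t w) (4 * π) := fun t => by
  have e : t + 4 * π = t + 2 * π + 2 * π := by ring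
  simp only [e, donut_two_pi, neg_neg]

theorem donut_add_int_mul (t : ℝ) (w : ℂ) (n : ℤ) : donut (t + n * (4 * π)) w = donut t w :=
  (donut_periodic w).int_mul n t

theorem donutNormal_periodic (w : ℂ) : Function.Periodic (fun t => donutNormal t w) (4 * π) :=
  fun t => by
  have e : (t + 4 * π) / 2 = t / 2 + 2 * π := by ring
  have e' : t + 4 * π = t + 2 * π + 2 * π := by ring
  simp only [donutNormal_eq, sliceRe, sliceIm, e, Real.cos_add_two_pi, Real.sin_add_two_pi]
  simp only [e', Real.cos_add_two_pi, Real.sin_add_two_pi]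

/-- Two points of the solid donut coincide only if their parameters differ by turns. -/
theorem donut_eq_donut_iff {t t' : ℝ} {w w' : ℂ} (hw : ‖w‖ ≤ 1) (hw' : ‖w'‖ ≤ 1) :
    donut t w = donut t' w' ↔
      ∃ n : ℤ, (t' = t + n * (4 * π) ∧ w' = w) ∨ (t' = t + 2 * π + n * (4 * π) ∧ w' = -w) := by
  constructor
  · intro h
    rw [donut_eq, donut_eq] at h
    have h0 := congrArg (fun p : E3 => p 0) h
    have h1 := congrArg (fun p : E3 => p 1) h
    have h2 := congrArg (fun p : E3 => p 2) h
    simp at h0 h1 h2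
    have r := radius_pos (t := t) hw
    have r' := radius_pos (t := t') hw'
    -- Both sides are the distance from the axis, which is positive; equality of squares suffices.
    have hr : √2 + sliceRe t w = √2 + sliceRe t' w' := by
      refine (sq_eq_sq₀ r.le r'.le).1 ?_
      have e : (√2 + sliceRe t w) ^ 2 =
          ((√2 + sliceRe t w) * Real.cos t) ^ 2 + ((√2 + sliceRe t w) * Real.sin t) ^ 2 := by
        linear_combination -(√2 + sliceRe t w) ^ 2 * Real.sin_sq_add_cos_sq t
      rw [e, h0, h1]
      linear_combination (√2 + sliceRe t' w') ^ 2 * Real.sin_sq_add_cos_sq t'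
    rw [hr] at h0 h1
    have hc := mul_left_cancel₀ r'.ne' h0
    have hs := mul_left_cancel₀ r'.ne' h1
    have hA : (t : Real.Angle) = t' := Real.Angle.cos_sin_inj hc hs
    obtain ⟨k, hk⟩ := Real.Angle.angle_eq_iff_two_pi_dvd_sub.1 hA.symm
    have hz : Complex.exp (((t / 2 : ℝ) : ℂ) * Complex.I) * w =
        Complex.exp (((t' / 2 : ℝ) : ℂ) * Complex.I) * w' := by
      apply Complex.ext
      · rw [exp_half_mul_re, exp_half_mul_re]
        exact add_left_cancel hr
      · rw [exp_half_mul_im, exp_half_mul_im]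
        exact h2
    have hexp : ∀ x : ℝ, Complex.exp ((x : ℂ) * Complex.I) ≠ 0 := fun x => Complex.exp_ne_zero _
    -- The parity of the number of revolutions decides between `w` and `-w`.
    rcases Int.even_or_odd' k with ⟨n, rfl | rfl⟩
    · refine ⟨n, Or.inl ⟨by push_cast at hk; linarith, ?_⟩⟩
      have e : ((t' / 2 : ℝ) : ℂ) * Complex.I =
          ((t / 2 : ℝ) : ℂ) * Complex.I + n * (2 * π * Complex.I) := by
        have : t' / 2 = t / 2 + n * (2 * π) := by push_cast at hk; linarith
        rw [this]
        push_cast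
        ring
      rw [e, Complex.exp_add, Complex.exp_int_mul_two_pi_mul_I, mul_one] at hz
      exact (mul_left_cancel₀ (hexp _) hz).symm
    · refine ⟨n, Or.inr ⟨by push_cast at hk; linarith, ?_⟩⟩
      have e : ((t' / 2 : ℝ) : ℂ) * Complex.I =
          ((t / 2 : ℝ) : ℂ) * Complex.I + π * Complex.I + n * (2 * π * Complex.I) := by
        have : t' / 2 = t / 2 + π + n * (2 * π) := by push_cast at hk; linarith
        rw [this]
        push_cast
        ring
      rw [e, Complex.exp_add, Complex.exp_int_mul_two_pi_mul_I, mul_one, Complex.exp_add,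
        Complex.exp_pi_mul_I, mul_neg_one, neg_mul, ← mul_neg] at hz
      rw [mul_left_cancel₀ (hexp _) hz, neg_neg]
  · rintro ⟨n, ⟨rfl, rfl⟩ | ⟨rfl, rfl⟩⟩
    · rw [donut_add_int_mul]
    · rw [donut_add_int_mul, donut_two_pi, neg_neg]

theorem contDiff_donut : ContDiff ℝ ∞ (fun q : ℝ × ℂ => donut q.1 q.2) := by
  have hre : ContDiff ℝ ∞ (fun q : ℝ × ℂ => q.2.re) := Complex.reCLM.contDiff.comp contDiff_snd
  have him : ContDiff ℝ ∞ (fun q : ℝ × ℂ => q.2.im) := Complex.imCLM.contDiff.comp contDiff_snd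
  simp only [donut_eq, sliceRe, sliceIm]
  rw [contDiff_euclidean]
  intro i
  fin_cases i <;> simp <;> fun_prop

theorem contDiff_donutNormal : ContDiff ℝ ∞ (fun q : ℝ × ℂ => donutNormal q.1 q.2) := by
  have hre : ContDiff ℝ ∞ (fun q : ℝ × ℂ => q.2.re) := Complex.reCLM.contDiff.comp contDiff_snd
  have him : ContDiff ℝ ∞ (fun q : ℝ × ℂ => q.2.im) := Complex.imCLM.contDiff.comp contDiff_snd
  simp only [donutNormal_eq, sliceRe, sliceIm]
  rw [contDiff_euclidean]
  intro i
  fin_cases i <;> simp <;> fun_prop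

/-- The velocity of `donut` along a curve through `(t, w)` with velocity `(t', w')`. -/
def donutVelocity (t : ℝ) (w : ℂ) (t' : ℝ) (w' : ℂ) : E3 :=
  !₂[(sliceRe t w' - t' / 2 * sliceIm t w) * Real.cos t - (√2 + sliceRe t w) * (Real.sin t * t'),
    (sliceRe t w' - t' / 2 * sliceIm t w) * Real.sin t + (√2 + sliceRe t w) * (Real.cos t * t'),
    sliceIm t w' + t' / 2 * sliceRe t w]

theorem hasDerivAt_donut {T : ℝ → ℝ} {W : ℝ → ℂ} {T' x : ℝ} {W' : ℂ} (hT : HasDerivAt T T' x)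
    (hW : HasDerivAt W W' x) :
    HasDerivAt (fun e => donut (T e) (W e)) (donutVelocity (T x) (W x) T' W') x := by
  have hre : HasDerivAt (fun e => (W e).re) W'.re x := Complex.reCLM.hasFDerivAt.comp_hasDerivAt x hW
  have him : HasDerivAt (fun e => (W e).im) W'.im x := Complex.imCLM.hasFDerivAt.comp_hasDerivAt x hW
  have hT2 := hT.div_const 2
  have h1 : HasDerivAt (fun e => sliceRe (T e) (W e))
      (sliceRe (T x) W' - T' / 2 * sliceIm (T x) (W x)) x := by
    refine ((hT2.cos.mul hre).sub (hT2.sin.mul him)).congr_deriv ?_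
    simp only [sliceRe, sliceIm]
    ring
  have h2 : HasDerivAt (fun e => sliceIm (T e) (W e))
      (sliceIm (T x) W' + T' / 2 * sliceRe (T x) (W x)) x := by
    refine ((hT2.cos.mul him).add (hT2.sin.mul hre)).congr_deriv ?_
    simp only [sliceRe, sliceIm]
    ring
  simp only [donut_eq]
  rw [hasDerivAt_euclidean]
  intro i
  fin_cases i
  · refine ((h1.const_add (√2)).mul hT.cos).congr_deriv ?_
    simp [donutVelocity]
    ring
  · refine ((h1.const_add (√2)).mul hT.sin).congr_deriv ?_
    simp [donutVelocity]
  · exact h2.congr_deriv (by simp [donutVelocity])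

theorem slice_eq_zero {t : ℝ} {w : ℂ} (h1 : sliceRe t w = 0) (h2 : sliceIm t w = 0) : w = 0 := by
  have := sliceRe_sq_add_sliceIm_sq t w
  rw [h1, h2] at this
  simpa using this.symm

/-- The donut map is an immersion on the closed unit disc. -/
theorem donutVelocity_eq_zero {t t' : ℝ} {w w' : ℂ} (hw : ‖w‖ ≤ 1)
    (h : donutVelocity t w t' w' = 0) : t' = 0 ∧ w' = 0 := by
  have h0 := congrArg (fun p : E3 => p 0) h
  have h1 := congrArg (fun p : E3 => p 1) h
  have h2 := congrArg (fun p : E3 => p 2) h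
  simp [donutVelocity] at h0 h1 h2
  have hsc := Real.sin_sq_add_cos_sq t
  -- The horizontal part of the velocity is split into its components along the revolution and away
  -- from the axis.
  have ht : (√2 + sliceRe t w) * t' = 0 := by
    linear_combination Real.cos t * h1 - Real.sin t * h0 - (√2 + sliceRe t w) * t' * hsc
  have hr : sliceRe t w' - t' / 2 * sliceIm t w = 0 := by
    linear_combination Real.cos t * h0 + Real.sin t * h1 -
      (sliceRe t w' - t' / 2 * sliceIm t w) * hsc
  have ht' : t' = 0 := (mul_eq_zero.1 ht).resolve_left (radius_pos hw).ne'
  subst ht'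
  simp at hr h2
  exact ⟨rfl, slice_eq_zero hr h2⟩

theorem donutVelocity_add (t : ℝ) (w : ℂ) (a b : ℝ) (a' b' : ℂ) :
    donutVelocity t w (a + b) (a' + b') = donutVelocity t w a a' + donutVelocity t w b b' := by
  ext i
  fin_cases i <;> simp [donutVelocity, sliceRe, sliceIm] <;> ring

theorem donutVelocity_smul (t : ℝ) (w : ℂ) (a b : ℝ) (b' : ℂ) :
    donutVelocity t w (a * b) (a • b') = a • donutVelocity t w b b' := by
  ext i
  fin_cases i <;> simp [donutVelocity, sliceRe, sliceIm] <;> ring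

theorem donutVelocity_zero_self (t : ℝ) (w : ℂ) : donutVelocity t w 0 w = donutNormal t w := by
  simp [donutVelocity, donutNormal_eq]

theorem inner_donutNormal_self (t : ℝ) (w : ℂ) :
    inner ℝ (donutNormal t w) (donutNormal t w) = ‖w‖ ^ 2 := by
  rw [← sliceRe_sq_add_sliceIm_sq t w, donutNormal_eq, real_inner_self_eq_norm_sq,
    EuclideanSpace.real_norm_sq_eq, Fin.sum_univ_three]
  simp
  linear_combination (sliceRe t w ^ 2) * Real.sin_sq_add_cos_sq t

/-- Revolving and turning the disc both preserve the torus of radius `‖w‖`, so the velocity is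
tangent to it. -/
theorem inner_donutVelocity_donutNormal (t : ℝ) (w : ℂ) :
    inner ℝ (donutVelocity t w 1 0) (donutNormal t w) = 0 := by
  have h1 : sliceRe t 0 = 0 := by simp [sliceRe]
  have h2 : sliceIm t 0 = 0 := by simp [sliceIm]
  simp [PiLp.inner_apply, Fin.sum_univ_three, donutVelocity, donutNormal_eq, h1, h2]
  linear_combination -(1 / 2) * sliceIm t w * sliceRe t w * Real.sin_sq_add_cos_sq t

/-! ### Rotations about the third axis -/

/-- `rotZ θ` as a continuous linear map. -/
def rotZL (θ : ℝ) : E3 →L[ℝ] E3 :=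
  LinearMap.toContinuousLinearMap
    { toFun := rotZ θ
      map_add' := fun p q => by ext i; fin_cases i <;> simp [rotZ] <;> ring
      map_smul' := fun a p => by ext i; fin_cases i <;> simp [rotZ] <;> ring }

@[simp] theorem rotZL_apply (θ : ℝ) (p : E3) : rotZL θ p = rotZ θ p := rfl

theorem rotZ_add (a b : ℝ) (p : E3) : rotZ (a + b) p = rotZ a (rotZ b p) := by
  ext i
  fin_cases i <;> simp [rotZ, Real.cos_add, Real.sin_add] <;> ring

theorem rotZ_zero (p : E3) : rotZ 0 p = p := by
  ext i
  fin_cases i <;> simp [rotZ]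

theorem rotZ_injective (θ : ℝ) : Function.Injective (rotZ θ) :=
  Function.LeftInverse.injective (g := rotZ (-θ)) fun p => by
    rw [← rotZ_add, neg_add_cancel, rotZ_zero]

theorem rotZ_add_two_pi (θ : ℝ) (p : E3) : rotZ (θ + 2 * π) p = rotZ θ p := by
  simp [rotZ]

theorem rotZ_sub_two_pi (θ : ℝ) (p : E3) : rotZ (θ - 2 * π) p = rotZ θ p := by
  simp [rotZ]

theorem contDiff_rotZ : ContDiff ℝ ∞ (fun q : ℝ × E3 => rotZ q.1 q.2) := by
  rw [contDiff_euclidean]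
  intro i
  fin_cases i <;> simp [rotZ] <;> fun_prop

theorem norm_rotZ (θ : ℝ) (p : E3) : ‖rotZ θ p‖ = ‖p‖ := by
  rw [EuclideanSpace.norm_eq, EuclideanSpace.norm_eq]
  congr 1
  simp [Fin.sum_univ_three, rotZ]
  linear_combination (p 0 ^ 2 + p 1 ^ 2) * Real.sin_sq_add_cos_sq θ

theorem slice_shift (t θ : ℝ) (w : ℂ) :
    Complex.exp ((((t + θ) / 2 : ℝ) : ℂ) * Complex.I) *
      (Complex.exp (((-(θ / 2) : ℝ) : ℂ) * Complex.I) * w) =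
    Complex.exp (((t / 2 : ℝ) : ℂ) * Complex.I) * w := by
  rw [← mul_assoc, ← Complex.exp_add]
  congr 2
  push_cast
  ring

theorem sliceRe_shift (t θ : ℝ) (w : ℂ) :
    sliceRe (t + θ) (Complex.exp (((-(θ / 2) : ℝ) : ℂ) * Complex.I) * w) = sliceRe t w := by
  have := congrArg Complex.re (slice_shift t θ w)
  rwa [exp_half_mul_re, exp_half_mul_re] at this

theorem sliceIm_shift (t θ : ℝ) (w : ℂ) :
    sliceIm (t + θ) (Complex.exp (((-(θ / 2) : ℝ) : ℂ) * Complex.I) * w) = sliceIm t w := by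
  have := congrArg Complex.im (slice_shift t θ w)
  rwa [exp_half_mul_im, exp_half_mul_im] at this

/-- The rotation revolves the disc without turning it, so the coordinate `w` has to be turned back
by `θ / 2`. For `w = 1` this gives an end of the arc `α_{θ/2}`, which is why `A_{θ/2}` fits `D_θ`.
-/
theorem rotZ_donut (θ t : ℝ) (w : ℂ) :
    rotZ θ (donut t w) = donut (t + θ) (Complex.exp (((-(θ / 2) : ℝ) : ℂ) * Complex.I) * w) := by
  rw [donut_eq, donut_eq, sliceRe_shift, sliceIm_shift]
  ext i
  fin_cases i <;> simp [rotZ, Real.cos_add, Real.sin_add] <;> ring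

theorem rotZ_donutVelocity (θ t t' : ℝ) (w w' : ℂ) :
    rotZ θ (donutVelocity t w t' w') =
      donutVelocity (t + θ) (Complex.exp (((-(θ / 2) : ℝ) : ℂ) * Complex.I) * w) t'
        (Complex.exp (((-(θ / 2) : ℝ) : ℂ) * Complex.I) * w') := by
  simp only [donutVelocity, sliceRe_shift, sliceIm_shift]
  ext i
  fin_cases i <;> simp [rotZ, Real.cos_add, Real.sin_add] <;> ring

/-! ### The arcs -/

/-- A rational parametrization of the arc `α_φ` by `[-1, 1]`. -/
def arcPoint (φ q : ℝ) : ℂ :=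
  ⟨Real.cos φ * (1 + q ^ 2) / ((1 + Real.sin φ) + (1 - Real.sin φ) * q ^ 2),
    2 * Real.sin φ * q / ((1 + Real.sin φ) + (1 - Real.sin φ) * q ^ 2)⟩

theorem arcPoint_denom_pos {φ : ℝ} (hφ : 0 < Real.sin φ) (q : ℝ) :
    0 < (1 + Real.sin φ) + (1 - Real.sin φ) * q ^ 2 := by
  have := mul_nonneg (sub_nonneg.2 (Real.sin_le_one φ)) (sq_nonneg q)
  linarith

/-- The arc is a geodesic of the Poincaré disc: `arcPoint φ q` is the image of the point `iq` of the
vertical diameter under `z ↦ (z + a) / (1 + a z)`, where `a = cos φ / (1 + sin φ)`. -/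
theorem norm_arcPoint_sq {φ : ℝ} (hφ : 0 < Real.sin φ) (q : ℝ) :
    ‖arcPoint φ q‖ ^ 2 = ((1 - Real.sin φ) + (1 + Real.sin φ) * q ^ 2) /
      ((1 + Real.sin φ) + (1 - Real.sin φ) * q ^ 2) := by
  have hd := (arcPoint_denom_pos hφ q).ne'
  rw [Complex.sq_norm, Complex.normSq_apply]
  simp only [arcPoint]
  rw [div_mul_div_comm, div_mul_div_comm, ← add_div, div_eq_div_iff (mul_ne_zero hd hd) hd]
  linear_combination (1 + q ^ 2) ^ 2 * ((1 + Real.sin φ) + (1 - Real.sin φ) * q ^ 2) *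
    Real.sin_sq_add_cos_sq φ

theorem norm_arcPoint_le_one {φ : ℝ} (hφ : 0 < Real.sin φ) {q : ℝ} (hq : |q| ≤ 1) :
    ‖arcPoint φ q‖ ≤ 1 := by
  have hd := arcPoint_denom_pos hφ q
  have h1 : q ^ 2 ≤ 1 := by rw [← sq_abs]; nlinarith [abs_nonneg q]
  rw [← abs_norm, ← sq_le_one_iff_abs_le_one, norm_arcPoint_sq hφ, div_le_one hd]
  nlinarith

theorem arcPoint_mem {φ : ℝ} (hφ : 0 < Real.sin φ) {q : ℝ} (hq : |q| ≤ 1) :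
    arcPoint φ q ∈ arc φ := by
  have hd := arcPoint_denom_pos hφ q
  refine ⟨norm_arcPoint_le_one hφ hq, ?_⟩
  rw [norm_arcPoint_sq hφ]
  simp only [arcPoint]
  field_simp
  ring

/-- The cosine changes sign and the sine does not; this is the symmetry `θ ↦ 2π - θ` at the level of
arcs. -/
theorem arcPoint_pi_sub (φ q : ℝ) : arcPoint (π - φ) q = -arcPoint φ (-q) := by
  apply Complex.ext <;> simp [arcPoint, neg_div]

theorem hasDerivAt_arcPoint_im {φ : ℝ} (hφ : 0 < Real.sin φ) (q : ℝ) :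
    HasDerivAt (fun q => (arcPoint φ q).im)
      (2 * Real.sin φ * ((1 + Real.sin φ) - (1 - Real.sin φ) * q ^ 2) /
        ((1 + Real.sin φ) + (1 - Real.sin φ) * q ^ 2) ^ 2) q := by
  have hd := (arcPoint_denom_pos hφ q).ne'
  have h1 : HasDerivAt (fun q : ℝ => (1 + Real.sin φ) + (1 - Real.sin φ) * q ^ 2)
      ((1 - Real.sin φ) * (2 * q)) q := by
    simpa using ((hasDerivAt_pow 2 q).const_mul (1 - Real.sin φ)).const_add (1 + Real.sin φ)
  refine (((hasDerivAt_id q).const_mul (2 * Real.sin φ)).div h1 hd).congr_deriv ?_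
  simp only [id]
  congr 1
  ring

theorem arcPoint_im_deriv_pos {φ : ℝ} (hφ : 0 < Real.sin φ) {q : ℝ} (hq : |q| ≤ 1) :
    0 < 2 * Real.sin φ * ((1 + Real.sin φ) - (1 - Real.sin φ) * q ^ 2) /
        ((1 + Real.sin φ) + (1 - Real.sin φ) * q ^ 2) ^ 2 := by
  have hd := arcPoint_denom_pos hφ q
  have h1 : q ^ 2 ≤ 1 := by rw [← sq_abs]; nlinarith [abs_nonneg q]
  have h2 := Real.sin_le_one φ
  have h3 : 0 < (1 + Real.sin φ) - (1 - Real.sin φ) * q ^ 2 := by nlinarith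
  positivity

theorem strictMonoOn_arcPoint_im {φ : ℝ} (hφ : 0 < Real.sin φ) :
    StrictMonoOn (fun q => (arcPoint φ q).im) (Icc (-1) 1) := by
  refine strictMonoOn_of_deriv_pos (convex_Icc _ _)
    (fun h _ => (hasDerivAt_arcPoint_im hφ h).continuousAt.continuousWithinAt) fun h hh => ?_
  rw [(hasDerivAt_arcPoint_im hφ h).deriv]
  exact arcPoint_im_deriv_pos hφ (abs_le.2 (show h ∈ Icc (-1 : ℝ) 1 from interior_subset hh))

theorem arcPoint_one (φ : ℝ) : arcPoint φ 1 = Complex.exp ((φ : ℂ) * Complex.I) := by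
  apply Complex.ext
  · rw [Complex.exp_ofReal_mul_I_re]
    simp only [arcPoint]
    ring
  · rw [Complex.exp_ofReal_mul_I_im]
    simp only [arcPoint]
    ring

theorem arcPoint_neg_one (φ : ℝ) : arcPoint φ (-1) = Complex.exp (((-φ : ℝ) : ℂ) * Complex.I) := by
  apply Complex.ext
  · rw [Complex.exp_ofReal_mul_I_re]
    simp only [arcPoint, Real.cos_neg]
    ring
  · rw [Complex.exp_ofReal_mul_I_im]
    simp only [arcPoint, Real.sin_neg]
    ring

theorem hasDerivAt_complex {f : ℝ → ℂ} {f' : ℂ} {x : ℝ} (h1 : HasDerivAt (fun x => (f x).re) f'.re x)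
    (h2 : HasDerivAt (fun x => (f x).im) f'.im x) : HasDerivAt f f' x := by
  have h := h1.ofReal_comp.add (h2.ofReal_comp.mul_const Complex.I)
  rw [Complex.re_add_im] at h
  exact h.congr_of_eventuallyEq (Filter.Eventually.of_forall fun x => (Complex.re_add_im (f x)).symm)

theorem hasDerivAt_arcPoint {φ : ℝ} (hφ : 0 < Real.sin φ) (q : ℝ) :
    HasDerivAt (arcPoint φ)
      ⟨4 * Real.cos φ * Real.sin φ * q / ((1 + Real.sin φ) + (1 - Real.sin φ) * q ^ 2) ^ 2,
        2 * Real.sin φ * ((1 + Real.sin φ) - (1 - Real.sin φ) * q ^ 2) /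
        ((1 + Real.sin φ) + (1 - Real.sin φ) * q ^ 2) ^ 2⟩ q := by
  refine hasDerivAt_complex ?_ (hasDerivAt_arcPoint_im hφ q)
  have hd := (arcPoint_denom_pos hφ q).ne'
  have h1 : HasDerivAt (fun q : ℝ => (1 + Real.sin φ) + (1 - Real.sin φ) * q ^ 2)
      ((1 - Real.sin φ) * (2 * q)) q := by
    simpa using ((hasDerivAt_pow 2 q).const_mul (1 - Real.sin φ)).const_add (1 + Real.sin φ)
  have h2 : HasDerivAt (fun q : ℝ => Real.cos φ * (1 + q ^ 2)) (Real.cos φ * (2 * q)) q := by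
    simpa using ((hasDerivAt_pow 2 q).const_add 1).const_mul (Real.cos φ)
  refine (h2.div h1 hd).congr_deriv ?_
  congr 1
  ring

/-- The velocity is a real multiple of the end point because the arc is orthogonal to the unit
circle. The speed `sin φ` is cancelled later by `Collar.slope`. -/
theorem hasDerivAt_arcPoint_neg_one {φ : ℝ} (hφ : 0 < Real.sin φ) :
    HasDerivAt (arcPoint φ) (-(Real.sin φ • Complex.exp (((-φ : ℝ) : ℂ) * Complex.I))) (-1) := by
  refine (hasDerivAt_arcPoint hφ (-1)).congr_deriv ?_
  apply Complex.ext
  · rw [Complex.neg_re, Complex.real_smul, Complex.re_ofReal_mul, Complex.exp_ofReal_mul_I_re,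
      Real.cos_neg]
    ring
  · rw [Complex.neg_im, Complex.real_smul, Complex.im_ofReal_mul, Complex.exp_ofReal_mul_I_im,
      Real.sin_neg]
    ring

theorem exists_arcPoint_eq {φ : ℝ} (hφ : 0 < Real.sin φ) {w : ℂ} (hw : w ∈ arc φ) :
    ∃ q, |q| ≤ 1 ∧ arcPoint φ q = w := by
  have hc : ContinuousOn (fun q => (arcPoint φ q).im) (Icc (-1) 1) := fun q _ =>
    (hasDerivAt_arcPoint_im hφ q).continuousAt.continuousWithinAt
  have h1 := intermediate_value_Icc (by norm_num : (-1 : ℝ) ≤ 1) hc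
  simp only [arcPoint_one, arcPoint_neg_one, Complex.exp_ofReal_mul_I_im, Real.sin_neg] at h1
  obtain ⟨hn, he⟩ := hw
  have hN : w.re ^ 2 + w.im ^ 2 = ‖w‖ ^ 2 := by
    rw [Complex.sq_norm, Complex.normSq_apply]
    ring
  have hn2 : ‖w‖ ^ 2 ≤ 1 := by nlinarith [norm_nonneg w]
  have hsc := Real.sin_sq_add_cos_sq φ
  -- With `n = ‖w‖ ^ 2`, the difference of the two sides is `(1 - n) sin² φ + cos² φ (1 - n)² / 4`.
  have him : w.im ^ 2 ≤ Real.sin φ ^ 2 := by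
    have h4 : 4 * w.re ^ 2 = Real.cos φ ^ 2 * (‖w‖ ^ 2 + 1) ^ 2 := by
      rw [← mul_pow, he]
      ring
    nlinarith [mul_nonneg (sq_nonneg (Real.cos φ)) (sq_nonneg (‖w‖ ^ 2 - 1)),
      mul_nonneg (sq_nonneg (Real.sin φ)) (sub_nonneg.2 hn2)]
  have him' := abs_le_of_sq_le_sq' him hφ.le
  obtain ⟨q, hq, e⟩ := h1 ⟨him'.1, him'.2⟩
  have hq' := abs_le.2 hq
  have hm := arcPoint_mem hφ hq'
  refine ⟨q, hq', Complex.ext ?_ e⟩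
  obtain ⟨hn', he'⟩ := hm
  have hN' : (arcPoint φ q).re ^ 2 + (arcPoint φ q).im ^ 2 = ‖arcPoint φ q‖ ^ 2 := by
    rw [Complex.sq_norm, Complex.normSq_apply]
    ring
  simp only at e
  rw [← hN', e] at he'
  rw [← hN] at he
  set a := (arcPoint φ q).re
  -- A horizontal line meets the circle in two points whose real parts add up to `2 / cos φ`; they
  -- cannot both lie in the unit disc.
  have hfac : (a - w.re) * (Real.cos φ * (a + w.re) - 2) = 0 := by
    linear_combination he' - he
  rcases mul_eq_zero.1 hfac with h | h
  · linarith
  · exfalso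
    have ha : |a| ≤ 1 := (Complex.abs_re_le_norm _).trans hn'
    have hw1 : |w.re| ≤ 1 := (Complex.abs_re_le_norm _).trans hn
    have hc1 : |Real.cos φ| < 1 := by
      rw [← sq_lt_one_iff_abs_lt_one]
      nlinarith
    have : |Real.cos φ * (a + w.re)| < 2 := by
      rw [abs_mul]
      have : |a + w.re| ≤ 2 := (abs_add_le _ _).trans (by linarith)
      nlinarith [abs_nonneg (Real.cos φ), abs_nonneg (a + w.re)]
    have := (abs_lt.1 this).2
    linarith

theorem arc_pi_sub (φ : ℝ) : arc (π - φ) = {w | -w ∈ arc φ} := by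
  ext w
  simp only [arc, mem_ofPred_eq, Real.cos_pi_sub, norm_neg, Complex.neg_re]
  refine and_congr_right fun _ => ⟨fun h => by linarith, fun h => by linarith⟩

/-- The second arc is the negative of the first, and one more revolution takes it there. -/
theorem annulus_eq (φ : ℝ) : annulus φ = {p | ∃ t : ℝ, ∃ w ∈ arc φ, p = donut t w} := by
  ext p
  constructor
  · rintro ⟨t, w, hw | hw, rfl⟩
    · exact ⟨t, w, hw, rfl⟩
    · rw [arc_pi_sub] at hw
      exact ⟨t + 2 * π, -w, hw, by rw [donut_two_pi, neg_neg]⟩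
  · rintro ⟨t, w, hw, rfl⟩
    exact ⟨t, w, Or.inl hw, rfl⟩

theorem annulus_pi_div_two : annulus (π / 2) = moebius := by
  rw [annulus_eq]
  ext p
  simp only [arc, moebius, mem_ofPred_eq, Real.cos_pi_div_two, zero_mul]
  constructor
  · rintro ⟨t, w, ⟨h1, h2⟩, rfl⟩
    exact ⟨t, w, by linarith, h1, rfl⟩
  · rintro ⟨t, w, h1, h2, rfl⟩
    exact ⟨t, w, ⟨h2, by linarith⟩, rfl⟩

/-! ### The rotating annulus -/

theorem sin_half_pos {θ₀ θ : ℝ} (hpos : 0 < θ₀) (hθ : θ ∈ Icc θ₀ (2 * π - θ₀)) :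
    0 < Real.sin (θ / 2) :=
  Real.sin_pos_of_pos_of_lt_pi (by linarith [hθ.1]) (by linarith [hθ.2])

theorem sin_half_le {θ₀ θ : ℝ} (hpos : 0 < θ₀) (hθ : θ ∈ Icc θ₀ (2 * π - θ₀)) :
    Real.sin (θ₀ / 2) ≤ Real.sin (θ / 2) := by
  rcases le_total θ π with h | h
  · exact Real.sin_le_sin_of_le_of_le_pi_div_two (by linarith [Real.pi_pos]) (by linarith)
      (by linarith [hθ.1])
  · rw [← Real.sin_pi_sub (θ / 2)]
    exact Real.sin_le_sin_of_le_of_le_pi_div_two (by linarith [Real.pi_pos]) (by linarith)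
      (by linarith [hθ.2])

theorem two_pi_sub_mem {θ₀ θ : ℝ} (hθ : θ ∈ Icc θ₀ (2 * π - θ₀)) :
    2 * π - θ ∈ Icc θ₀ (2 * π - θ₀) := ⟨by linarith [hθ.2], by linarith [hθ.1]⟩

theorem sin_half_two_pi_sub (θ : ℝ) : Real.sin ((2 * π - θ) / 2) = Real.sin (θ / 2) := by
  rw [← Real.sin_pi_sub (θ / 2)]
  congr 1
  ring

/-- The boundary behaviour of the annulus: `τ` parametrizes the knot, going `η = ± 1` times
around it, `(1 + 2 l) α` is the component of the radial velocity along the normal of the torus and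
`c α` the one along the knot. -/
structure Collar (θ₀ : ℝ) where
  η : ℝ
  τ : ℝ → ℝ
  α : ℝ → ℝ
  c : ℝ → ℝ
  l : ℝ
  N : ℝ
  θ₀_pos : 0 < θ₀
  η_eq : η = 1 ∨ η = -1
  τ_smooth : ContDiff ℝ ∞ τ
  τ_add : ∀ s, τ (s + 2 * π) = τ s + η * (4 * π)
  τ_deriv : ∀ s, 0 < η * deriv τ s
  α_smooth : ContDiff ℝ ∞ α
  α_periodic : Function.Periodic α (2 * π)
  α_pos : ∀ s, 0 < α s
  α_le : ∀ s, α s ≤ Real.sin (θ₀ / 2)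
  c_smooth : ContDiff ℝ ∞ c
  c_periodic : Function.Periodic c (2 * π)
  c_deriv : ∀ s, |deriv c s| ≤ N * (η * deriv τ s)
  l_nonneg : 0 ≤ l
  N_nonneg : 0 ≤ N

namespace Collar

variable {θ₀ : ℝ} (κ : Collar θ₀)

/-- The value for which the height has slope `1 + 2 m = α / sin (θ / 2)` at the rims; the
denominator removes the speed of the arc. The bound on `α` in `Collar` makes it nonpositive for all
times of the homotopy. -/
def slope (θ s : ℝ) : ℝ := (κ.α s / Real.sin (θ / 2) - 1) / 2

/-- The reparametrized height in the annulus. -/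
def height (θ s h : ℝ) : ℝ := bandHeight (κ.slope θ s) h

/-- The angle by which the point of the annulus at height `p` has revolved. -/
def angle (θ s p : ℝ) : ℝ :=
  θ * sweep p + 2 * κ.η * s +
    cutoff p * (κ.τ s - 2 * κ.η * s + ripple κ.N p * (κ.c s * Real.sin (θ / 2)))

/-- The parametrized annulus. -/
def bandMap (θ s h : ℝ) : E3 :=
  donut (κ.angle θ s (κ.height θ s h)) (arcPoint (θ / 2) (-(steepen κ.l (κ.height θ s h))))

/-- The angle of the Dehn twist, as a function of the scaled height. -/
def twistAngle (h : ℝ) : ℝ := -(κ.η * π * (1 - sweep h))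

theorem η_sq : κ.η ^ 2 = 1 := by
  rcases κ.η_eq with h | h <;> rw [h] <;> norm_num

theorem slope_gt {θ : ℝ} (hθ : 0 < Real.sin (θ / 2)) (s : ℝ) : -(1 / 2) < κ.slope θ s := by
  have := div_pos (κ.α_pos s) hθ
  unfold slope
  linarith

theorem slope_nonpos {θ : ℝ} (hθ : θ ∈ Icc θ₀ (2 * π - θ₀)) (s : ℝ) : κ.slope θ s ≤ 0 := by
  have := (div_le_one (sin_half_pos κ.θ₀_pos hθ)).2 ((κ.α_le s).trans (sin_half_le κ.θ₀_pos hθ))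
  unfold slope
  linarith

theorem slope_periodic (θ : ℝ) : Function.Periodic (κ.slope θ) (2 * π) := fun s => by
  simp only [slope, κ.α_periodic s]

theorem slope_two_pi_sub (θ s : ℝ) : κ.slope (2 * π - θ) s = κ.slope θ s := by
  simp only [slope, sin_half_two_pi_sub]

theorem abs_height_le_one {θ : ℝ} (hθ : 0 < Real.sin (θ / 2)) (s : ℝ) {h : ℝ} (hh : |h| ≤ 1) :
    |κ.height θ s h| ≤ 1 := abs_bandHeight_le_one (κ.slope_gt hθ s) hh

theorem angle_add_two_pi (θ s p : ℝ) : κ.angle θ (s + 2 * π) p = κ.angle θ s p + κ.η * (4 * π) := by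
  simp only [angle, κ.τ_add, κ.c_periodic s]
  ring

theorem height_add_two_pi (θ s h : ℝ) : κ.height θ (s + 2 * π) h = κ.height θ s h := by
  simp only [height, κ.slope_periodic θ s]

theorem bandMap_periodic (θ h : ℝ) : Function.Periodic (fun s => κ.bandMap θ s h) (2 * π) := by
  intro s
  simp only [bandMap, height_add_two_pi, angle_add_two_pi]
  rcases κ.η_eq with e | e
  · rw [e, one_mul]
    exact donut_periodic _ _
  · rw [e, neg_one_mul, ← sub_eq_add_neg]
    exact (donut_periodic _).sub_eq _

theorem bandMap_congr {s s' : ℝ} (θ h : ℝ)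
    (hs : Complex.exp (s * Complex.I) = Complex.exp (s' * Complex.I)) :
    κ.bandMap θ s h = κ.bandMap θ s' h := by
  obtain ⟨n, hn⟩ := Complex.exp_eq_exp_iff_exists_int.1 hs
  have : s = s' + n * (2 * π) := by
    have := congrArg Complex.im hn
    simpa using this
  rw [this]
  exact (κ.bandMap_periodic θ h).int_mul n s'

theorem angle_add_int (θ s p : ℝ) (n : ℤ) :
    κ.angle θ (s + n * (2 * π)) p = κ.angle θ s p + n * (κ.η * (4 * π)) := by
  induction n using Int.induction_on with
  | zero => simp
  | succ i ih =>
    have := κ.angle_add_two_pi θ (s + ((i : ℤ) : ℝ) * (2 * π)) p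
    rw [ih] at this
    push_cast at this ⊢
    rw [show s + ((i : ℝ) + 1) * (2 * π) = s + i * (2 * π) + 2 * π by ring, this]
    ring
  | pred i ih =>
    have := κ.angle_add_two_pi θ (s + ((-(i : ℤ) - 1 : ℤ) : ℝ) * (2 * π)) p
    rw [show s + ((-(i : ℤ) - 1 : ℤ) : ℝ) * (2 * π) + 2 * π = s + ((-(i : ℤ) : ℤ) : ℝ) * (2 * π) by
      push_cast; ring, ih] at this
    push_cast at this ⊢
    linarith

theorem hasDerivAt_angle (θ s p : ℝ) :
    HasDerivAt (fun s => κ.angle θ s p)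
      (2 * κ.η + cutoff p *
        (deriv κ.τ s - 2 * κ.η + ripple κ.N p * (deriv κ.c s * Real.sin (θ / 2)))) s := by
  have h1 : HasDerivAt κ.τ (deriv κ.τ s) s :=
    (κ.τ_smooth.differentiable (by simp) s).hasDerivAt
  have h2 : HasDerivAt κ.c (deriv κ.c s) s :=
    (κ.c_smooth.differentiable (by simp) s).hasDerivAt
  have h3 : HasDerivAt (fun s => 2 * κ.η * s) (2 * κ.η) s := by
    simpa using (hasDerivAt_id s).const_mul (2 * κ.η)
  exact (h3.const_add (θ * sweep p)).add
    (((h1.sub h3).add ((h2.mul_const _).const_mul (ripple κ.N p))).const_mul (cutoff p))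

/-- Up to the factor `η`, the derivative is a convex combination, with weight `cutoff p`, of `2` and
of `η τ'` plus a correction smaller than half of it. -/
theorem angle_deriv_pos (θ s : ℝ) {p : ℝ} (hp : |p| ≤ 1) :
    0 < κ.η * (2 * κ.η + cutoff p *
        (deriv κ.τ s - 2 * κ.η + ripple κ.N p * (deriv κ.c s * Real.sin (θ / 2)))) := by
  have h1 := κ.τ_deriv s
  have h2 := κ.c_deriv s
  have h3 := ripple_nonneg κ.N_nonneg hp
  have h4 := two_mul_ripple_lt κ.N_nonneg hp
  have h5 := cutoff_nonneg p
  have h6 := cutoff_le_one p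
  have hη : |κ.η| = 1 := by rcases κ.η_eq with e | e <;> rw [e] <;> simp
  have h7 : |κ.η * (deriv κ.c s * Real.sin (θ / 2))| ≤ κ.N * (κ.η * deriv κ.τ s) := by
    rw [abs_mul, hη, one_mul, abs_mul]
    have := Real.abs_sin_le_one (θ / 2)
    nlinarith [abs_nonneg (deriv κ.c s)]
  have h8 : 0 < κ.η * deriv κ.τ s +
      ripple κ.N p * (κ.η * (deriv κ.c s * Real.sin (θ / 2))) := by
    have := mul_le_mul_of_nonneg_left (abs_le.1 h7).1 h3
    nlinarith
  have e : κ.η * (2 * κ.η + cutoff p *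
        (deriv κ.τ s - 2 * κ.η + ripple κ.N p * (deriv κ.c s * Real.sin (θ / 2)))) =
      2 * (1 - cutoff p) + cutoff p * (κ.η * deriv κ.τ s +
      ripple κ.N p * (κ.η * (deriv κ.c s * Real.sin (θ / 2)))) := by
    linear_combination (2 - 2 * cutoff p) * κ.η_sq
  rw [e]
  rcases h6.lt_or_eq with h | h
  · have := mul_nonneg h5 h8.le
    linarith
  · rw [h]
    linarith

theorem strictMono_angle (θ : ℝ) {p : ℝ} (hp : |p| ≤ 1) :
    StrictMono (fun s => κ.η * κ.angle θ s p) := by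
  refine strictMono_of_deriv_pos fun s => ?_
  rw [((κ.hasDerivAt_angle θ s p).const_mul κ.η).deriv]
  exact κ.angle_deriv_pos θ s hp

theorem exists_angle_eq (θ p t : ℝ) : ∃ s, κ.angle θ s p = t := by
  have hc : Continuous (fun s => κ.angle θ s p) :=
    continuous_iff_continuousAt.2 fun s => (κ.hasDerivAt_angle θ s p).continuousAt
  -- Each period of `s` advances the angle by `± 4π`, so the angle is unbounded in both directions.
  have key : ∀ x : ℝ, ∃ n : ℤ, x ≤ n * (κ.η * (4 * π)) := by
    intro x
    obtain ⟨m, hm⟩ := exists_nat_ge (x / (4 * π))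
    have hm' : x ≤ m * (4 * π) := (div_le_iff₀ (by positivity)).1 hm
    rcases κ.η_eq with e | e
    · exact ⟨m, by rw [e]; simpa using hm'⟩
    · exact ⟨-m, by rw [e]; simpa using hm'⟩
  obtain ⟨n, hn⟩ := key (t - κ.angle θ 0 p)
  obtain ⟨n', hn'⟩ := key (κ.angle θ 0 p - t)
  refine mem_range_of_exists_le_of_exists_ge hc ⟨0 + ((-n' : ℤ) : ℝ) * (2 * π), ?_⟩
    ⟨0 + n * (2 * π), ?_⟩
  · rw [angle_add_int]
    push_cast
    linarith
  · rw [angle_add_int]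
    linarith

/-! #### The symmetry -/

theorem twistAngle_eq_zero {h : ℝ} (hh : 1 / 2 ≤ h) : κ.twistAngle h = 0 := by
  simp [twistAngle, sweep_eq_one hh]

theorem twistAngle_eq {h : ℝ} (hh : h ≤ -(1 / 2)) : κ.twistAngle h = -κ.η * (2 * π) := by
  rw [twistAngle, sweep_eq_neg_one hh]
  ring

theorem twistAngle_neg (h : ℝ) : κ.twistAngle (-h) = -κ.η * (2 * π) - κ.twistAngle h := by
  simp only [twistAngle, sweep_neg]
  ring

/-- Outside the middle zone the twist is `0` or a full turn, invisible to periodic data. The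
functions that depend on `ρ` enter the angle only there. -/
theorem periodic_twistAngle {f : ℝ → ℝ} (hf : Function.Periodic f (2 * π)) (s : ℝ) {h : ℝ}
    (hh : 1 / 2 < |h|) : f (s + κ.twistAngle h) = f s := by
  rcases lt_abs.1 hh with h1 | h1
  · rw [κ.twistAngle_eq_zero h1.le, add_zero]
  · rw [κ.twistAngle_eq (by linarith)]
    rcases κ.η_eq with e | e
    · rw [e, neg_one_mul, ← sub_eq_add_neg, hf.sub_eq]
    · rw [e, neg_neg, one_mul, hf s]

/-- In the middle zone the height does not depend on the slope; outside it the slope is not changed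
by the twist. -/
theorem height_twist (θ s h : ℝ) :
    κ.height θ (s + κ.twistAngle h) (-h) = -κ.height (2 * π - θ) s h := by
  simp only [height, bandHeight_neg, slope_two_pi_sub]
  by_cases hh : |h| ≤ 1 / 2
  · rw [bandHeight_eq_self _ hh, bandHeight_eq_self _ hh]
  · rw [κ.periodic_twistAngle (κ.slope_periodic θ) s (not_le.1 hh)]

/-- In the middle zone the angle is `θ * sweep p + 2ηs`, and the twist is made so that `2η *
twistAngle p = -2π (1 - sweep p)`, which is the discrepancy between the two times. In the collar
zones `τ s - 2ηs` and `c` are periodic. -/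
theorem angle_twist (θ s p : ℝ) :
    κ.angle (2 * π - θ) s p = κ.angle θ (s + κ.twistAngle p) (-p) + 2 * π := by
  have hX : cutoff p * (κ.τ (s + κ.twistAngle p) - 2 * κ.η * (s + κ.twistAngle p) +
      ripple κ.N p * (κ.c (s + κ.twistAngle p) * Real.sin (θ / 2))) =
      cutoff p * (κ.τ s - 2 * κ.η * s + ripple κ.N p * (κ.c s * Real.sin (θ / 2))) := by
    by_cases hh : |p| ≤ 1 / 2
    · rw [cutoff_eq_zero hh, zero_mul, zero_mul]
    · rw [κ.periodic_twistAngle κ.c_periodic s (not_le.1 hh)]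
      have hd : Function.Periodic (fun s => κ.τ s - 2 * κ.η * s) (2 * π) := fun s => by
        simp only [κ.τ_add]
        ring
      have := κ.periodic_twistAngle hd s (not_le.1 hh)
      rw [this]
  simp only [angle, cutoff_neg, sweep_neg, ripple_neg, sin_half_two_pi_sub]
  rw [hX, twistAngle]
  linear_combination (-2 * π * (1 - sweep p)) * (-κ.η_sq)

theorem twistAngle_height {θ : ℝ} (hθ : θ ∈ Icc θ₀ (2 * π - θ₀)) (s : ℝ) {h : ℝ} (hh : |h| ≤ 1) :
    κ.twistAngle (κ.height θ s h) = κ.twistAngle h := by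
  have := sweep_bandHeight (κ.slope_gt (sin_half_pos κ.θ₀_pos hθ) s) (κ.slope_nonpos hθ s) hh
  rw [twistAngle, height, this, twistAngle]

/-- The extra `2π` in the angle changes the sign of the arc coordinate, and so does the passage from
`α_{θ/2}` to `α_{π-θ/2}`. -/
theorem bandMap_twist {θ : ℝ} (hθ : θ ∈ Icc θ₀ (2 * π - θ₀)) (s : ℝ) {h : ℝ} (hh : |h| ≤ 1) :
    κ.bandMap θ (s + κ.twistAngle h) (-h) = κ.bandMap (2 * π - θ) s h := by
  have h1 := κ.twistAngle_height (two_pi_sub_mem hθ) s hh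
  have h2 : (2 * π - θ) / 2 = π - θ / 2 := by ring
  rw [bandMap, bandMap, height_twist, angle_twist, h1, steepen_neg, neg_neg, donut_two_pi, h2,
    arcPoint_pi_sub, neg_neg, neg_neg]

/-! #### Injectivity and surjectivity -/

theorem injective_of_angle_height {θ : ℝ} (hθ : θ ∈ Icc θ₀ (2 * π - θ₀)) {s s' h h' : ℝ}
    (hh : |h| ≤ 1) (hh' : |h'| ≤ 1) (n : ℤ) (hp : κ.height θ s' h' = κ.height θ s h)
    (ht : κ.angle θ s' (κ.height θ s' h') = κ.angle θ s (κ.height θ s h) + n * (4 * π)) :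
    h' = h ∧ ∃ k : ℤ, s' = s + k * (2 * π) := by
  have hs := sin_half_pos κ.θ₀_pos hθ
  -- A gain of `4πn` in the angle amounts to `ηn` periods of `s`, since `η = ± 1`.
  have hk : ∃ k : ℤ, (n : ℝ) = k * κ.η := by
    rcases κ.η_eq with e | e
    · exact ⟨n, by simp [e]⟩
    · exact ⟨-n, by simp [e]⟩
  obtain ⟨k, hk⟩ := hk
  rw [hp, hk, mul_assoc, ← angle_add_int] at ht
  have hs' : s' = s + k * (2 * π) :=
    (κ.strictMono_angle θ (κ.abs_height_le_one hs s hh)).injective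
      (congrArg (fun x => κ.η * x) ht)
  refine ⟨?_, k, hs'⟩
  have e : κ.height θ s' h' = κ.height θ s h' := by
    rw [hs']
    simp only [height]
    rw [(κ.slope_periodic θ).int_mul k s]
  rw [e] at hp
  exact (strictMonoOn_bandHeight (κ.slope_gt hs s) (κ.slope_nonpos hθ s)).injOn
    (abs_le.1 hh') (abs_le.1 hh) hp

theorem height_eq_of_arcPoint_eq {θ : ℝ} (hθ : 0 < Real.sin (θ / 2)) {p p' : ℝ} (hp : |p| ≤ 1)
    (hp' : |p'| ≤ 1)
    (h : arcPoint (θ / 2) (-(steepen κ.l p')) = arcPoint (θ / 2) (-(steepen κ.l p))) : p' = p := by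
  have h1 : ∀ p, |p| ≤ 1 → -(steepen κ.l p) ∈ Icc (-1 : ℝ) 1 := fun p hp => by
    have := abs_steepen_le_one κ.l_nonneg hp
    rw [← abs_neg] at this
    exact abs_le.1 this
  have h2 := (strictMonoOn_arcPoint_im hθ).injOn (h1 p' hp') (h1 p hp) (congrArg Complex.im h)
  exact (strictMonoOn_steepen κ.l_nonneg).injOn (abs_le.1 hp') (abs_le.1 hp) (neg_injective h2)

theorem abs_neg_steepen_le_one {p : ℝ} (hp : |p| ≤ 1) :
    |-(steepen κ.l p)| ≤ 1 := by
  rw [abs_neg]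
  exact abs_steepen_le_one κ.l_nonneg hp

theorem bandMap_mem_annulus {θ : ℝ} (hθ : 0 < Real.sin (θ / 2)) (s : ℝ) {h : ℝ} (hh : |h| ≤ 1) :
    κ.bandMap θ s h ∈ annulus (θ / 2) := by
  rw [annulus_eq]
  exact ⟨_, _, arcPoint_mem hθ (κ.abs_neg_steepen_le_one (κ.abs_height_le_one hθ s hh)), rfl⟩

theorem exists_bandMap_eq {θ : ℝ} (hθ : 0 < Real.sin (θ / 2)) {p : E3}
    (hp : p ∈ annulus (θ / 2)) : ∃ s h, |h| ≤ 1 ∧ κ.bandMap θ s h = p := by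
  rw [annulus_eq] at hp
  obtain ⟨t, w, hw, rfl⟩ := hp
  obtain ⟨q, hq, rfl⟩ := exists_arcPoint_eq hθ hw
  obtain ⟨p, hp, hpq⟩ := exists_steepen_eq κ.l_nonneg (q := -q) (by rwa [abs_neg])
  obtain ⟨s, hs⟩ := κ.exists_angle_eq θ p t
  obtain ⟨h, hh, e⟩ := exists_bandHeight_eq (κ.slope_gt hθ s) hp
  refine ⟨s, h, hh, ?_⟩
  have e' : κ.height θ s h = p := e
  rw [bandMap, e', hs, hpq, neg_neg]

/-- The double points of the annulus. -/
theorem bandMap_eq_bandMap {θ : ℝ} (hθ : θ ∈ Icc θ₀ (2 * π - θ₀)) {s s' h h' : ℝ}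
    (hh : |h| ≤ 1) (hh' : |h'| ≤ 1) (he : κ.bandMap θ s h = κ.bandMap θ s' h') :
    (h' = h ∧ ∃ k : ℤ, s' = s + k * (2 * π)) ∨
      θ = π ∧ h' = -h ∧ ∃ k : ℤ, s' = s + κ.twistAngle h + k * (2 * π) := by
  have hs := sin_half_pos κ.θ₀_pos hθ
  have key : ∀ {s s' h h' : ℝ}, |h| ≤ 1 → |h'| ≤ 1 → κ.bandMap θ s h = κ.bandMap θ s' h' →
      (h' = h ∧ ∃ k : ℤ, s' = s + k * (2 * π)) ∨
      θ = π ∧ ∃ n : ℤ, κ.angle θ s' (κ.height θ s' h') =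
        κ.angle θ s (κ.height θ s h) + 2 * π + n * (4 * π) ∧
        arcPoint (θ / 2) (-(steepen κ.l (κ.height θ s' h'))) =
          -arcPoint (θ / 2) (-(steepen κ.l (κ.height θ s h))) := by
    intro s s' h h' hh hh' he
    have hp := κ.abs_height_le_one hs s hh
    have hp' := κ.abs_height_le_one hs s' hh'
    have hm := arcPoint_mem hs (κ.abs_neg_steepen_le_one hp)
    have hm' := arcPoint_mem hs (κ.abs_neg_steepen_le_one hp')
    obtain ⟨n, ⟨h1, h2⟩ | ⟨h1, h2⟩⟩ := (donut_eq_donut_iff hm.1 hm'.1).1 he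
    · exact Or.inl (κ.injective_of_angle_height hθ hh hh' n
        (κ.height_eq_of_arcPoint_eq hs hp hp' h2) h1)
    · refine Or.inr ⟨?_, n, h1, h2⟩
      -- Both `w` and `-w` satisfy the equation of the arc; adding the two equations leaves only the
      -- multiple of `cos (θ / 2)`.
      have e1 := hm.2
      have e2 := hm'.2
      rw [h2, norm_neg, Complex.neg_re] at e2
      have hc : Real.cos (θ / 2) *
          (‖arcPoint (θ / 2) (-(steepen κ.l (κ.height θ s h)))‖ ^ 2 + 1) = 0 := by linarith
      have hc' : Real.cos (θ / 2) = 0 := (mul_eq_zero.1 hc).resolve_right (by positivity)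
      have hθ' : θ / 2 = π / 2 := by
        refine Real.injOn_cos ⟨?_, ?_⟩ ⟨?_, ?_⟩ (hc'.trans Real.cos_pi_div_two.symm) <;>
          linarith [hθ.1, hθ.2, Real.pi_pos, κ.θ₀_pos]
      linarith
  rcases key hh hh' he with h1 | ⟨h1, n, h2, h3⟩
  · exact Or.inl h1
  · refine Or.inr ⟨h1, ?_⟩
    -- At `θ = π` the symmetry preserves the band map, so the second sheet reduces to injectivity at
    -- the twisted point. Its angle is smaller by `2π`; with the `2π` between the sheets this makes
    -- one more period, whence `n + 1`.
    have hθπ : 2 * π - θ = θ := by rw [h1]; ring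
    have hhn : |-h| ≤ 1 := by rwa [abs_neg]
    have hht := κ.height_twist θ s h
    have hat := κ.angle_twist θ s (κ.height θ s h)
    rw [hθπ] at hht hat
    rw [κ.twistAngle_height hθ s hh, ← hht] at hat
    refine κ.injective_of_angle_height hθ hhn hh' (n + 1) ?_ ?_
    · rw [hht]
      refine κ.height_eq_of_arcPoint_eq hs ?_ (κ.abs_height_le_one hs s' hh') ?_
      · rw [abs_neg]
        exact κ.abs_height_le_one hs s hh
      · have e : π - θ / 2 = θ / 2 := by rw [h1]; ring
        have e' := arcPoint_pi_sub (θ / 2) (steepen κ.l (κ.height θ s h))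
        rw [e] at e'
        rw [h3, steepen_neg, neg_neg, e']
    · rw [h2, hat]
      push_cast
      ring

end Collar

theorem contDiffAt_arcPoint {θ q : ℝ} (hθ : 0 < Real.sin (θ / 2)) :
    ContDiffAt ℝ ∞ (fun x : ℝ × ℝ => arcPoint (x.1 / 2) x.2) (θ, q) := by
  have hd : ContDiff ℝ ∞ (fun x : ℝ × ℝ =>
      (1 + Real.sin (x.1 / 2)) + (1 - Real.sin (x.1 / 2)) * x.2 ^ 2) := by fun_prop
  have h1 : ContDiffAt ℝ ∞ (fun x : ℝ × ℝ => (arcPoint (x.1 / 2) x.2).re) (θ, q) :=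
    ContDiffAt.div (by fun_prop) hd.contDiffAt (arcPoint_denom_pos hθ q).ne'
  have h2 : ContDiffAt ℝ ∞ (fun x : ℝ × ℝ => (arcPoint (x.1 / 2) x.2).im) (θ, q) :=
    ContDiffAt.div (by fun_prop) hd.contDiffAt (arcPoint_denom_pos hθ q).ne'
  exact Complex.equivRealProdCLM.symm.contDiff.contDiffAt.comp (θ, q) (h1.prodMk h2)

namespace Collar

variable {θ₀ : ℝ} (κ : Collar θ₀)

/-! #### Smoothness -/

theorem contDiffAt_height {θ s h : ℝ} (hθ : 0 < Real.sin (θ / 2)) (hh : |h| ≤ 1) :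
    ContDiffAt ℝ ∞ (fun q : ℝ × ℝ × ℝ => κ.height q.1 q.2.1 q.2.2) (θ, s, h) := by
  have hα : ContDiff ℝ ∞ (fun q : ℝ × ℝ × ℝ => κ.α q.2.1) := κ.α_smooth.comp (by fun_prop)
  have hX : ContDiff ℝ ∞ (fun q : ℝ × ℝ × ℝ => cutoff q.2.2) := contDiff_cutoff.comp (by fun_prop)
  have hS : ContDiff ℝ ∞ (fun q : ℝ × ℝ × ℝ => Real.sin (q.1 / 2)) := by fun_prop
  have h1 : ContDiffAt ℝ ∞ (fun q : ℝ × ℝ × ℝ => κ.slope q.1 q.2.1) (θ, s, h) := by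
    have h0 : ContDiffAt ℝ ∞ (fun q : ℝ × ℝ × ℝ => κ.α q.2.1 / Real.sin (q.1 / 2)) (θ, s, h) :=
      ContDiffAt.div hα.contDiffAt hS.contDiffAt (by exact hθ.ne')
    simp only [slope]
    exact (h0.sub contDiffAt_const).div_const 2
  have h2 : ContDiffAt ℝ ∞ (fun q : ℝ × ℝ × ℝ =>
      1 + κ.slope q.1 q.2.1 * cutoff q.2.2 * (1 - q.2.2 ^ 2)) (θ, s, h) :=
    contDiffAt_const.add ((h1.mul hX.contDiffAt).mul (by fun_prop))
  have h3 : ContDiffAt ℝ ∞ (fun q : ℝ × ℝ × ℝ => q.2.2) (θ, s, h) := by fun_prop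
  simp only [height, bandHeight]
  exact h3.div h2 (bandHeight_denom_pos (κ.slope_gt hθ s) hh).ne'

theorem contDiffAt_ripple {p : ℝ} (hp : |p| ≤ 1) : ContDiffAt ℝ ∞ (ripple κ.N) p :=
  ContDiffAt.div (by fun_prop) (by fun_prop)
    (mul_pos two_pos (ripple_denom_pos κ.N_nonneg hp)).ne'

theorem contDiffAt_steepen {p : ℝ} (hp : |p| ≤ 1) : ContDiffAt ℝ ∞ (steepen κ.l) p :=
  ContDiffAt.div (by fun_prop) (by fun_prop) (ripple_denom_pos κ.l_nonneg hp).ne'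

theorem contDiffAt_angle {θ s p : ℝ} (hp : |p| ≤ 1) :
    ContDiffAt ℝ ∞ (fun q : ℝ × ℝ × ℝ => κ.angle q.1 q.2.1 q.2.2) (θ, s, p) := by
  have hτ : ContDiff ℝ ∞ (fun q : ℝ × ℝ × ℝ => κ.τ q.2.1) := κ.τ_smooth.comp (by fun_prop)
  have hc : ContDiff ℝ ∞ (fun q : ℝ × ℝ × ℝ => κ.c q.2.1) := κ.c_smooth.comp (by fun_prop)
  have hX : ContDiff ℝ ∞ (fun q : ℝ × ℝ × ℝ => cutoff q.2.2) := contDiff_cutoff.comp (by fun_prop)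
  have hv : ContDiff ℝ ∞ (fun q : ℝ × ℝ × ℝ => sweep q.2.2) := contDiff_sweep.comp (by fun_prop)
  have hS : ContDiff ℝ ∞ (fun q : ℝ × ℝ × ℝ => Real.sin (q.1 / 2)) := by fun_prop
  have hr : ContDiffAt ℝ ∞ (fun q : ℝ × ℝ × ℝ => ripple κ.N q.2.2) (θ, s, p) :=
    ContDiffAt.comp (θ, s, p) (κ.contDiffAt_ripple hp) (by fun_prop)
  exact ((contDiffAt_fst.mul hv.contDiffAt).add (by fun_prop)).add (hX.contDiffAt.mul
    ((hτ.contDiffAt.sub (by fun_prop)).add (hr.mul (hc.contDiffAt.mul hS.contDiffAt))))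

theorem contDiffAt_bandMap {θ s h : ℝ} (hθ : 0 < Real.sin (θ / 2)) (hh : |h| ≤ 1) :
    ContDiffAt ℝ ∞ (fun q : ℝ × ℝ × ℝ => κ.bandMap q.1 q.2.1 q.2.2) (θ, s, h) := by
  have hp := κ.abs_height_le_one hθ s hh
  have h1 := κ.contDiffAt_height (s := s) hθ hh
  have h2 : ContDiffAt ℝ ∞ (fun q : ℝ × ℝ × ℝ =>
      κ.angle q.1 q.2.1 (κ.height q.1 q.2.1 q.2.2)) (θ, s, h) :=
    ContDiffAt.comp (θ, s, h) (g := fun q : ℝ × ℝ × ℝ => κ.angle q.1 q.2.1 q.2.2)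
      (f := fun q : ℝ × ℝ × ℝ => (q.1, q.2.1, κ.height q.1 q.2.1 q.2.2)) (κ.contDiffAt_angle hp)
      (contDiffAt_fst.prodMk ((by fun_prop : ContDiffAt ℝ ∞ (fun q : ℝ × ℝ × ℝ => q.2.1) _).prodMk h1))
  have h3 : ContDiffAt ℝ ∞ (fun q : ℝ × ℝ × ℝ =>
      -(steepen κ.l (κ.height q.1 q.2.1 q.2.2))) (θ, s, h) :=
    (ContDiffAt.comp (θ, s, h) (κ.contDiffAt_steepen hp) h1).neg
  have h4 : ContDiffAt ℝ ∞ (fun q : ℝ × ℝ × ℝ =>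
      arcPoint (q.1 / 2) (-(steepen κ.l (κ.height q.1 q.2.1 q.2.2)))) (θ, s, h) :=
    ContDiffAt.comp (θ, s, h) (g := fun x : ℝ × ℝ => arcPoint (x.1 / 2) x.2)
      (f := fun q : ℝ × ℝ × ℝ => (q.1, -(steepen κ.l (κ.height q.1 q.2.1 q.2.2))))
      (contDiffAt_arcPoint hθ) (contDiffAt_fst.prodMk h3)
  simp only [bandMap]
  exact ContDiffAt.comp (θ, s, h) (g := fun q : ℝ × ℂ => donut q.1 q.2)
    (f := fun q : ℝ × ℝ × ℝ => (κ.angle q.1 q.2.1 (κ.height q.1 q.2.1 q.2.2),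
      arcPoint (q.1 / 2) (-(steepen κ.l (κ.height q.1 q.2.1 q.2.2)))))
    contDiff_donut.contDiffAt (h2.prodMk h4)

/-! #### Boundary behaviour -/

theorem height_one (θ s : ℝ) : κ.height θ s 1 = 1 := bandHeight_one _

theorem angle_eq_of_near_one {θ s p : ℝ} (hp : 3 / 4 ≤ p) :
    κ.angle θ s p = κ.τ s + θ + ripple κ.N p * (κ.c s * Real.sin (θ / 2)) := by
  rw [angle, sweep_eq_one (by linarith), cutoff_eq_one (hp.trans (le_abs_self p))]
  ring

theorem bandMap_one (θ s : ℝ) : κ.bandMap θ s 1 = rotZ θ (donut (κ.τ s) 1) := by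
  rw [bandMap, height_one, κ.angle_eq_of_near_one (by norm_num), ripple_one, steepen_one,
    arcPoint_neg_one, rotZ_donut]
  simp

/-- The lower rim is obtained from the upper one by the symmetry. -/
theorem bandMap_neg_one {θ : ℝ} (hθ : θ ∈ Icc θ₀ (2 * π - θ₀)) (s : ℝ) :
    κ.bandMap θ s (-1) = rotZ (-θ) (donut (κ.τ s) 1) := by
  have h := κ.bandMap_twist hθ s (h := 1) (by norm_num)
  rw [κ.twistAngle_eq_zero (by norm_num), add_zero, bandMap_one] at h
  rw [h, sub_eq_add_neg, add_comm, rotZ_add_two_pi]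

/-- The slopes `α / sin (θ/2)` of the height, `1 + 2l` of `steepen` and `sin (θ/2)` of the arc
multiply to the normal component; the slope `-1` of `ripple` gives the component along the knot.
Every `sin (θ/2)` cancels, as it must beside a rigidly rotating disc. -/
theorem hasDerivAt_bandMap_one {θ : ℝ} (hθ : 0 < Real.sin (θ / 2)) (s : ℝ) :
    HasDerivAt (fun h => κ.bandMap θ s h)
      (rotZ θ (((1 + 2 * κ.l) * κ.α s) • donutNormal (κ.τ s) 1 -
        (κ.c s * κ.α s) • donutVelocity (κ.τ s) 1 1 0)) 1 := by
  have h1 : HasDerivAt (fun h => κ.height θ s h) (κ.α s / Real.sin (θ / 2)) 1 := by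
    refine (hasDerivAt_bandHeight_one (κ.slope θ s)).congr_deriv ?_
    unfold slope
    ring
  have h2 : HasDerivAt (fun p => κ.angle θ s p) (-(κ.c s * Real.sin (θ / 2)))
      (κ.height θ s 1) := by
    rw [height_one]
    have h := ((hasDerivAt_ripple_one κ.N).mul_const (κ.c s * Real.sin (θ / 2))).const_add
      (κ.τ s + θ)
    rw [neg_one_mul] at h
    refine h.congr_of_eventuallyEq ?_
    filter_upwards [eventually_ge_nhds (by norm_num : (3 / 4 : ℝ) < 1)] with p hp
    exact κ.angle_eq_of_near_one hp
  have h3 : HasDerivAt (fun p => -(steepen κ.l p)) (-(1 + 2 * κ.l)) (κ.height θ s 1) := by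
    rw [height_one]
    refine (hasDerivAt_steepen (l := κ.l) (p := 1) (by simp)).neg.congr_deriv ?_
    norm_num
    ring
  have h4 := hasDerivAt_arcPoint_neg_one hθ
  rw [← steepen_one κ.l, ← κ.height_one θ s] at h4
  have h5 := (HasDerivAt.scomp 1 h4 (h3.comp 1 h1))
  have h6 := hasDerivAt_donut (h2.comp 1 h1) h5
  refine h6.congr_deriv ?_
  have hS := hθ.ne'
  rw [← rotZL_apply, map_sub, map_smul, map_smul, rotZL_apply, rotZL_apply,
    ← donutVelocity_zero_self, rotZ_donutVelocity, rotZ_donutVelocity, ← donutVelocity_smul,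
    ← donutVelocity_smul, mul_zero, mul_one, mul_zero, smul_zero, mul_one, sub_eq_add_neg,
    ← neg_one_smul ℝ (donutVelocity _ _ _ _), ← donutVelocity_smul, ← donutVelocity_add, zero_add,
    smul_zero, add_zero]
  have e1 : κ.angle θ s (κ.height θ s 1) = κ.τ s + θ := by
    rw [height_one, κ.angle_eq_of_near_one (by norm_num), ripple_one]
    ring
  have e2 : arcPoint (θ / 2) (-(steepen κ.l (κ.height θ s 1))) =
      Complex.exp (((-(θ / 2) : ℝ) : ℂ) * Complex.I) := by
    rw [height_one, steepen_one, arcPoint_neg_one]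
  simp only [Function.comp_apply]
  rw [e1, e2]
  congr 1
  · field_simp
  · rw [smul_neg, smul_smul, ← neg_smul]
    congr 1
    field_simp

/-! #### Immersivity -/

/-- The derivative is triangular. For a kernel vector `(a, b)` the donut map forces the velocities
of angle and arc coordinate to vanish. Then the height velocity `p'` is zero by monotonicity along
the arc, `a = 0` by monotonicity of the angle in `s`, and `b = 0` by monotonicity of `bandHeight`.
-/
theorem injective_fderiv_bandMap {θ : ℝ} (hθ : θ ∈ Icc θ₀ (2 * π - θ₀)) (s : ℝ) {h : ℝ}
    (hh : |h| ≤ 1) :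
    Function.Injective (fderiv ℝ (fun q : ℝ × ℝ => κ.bandMap θ q.1 q.2) (s, h)) := by
  have hs := sin_half_pos κ.θ₀_pos hθ
  have hincl : ∀ q : ℝ × ℝ, ContDiffAt ℝ ∞ (fun q : ℝ × ℝ => (θ, q.1, q.2)) q := fun q => by
    fun_prop
  have hp := κ.abs_height_le_one hs s hh
  have hB : DifferentiableAt ℝ (fun q : ℝ × ℝ => κ.bandMap θ q.1 q.2) (s, h) :=
    (ContDiffAt.comp (s, h) (g := fun q : ℝ × ℝ × ℝ => κ.bandMap q.1 q.2.1 q.2.2)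
      (f := fun q : ℝ × ℝ => (θ, q.1, q.2)) (κ.contDiffAt_bandMap hs hh) (hincl (s, h))).differentiableAt (by simp)
  have hH : DifferentiableAt ℝ (fun q : ℝ × ℝ => κ.height θ q.1 q.2) (s, h) :=
    (ContDiffAt.comp (s, h) (g := fun q : ℝ × ℝ × ℝ => κ.height q.1 q.2.1 q.2.2)
      (f := fun q : ℝ × ℝ => (θ, q.1, q.2)) (κ.contDiffAt_height hs hh) (hincl (s, h))).differentiableAt (by simp)
  have hA : DifferentiableAt ℝ (fun q : ℝ × ℝ => κ.angle θ q.1 q.2) (s, κ.height θ s h) :=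
    (ContDiffAt.comp (s, κ.height θ s h) (g := fun q : ℝ × ℝ × ℝ => κ.angle q.1 q.2.1 q.2.2)
      (f := fun q : ℝ × ℝ => (θ, q.1, q.2)) (κ.contDiffAt_angle hp) (hincl _)).differentiableAt
      (by simp)
  rw [injective_iff_map_eq_zero]
  rintro ⟨a, b⟩ hv
  have hcurve : HasDerivAt (fun e : ℝ => (s + e * a, h + e * b)) (a, b) 0 := by
    have h1 := ((hasDerivAt_id (0 : ℝ)).mul_const a).const_add s
    have h2 := ((hasDerivAt_id (0 : ℝ)).mul_const b).const_add h
    simpa using h1.prodMk h2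
  have hcurve0 : (s + 0 * a, h + 0 * b) = (s, h) := by simp
  have hBc : HasDerivAt (fun e : ℝ => κ.bandMap θ (s + e * a) (h + e * b)) 0 0 :=
    (HasFDerivAt.comp_hasDerivAt_of_eq (l := fun q : ℝ × ℝ => κ.bandMap θ q.1 q.2)
      (f := fun e : ℝ => (s + e * a, h + e * b)) 0 hB.hasFDerivAt hcurve hcurve0.symm).congr_deriv hv
  obtain ⟨p', hpc⟩ : ∃ p', HasDerivAt (fun e : ℝ => κ.height θ (s + e * a) (h + e * b)) p' 0 :=
    ⟨_, HasFDerivAt.comp_hasDerivAt_of_eq (l := fun q : ℝ × ℝ => κ.height θ q.1 q.2)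
      (f := fun e : ℝ => (s + e * a, h + e * b)) 0 hH.hasFDerivAt hcurve hcurve0.symm⟩
  have hcurveA : HasDerivAt (fun e : ℝ => (s + e * a, κ.height θ (s + e * a) (h + e * b)))
      (a, p') 0 := by
    have h1 := ((hasDerivAt_id (0 : ℝ)).mul_const a).const_add s
    rw [one_mul] at h1
    exact h1.prodMk hpc
  have hcurveA0 : (s + 0 * a, κ.height θ (s + 0 * a) (h + 0 * b)) = (s, κ.height θ s h) := by simp
  have hAc : HasDerivAt (fun e : ℝ => κ.angle θ (s + e * a) (κ.height θ (s + e * a) (h + e * b)))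
      (fderiv ℝ (fun q : ℝ × ℝ => κ.angle θ q.1 q.2) (s, κ.height θ s h) (a, p')) 0 :=
    HasFDerivAt.comp_hasDerivAt_of_eq (l := fun q : ℝ × ℝ => κ.angle θ q.1 q.2)
      (f := fun e : ℝ => (s + e * a, κ.height θ (s + e * a) (h + e * b))) 0 hA.hasFDerivAt hcurveA
      hcurveA0.symm
  have hp0 : κ.height θ (s + 0 * a) (h + 0 * b) = κ.height θ s h := by simp
  have hq := (HasDerivAt.comp_of_eq 0
    (hasDerivAt_steepen (ripple_denom_pos κ.l_nonneg hp).ne') hpc hp0.symm).neg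
  have hw := HasDerivAt.scomp_of_eq (h := fun e => -(steepen κ.l (κ.height θ (s + e * a) (h + e * b))))
    0 (hasDerivAt_arcPoint hs (-(steepen κ.l (κ.height θ s h)))) hq (by rw [hp0])
  have hD := (hasDerivAt_donut hAc hw).unique hBc
  simp only [Function.comp_apply, zero_mul, add_zero] at hD
  obtain ⟨hA0, hw0⟩ := donutVelocity_eq_zero
    (norm_arcPoint_le_one hs (κ.abs_neg_steepen_le_one hp)) hD
  have hpos1 := steepen_deriv_pos κ.l_nonneg hp
  have hpos2 := arcPoint_im_deriv_pos hs (κ.abs_neg_steepen_le_one hp)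
  have hp' : p' = 0 := by
    have him := congrArg Complex.im hw0
    rw [Complex.real_smul, Complex.im_ofReal_mul, Complex.zero_im] at him
    have := (mul_eq_zero.1 him).resolve_right hpos2.ne'
    exact (mul_eq_zero.1 (neg_eq_zero.1 this)).resolve_left hpos1.ne'
  subst hp'
  have ha : a = 0 := by
    have hline : HasDerivAt (fun x : ℝ => (x, κ.height θ s h)) (1, 0) s :=
      (hasDerivAt_id s).prodMk (hasDerivAt_const s _)
    have h0 : HasDerivAt (fun x => κ.angle θ x (κ.height θ s h))
        (fderiv ℝ (fun q : ℝ × ℝ => κ.angle θ q.1 q.2) (s, κ.height θ s h) (1, 0)) s :=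
      HasFDerivAt.comp_hasDerivAt (l := fun q : ℝ × ℝ => κ.angle θ q.1 q.2)
        (f := fun x : ℝ => (x, κ.height θ s h)) s hA.hasFDerivAt hline
    have h1 := h0.unique (κ.hasDerivAt_angle θ s (κ.height θ s h))
    have h2 : (a, (0 : ℝ)) = a • ((1 : ℝ), (0 : ℝ)) := by simp
    rw [h2, map_smul, h1, smul_eq_mul] at hA0
    refine (mul_eq_zero.1 hA0).resolve_right fun h3 => ?_
    have := κ.angle_deriv_pos θ s hp
    rw [h3, mul_zero] at this
    exact this.false
  subst ha
  have hb : b = 0 := by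
    have hd := bandHeight_denom_pos (κ.slope_gt hs s) hh
    have hpos := bandHeight_deriv_pos (κ.slope_gt hs s) (κ.slope_nonpos hθ s) hh
    have h1 := hasDerivAt_bandHeight hd.ne'
    have h2 : HasDerivAt (fun e : ℝ => h + e * b) b 0 := by
      simpa using ((hasDerivAt_id (0 : ℝ)).mul_const b).const_add h
    have e0 : h = h + 0 * b := by simp
    have h3 := HasDerivAt.comp (0 : ℝ) (h₂ := bandHeight (κ.slope θ s)) (by rw [← e0]; exact h1) h2
    have h4 : HasDerivAt (bandHeight (κ.slope θ s) ∘ fun e : ℝ => h + e * b) 0 0 := by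
      refine hpc.congr_of_eventuallyEq (Filter.Eventually.of_forall fun e => ?_)
      simp [height]
    exact (mul_eq_zero.1 (h3.unique h4)).resolve_left hpos.ne'
  rw [hb]
  rfl

end Collar

/-! ### The boundary of the spanning disc -/

/-- A smooth curve in the unit circle has a smooth angle. -/
theorem exists_smooth_lift {m : ℝ → ℂ} (hm : ContDiff ℝ ∞ m) (h1 : ∀ s, ‖m s‖ = 1) :
    ∃ φ : ℝ → ℝ, ContDiff ℝ ∞ φ ∧ ∀ s, m s = Complex.exp (φ s * Complex.I) := by
  have hm' : ContDiff ℝ ∞ (deriv m) := (contDiff_infty_iff_deriv.1 hm).2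
  have hd : ∀ s, HasDerivAt m (deriv m s) s := fun s =>
    (hm.differentiable (by simp) s).hasDerivAt
  -- The angular velocity of the curve; its integral, started at the argument of `m 0`, is the
  -- desired angle.
  set w : ℝ → ℝ := fun s => (m s).re * (deriv m s).im - (m s).im * (deriv m s).re with hw
  have hre : ∀ {f : ℝ → ℂ}, ContDiff ℝ ∞ f → ContDiff ℝ ∞ (fun s => (f s).re) := fun hf =>
    Complex.reCLM.contDiff.comp hf
  have him : ∀ {f : ℝ → ℂ}, ContDiff ℝ ∞ f → ContDiff ℝ ∞ (fun s => (f s).im) := fun hf =>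
    Complex.imCLM.contDiff.comp hf
  have hws : ContDiff ℝ ∞ w := ((hre hm).mul (him hm')).sub ((him hm).mul (hre hm'))
  have hφ : ∀ s, HasDerivAt (fun s => (m 0).arg + ∫ x in (0 : ℝ)..s, w x) (w s) s := fun s =>
    (hws.continuous.integral_hasStrictDerivAt 0 s).hasDerivAt.const_add _
  refine ⟨fun s => (m 0).arg + ∫ x in (0 : ℝ)..s, w x, ?_, ?_⟩
  · rw [contDiff_infty_iff_deriv]
    refine ⟨fun s => (hφ s).differentiableAt, ?_⟩
    rwa [show deriv (fun s => (m 0).arg + ∫ x in (0 : ℝ)..s, w x) = w from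
      funext fun s => (hφ s).deriv]
  · have hsq : ∀ s, (m s).re ^ 2 + (m s).im ^ 2 = 1 := fun s => by
      have := Complex.sq_norm (m s)
      rw [h1, Complex.normSq_apply] at this
      linarith
    have hrad : ∀ s, (m s).re * (deriv m s).re + (m s).im * (deriv m s).im = 0 := by
      intro s
      have e1 : HasDerivAt (fun s => (m s).re) (deriv m s).re s :=
        Complex.reCLM.hasFDerivAt.comp_hasDerivAt s (hd s)
      have e2 : HasDerivAt (fun s => (m s).im) (deriv m s).im s :=
        Complex.imCLM.hasFDerivAt.comp_hasDerivAt s (hd s)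
      have e3 := (e1.pow 2).add (e2.pow 2)
      have e4 : HasDerivAt ((fun s => (m s).re) ^ 2 + (fun s => (m s).im) ^ 2) 0 s :=
        (hasDerivAt_const s (1 : ℝ)).congr_of_eventuallyEq (Filter.Eventually.of_forall hsq)
      have := e3.unique e4
      norm_num at this
      linarith
    have hmw : ∀ s, deriv m s = w s * Complex.I * m s := by
      intro s
      have := hsq s
      have := hrad s
      apply Complex.ext
      · simp [hw]
        linear_combination (m s).re * hrad s - (deriv m s).re * hsq s
      · simp [hw]
        linear_combination (m s).im * hrad s - (deriv m s).im * hsq s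
    set φ : ℝ → ℝ := fun s => (m 0).arg + ∫ x in (0 : ℝ)..s, w x with hφdef
    have hexp : ∀ s, HasDerivAt (fun s => Complex.exp (-(φ s * Complex.I)))
        (Complex.exp (-(φ s * Complex.I)) * -(w s * Complex.I)) s := fun s =>
      ((hφ s).ofReal_comp.mul_const Complex.I).neg.cexp
    -- Turned back by the candidate angle, the curve is constant.
    have hf : ∀ s, HasDerivAt (fun s => m s * Complex.exp (-(φ s * Complex.I))) 0 s := by
      intro s
      refine ((hd s).mul (hexp s)).congr_deriv ?_
      rw [hmw s]
      ring
    intro s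
    have hc := is_const_of_deriv_eq_zero (fun s => (hf s).differentiableAt)
      (fun s => (hf s).deriv) s 0
    have h0 : m 0 * Complex.exp (-(φ 0 * Complex.I)) = 1 := by
      have e : φ 0 = (m 0).arg := by simp [hφdef]
      have h2 := Complex.norm_mul_exp_arg_mul_I (m 0)
      rw [h1 0, Complex.ofReal_one, one_mul] at h2
      rw [e]
      nth_rw 1 [← h2]
      rw [← Complex.exp_add, add_neg_cancel, Complex.exp_zero]
    rw [h0, Complex.exp_neg, mul_inv_eq_one₀ (Complex.exp_ne_zero _)] at hc
    exact hc

/-- The point of the circle of angle `s`. -/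
def circlePt (s : ℝ) : ℂ := Complex.exp (s * Complex.I)

theorem norm_circlePt (s : ℝ) : ‖circlePt s‖ = 1 := Complex.norm_exp_ofReal_mul_I s

theorem circlePt_mem_sphere (s : ℝ) : circlePt s ∈ sphere (0 : ℂ) 1 := by
  rw [mem_sphere_zero_iff_norm, norm_circlePt]

theorem circlePt_mem_closedBall (s : ℝ) : circlePt s ∈ closedBall (0 : ℂ) 1 :=
  sphere_subset_closedBall (circlePt_mem_sphere s)

theorem circlePt_add_two_pi (s : ℝ) : circlePt (s + 2 * π) = circlePt s := by
  simp [circlePt, add_mul, Complex.exp_add, Complex.exp_two_pi_mul_I]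

theorem circlePt_eq_iff {s s' : ℝ} : circlePt s = circlePt s' ↔ ∃ n : ℤ, s = s' + n * (2 * π) := by
  rw [circlePt, circlePt, Complex.exp_eq_exp_iff_exists_int]
  refine exists_congr fun n => ⟨fun h => ?_, fun h => ?_⟩
  · simpa using congrArg Complex.im h
  · rw [h]
    push_cast
    ring

theorem contDiff_circlePt : ContDiff ℝ ∞ circlePt :=
  (Complex.ofRealCLM.contDiff.mul contDiff_const).cexp

theorem hasDerivAt_circlePt (s : ℝ) : HasDerivAt circlePt (Complex.I * circlePt s) s := by
  have h := ((hasDerivAt_id s).ofReal_comp.mul_const Complex.I).cexp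
  refine h.congr_deriv ?_
  simp [circlePt]
  ring

theorem mem_knot_iff {p : E3} : p ∈ knot ↔ ∃ t, p = donut t 1 := by
  constructor
  · rintro ⟨t, h | h⟩
    · exact ⟨t, h⟩
    · exact ⟨t + 2 * π, by rw [h, donut_two_pi]⟩
  · rintro ⟨t, h⟩
    exact ⟨t, Or.inl h⟩

theorem uniqueDiffOn_unitDisc : UniqueDiffOn ℝ (closedBall (0 : ℂ) 1) :=
  uniqueDiffOn_convex (convex_closedBall 0 1)
    ⟨0, ball_subset_interior_closedBall (mem_ball_self one_pos)⟩

theorem donut_one_eq_iff {t t' : ℝ} : donut t 1 = donut t' 1 ↔ ∃ n : ℤ, t' = t + n * (4 * π) := by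
  rw [donut_eq_donut_iff (by simp) (by simp)]
  refine exists_congr fun n => ⟨?_, fun h => Or.inl ⟨h, rfl⟩⟩
  rintro (h | ⟨-, h⟩)
  · exact h.1
  · norm_num [Complex.ext_iff] at h

theorem contDiff_donutTangent : ContDiff ℝ ∞ (fun t => donutVelocity t 1 1 0) := by
  simp only [donutVelocity, sliceRe, sliceIm]
  rw [contDiff_euclidean]
  intro i
  fin_cases i <;> simp <;> fun_prop

theorem donutTangent_periodic : Function.Periodic (fun t => donutVelocity t 1 1 0) (4 * π) :=
  fun t => by
  have e : (t + 4 * π) / 2 = t / 2 + 2 * π := by ring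
  have e' : t + 4 * π = t + 2 * π + 2 * π := by ring
  simp only [donutVelocity, sliceRe, sliceIm, e, Real.cos_add_two_pi, Real.sin_add_two_pi]
  simp only [e', Real.cos_add_two_pi, Real.sin_add_two_pi]

/-- At `donut t 1` the distance from the axis minus `√2` and the height are `cos (t/2)` and `sin
(t/2)`, so the knot is carried to the unit circle by a map that is smooth off the axis. -/
theorem contDiff_knotCoord {γ : ℝ → E3} (hγ : ContDiff ℝ ∞ γ) (hk : ∀ s, γ s ∈ knot) :
    ∃ m : ℝ → ℂ, ContDiff ℝ ∞ m ∧
      ∀ s t, γ s = donut t 1 → m s = Complex.exp (((t / 2 : ℝ) : ℂ) * Complex.I) := by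
  have hcoord : ∀ i, ContDiff ℝ ∞ (fun s => γ s i) := contDiff_euclidean.1 hγ
  have hval : ∀ t, (donut t 1) 0 ^ 2 + (donut t 1) 1 ^ 2 = (√2 + sliceRe t 1) ^ 2 := fun t => by
    simp [donut_eq]
    linear_combination (√2 + sliceRe t 1) ^ 2 * Real.sin_sq_add_cos_sq t
  have hpos : ∀ s, γ s 0 ^ 2 + γ s 1 ^ 2 ≠ 0 := fun s => by
    obtain ⟨t, ht⟩ := mem_knot_iff.1 (hk s)
    rw [ht, hval]
    exact (pow_pos (radius_pos (by simp)) 2).ne'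
  have h1 : ContDiff ℝ ∞ (fun s => √(γ s 0 ^ 2 + γ s 1 ^ 2) - √2) :=
    ((((hcoord 0).pow 2).add ((hcoord 1).pow 2)).sqrt hpos).sub contDiff_const
  refine ⟨fun s => ⟨√(γ s 0 ^ 2 + γ s 1 ^ 2) - √2, γ s 2⟩,
    Complex.equivRealProdCLM.symm.contDiff.comp (h1.prodMk (hcoord 2)), fun s t ht => ?_⟩
  apply Complex.ext
  · simp only [ht, hval]
    rw [Real.sqrt_sq (radius_pos (by simp)).le, Complex.exp_ofReal_mul_I_re]
    simp [sliceRe]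
  · simp only [ht]
    rw [Complex.exp_ofReal_mul_I_im]
    simp [donut_eq, sliceIm]

/-- A smooth closed curve in the knot lifts to the line. -/
theorem exists_knot_lift {γ : ℝ → E3} (hγ : ContDiff ℝ ∞ γ) (hk : ∀ s, γ s ∈ knot) :
    ∃ τ : ℝ → ℝ, ContDiff ℝ ∞ τ ∧ ∀ s, γ s = donut (τ s) 1 := by
  obtain ⟨m, hm, hmt⟩ := contDiff_knotCoord hγ hk
  obtain ⟨φ, hφ, hmφ⟩ := exists_smooth_lift hm fun s => by
    obtain ⟨t, ht⟩ := mem_knot_iff.1 (hk s)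
    rw [hmt s t ht, Complex.norm_exp_ofReal_mul_I]
  refine ⟨fun s => 2 * φ s, contDiff_const.mul hφ, fun s => ?_⟩
  obtain ⟨t, ht⟩ := mem_knot_iff.1 (hk s)
  have h := (hmφ s).symm.trans (hmt s t ht)
  obtain ⟨n, hn⟩ := circlePt_eq_iff.1 h
  rw [ht, donut_one_eq_iff]
  exact ⟨n, by linarith⟩

theorem exists_pos_mul_of_ne_zero {f : ℝ → ℝ} (hf : Continuous f) (h0 : ∀ s, f s ≠ 0) :
    ∃ η : ℝ, (η = 1 ∨ η = -1) ∧ ∀ s, 0 < η * f s := by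
  by_cases h : ∀ s, 0 < f s
  · exact ⟨1, Or.inl rfl, fun s => by simpa using h s⟩
  · push Not at h
    obtain ⟨a, ha⟩ := h
    refine ⟨-1, Or.inr rfl, fun s => ?_⟩
    by_contra hs
    obtain ⟨x, hx⟩ := mem_range_of_exists_le_of_exists_ge hf ⟨a, ha⟩
      ⟨s, by linarith⟩
    exact h0 x hx

/-- A lift of a simple closed curve in the knot goes once around it. -/
theorem lift_add_two_pi {γ : ℝ → E3} {τ : ℝ → ℝ} {η : ℝ} (hη : η = 1 ∨ η = -1)
    (hτc : Continuous τ) (hγ : ∀ s, γ s = donut (τ s) 1)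
    (hinj : ∀ s s', γ s = γ s' ↔ circlePt s = circlePt s') (hmono : StrictMono fun s => η * τ s)
    (s : ℝ) : τ (s + 2 * π) = τ s + η * (4 * π) := by
  have hη2 : η * η = 1 := by rcases hη with h | h <;> rw [h] <;> norm_num
  have key : ∀ x t : ℝ, (∃ n : ℤ, t = η * τ x + n * (4 * π)) ↔ donut (τ x) 1 = donut (η * t) 1 := by
    intro x t
    rw [donut_one_eq_iff]
    rcases hη with h | h
    · subst h
      simp
    · subst h
      constructor
      · rintro ⟨n, rfl⟩
        exact ⟨-n, by push_cast; ring⟩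
      · rintro ⟨n, hn⟩
        exact ⟨-n, by push_cast; linarith⟩
  have heq : γ s = γ (s + 2 * π) := (hinj _ _).2 (circlePt_add_two_pi s).symm
  obtain ⟨n, hn⟩ := (key s (η * τ (s + 2 * π))).2 (by
    rw [← mul_assoc, hη2, one_mul, ← hγ, ← hγ, heq])
  have hpi := Real.pi_pos
  have hlt : η * τ s < η * τ (s + 2 * π) := hmono (by linarith)
  have hn1 : (1 : ℤ) ≤ n := by
    by_contra h
    have : (n : ℝ) ≤ 0 := by exact_mod_cast (by omega : n ≤ 0)
    nlinarith
  -- If the lift advanced by `8π` or more, it would pass `4π` strictly inside the period, and the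
  -- closed curve would meet its starting point too early.
  have hn2 : n ≤ 1 := by
    by_contra h
    have h2 : (2 : ℝ) ≤ n := by exact_mod_cast (by omega : (2 : ℤ) ≤ n)
    have hc : ContinuousOn (fun s => η * τ s) (Icc s (s + 2 * π)) := by fun_prop
    obtain ⟨x, hx, hxe⟩ := intermediate_value_Ioo (by linarith : s ≤ s + 2 * π) hc
      (show η * τ s + 4 * π ∈ Ioo (η * τ s) (η * τ (s + 2 * π)) from
        ⟨by linarith, by rw [hn]; nlinarith⟩)
    have h3 := (key s (η * τ x)).1 ⟨1, by rw [show η * τ x = η * τ s + 4 * π from hxe]; simp⟩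
    rw [← mul_assoc, hη2, one_mul, ← hγ, ← hγ, hinj, circlePt_eq_iff] at h3
    obtain ⟨k, hk⟩ := h3
    have h4 : (-1 : ℝ) < k := by nlinarith [hx.2]
    have h5 : (k : ℝ) < 0 := by nlinarith [hx.1]
    have h4' : (-1 : ℤ) < k := by exact_mod_cast h4
    have h5' : k < (0 : ℤ) := by exact_mod_cast h5
    omega
  have : n = 1 := le_antisymm hn2 hn1
  rw [this] at hn
  push_cast at hn
  linear_combination η * hn - (τ (s + 2 * π) - τ s) * hη2

/-! ### Existence of a collar for every spanning disc -/

theorem exists_bound_of_periodic {f : ℝ → ℝ} (hf : Continuous f)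
    (hp : Function.Periodic f (2 * π)) : ∃ C, ∀ s, |f s| ≤ C := by
  obtain ⟨C, hC⟩ := (hp.isBounded_of_continuous (by positivity) hf).exists_norm_le
  exact ⟨C, fun s => hC _ (mem_range_self s)⟩

theorem deriv_periodic {f : ℝ → ℝ} {a T : ℝ} (hf : ∀ s, f (s + T) = f s + a) :
    Function.Periodic (deriv f) T := fun s => by
  have h : (fun s => f (s + T)) = fun s => f s + a := funext hf
  rw [← deriv_comp_add_const, h, deriv_add_const]

/-- The spanning disc's radial derivative along the boundary. -/
def radialDeriv (ρ : ℂ → E3) (s : ℝ) : E3 :=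
  fderivWithin ℝ ρ (closedBall 0 1) (circlePt s) (circlePt s)

theorem contDiff_radialDeriv {ρ : ℂ → E3} (hρ : IsSpanningDisc ρ) :
    ContDiff ℝ ∞ (radialDeriv ρ) :=
  ((hρ.smooth.fderivWithin uniqueDiffOn_unitDisc (by simp)).comp_contDiff contDiff_circlePt
    circlePt_mem_closedBall).clm_apply contDiff_circlePt

theorem radialDeriv_add_two_pi (ρ : ℂ → E3) : Function.Periodic (radialDeriv ρ) (2 * π) := fun s => by
  simp only [radialDeriv, circlePt_add_two_pi]

theorem contDiff_boundary {ρ : ℂ → E3} (hρ : IsSpanningDisc ρ) :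
    ContDiff ℝ ∞ (fun s => ρ (circlePt s)) :=
  hρ.smooth.comp_contDiff contDiff_circlePt circlePt_mem_closedBall

theorem hasFDerivWithinAt_disc {ρ : ℂ → E3} (hρ : IsSpanningDisc ρ) {x : ℂ}
    (hx : x ∈ closedBall (0 : ℂ) 1) :
    HasFDerivWithinAt ρ (fderivWithin ℝ ρ (closedBall 0 1) x) (closedBall 0 1) x :=
  (hρ.smooth.differentiableOn (by simp) x hx).hasFDerivWithinAt

theorem fderivWithin_tangent {ρ : ℂ → E3} (hρ : IsSpanningDisc ρ) {τ : ℝ → ℝ}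
    (hτ : ContDiff ℝ ∞ τ) (hγ : ∀ s, ρ (circlePt s) = donut (τ s) 1) (s : ℝ) :
    fderivWithin ℝ ρ (closedBall 0 1) (circlePt s) (Complex.I * circlePt s) =
      deriv τ s • donutVelocity (τ s) 1 1 0 := by
  have h1 : HasDerivAt (fun s => ρ (circlePt s)) _ s :=
    (hasFDerivWithinAt_disc hρ (circlePt_mem_closedBall s)).comp_hasDerivAt s
      (hasDerivAt_circlePt s) (Filter.Eventually.of_forall circlePt_mem_closedBall)
  have h2 := hasDerivAt_donut (hτ.differentiable (by simp) s).hasDerivAt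
    (hasDerivAt_const s (1 : ℂ))
  rw [show (fun s => ρ (circlePt s)) = fun s => donut (τ s) 1 from funext hγ] at h1
  rw [h1.unique h2, ← donutVelocity_smul]
  simp

/-- Along the boundary the radial derivative has no component outside the plane spanned by the
normal of the torus and the tangent of the knot, and it points towards the torus. -/
theorem radialDeriv_decomposition {ρ : ℂ → E3} (hρ : IsSpanningDisc ρ) {τ : ℝ → ℝ}
    (hτ : ContDiff ℝ ∞ τ) (hγ : ∀ s, ρ (circlePt s) = donut (τ s) 1) (s : ℝ) :
    radialDeriv ρ s = inner ℝ (radialDeriv ρ s) (donutNormal (τ s) 1) • donutNormal (τ s) 1 +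
      (inner ℝ (radialDeriv ρ s) (donutVelocity (τ s) 1 1 0) /
        ‖donutVelocity (τ s) 1 1 0‖ ^ 2) • donutVelocity (τ s) 1 1 0 := by
  obtain ⟨v, hv⟩ := hρ.orthogonal _ (circlePt_mem_sphere s) (τ s) (hγ s)
  have hN : inner ℝ (donutNormal (τ s) 1) (donutNormal (τ s) 1) = 1 := by
    simpa using inner_donutNormal_self (τ s) 1
  have hK := inner_donutVelocity_donutNormal (τ s) 1
  have hK0 : donutVelocity (τ s) 1 1 0 ≠ 0 := fun h =>
    one_ne_zero (donutVelocity_eq_zero (by simp) h).1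
  have hT := fderivWithin_tangent hρ hτ hγ s
  have hD : fderivWithin ℝ ρ (closedBall 0 1) (circlePt s) (circlePt s) = radialDeriv ρ s := rfl
  set N := donutNormal (τ s) 1
  set K := donutVelocity (τ s) 1 1 0
  set D := radialDeriv ρ s
  obtain ⟨x, y, hxy⟩ : ∃ x y : ℝ, v = x • circlePt s + y • (Complex.I * circlePt s) := by
    refine ⟨(v * (circlePt s)⁻¹).re, (v * (circlePt s)⁻¹).im, ?_⟩
    have h0 : circlePt s ≠ 0 := Complex.exp_ne_zero _
    rw [Complex.real_smul, Complex.real_smul, ← mul_assoc, ← add_mul, Complex.re_add_im,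
      inv_mul_cancel_right₀ h0]
  rw [hxy, map_add, map_smul, map_smul, hT, hD, smul_smul] at hv
  -- Orthogonality provides `N = x D + y τ' K`. Pairing with `N` kills the knot tangent and shows `x
  -- ≠ 0`, so the equation can be solved for `D`.
  have h1 : x * inner ℝ D N = 1 := by
    rw [← hN]
    nth_rw 2 [← hv]
    rw [inner_add_left, inner_smul_left, inner_smul_left, hK]
    simp
  have hx : x ≠ 0 := left_ne_zero_of_mul_eq_one h1
  have hDe : D = x⁻¹ • N + (-(x⁻¹ * (y * deriv τ s))) • K := by
    rw [← hv, smul_add, smul_smul, smul_smul, inv_mul_cancel₀ hx, one_smul, neg_smul]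
    abel
  have hDN : inner ℝ D N = x⁻¹ := eq_inv_of_mul_eq_one_right h1
  have hNK : inner ℝ N K = 0 := by rw [real_inner_comm]; exact hK
  have hDK : inner ℝ D K = -(x⁻¹ * (y * deriv τ s)) * ‖K‖ ^ 2 := by
    rw [hDe, inner_add_left, inner_smul_left, inner_smul_left, hNK, real_inner_self_eq_norm_sq]
    simp
  rw [hDN, hDK, mul_div_cancel_right₀ _ (pow_ne_zero 2 (norm_ne_zero_iff.2 hK0))]
  exact hDe

set_option maxHeartbeats 1000000 in
/-- Every spanning disc has a collar. -/
theorem exists_collar {ρ : ℂ → E3} (hρ : IsSpanningDisc ρ) {θ₀ : ℝ} (hpos : 0 < θ₀)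
    (hlt : θ₀ < π) : ∃ κ : Collar θ₀, (∀ s, ρ (circlePt s) = donut (κ.τ s) 1) ∧
      ∀ s, (-(9 / 16) : ℝ) • radialDeriv ρ s =
        ((1 + 2 * κ.l) * κ.α s) • donutNormal (κ.τ s) 1 -
          (κ.c s * κ.α s) • donutVelocity (κ.τ s) 1 1 0 := by
  obtain ⟨τ, hτ, hγ⟩ := exists_knot_lift (contDiff_boundary hρ) fun s =>
    hρ.boundary.mapsTo (circlePt_mem_sphere s)
  have hτ0 : ∀ s, deriv τ s ≠ 0 := fun s h => by
    have h1 := fderivWithin_tangent hρ hτ hγ s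
    rw [h, zero_smul, ← map_zero (fderivWithin ℝ ρ (closedBall 0 1) (circlePt s))] at h1
    have h2 := hρ.immersed _ (circlePt_mem_closedBall s) h1
    exact mul_ne_zero Complex.I_ne_zero (Complex.exp_ne_zero _) h2
  have hτd : ContDiff ℝ ∞ (deriv τ) := (contDiff_infty_iff_deriv.1 hτ).2
  obtain ⟨η, hη, hητ⟩ := exists_pos_mul_of_ne_zero hτd.continuous hτ0
  have hmono : StrictMono fun s => η * τ s := strictMono_of_deriv_pos fun s => by
    rw [((hτ.differentiable (by simp) s).hasDerivAt.const_mul η).deriv]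
    exact hητ s
  have hadd : ∀ s, τ (s + 2 * π) = τ s + η * (4 * π) :=
    lift_add_two_pi hη hτ.continuous hγ (fun s s' =>
      hρ.boundary.injOn.eq_iff (circlePt_mem_sphere s) (circlePt_mem_sphere s')) hmono
  have hper : ∀ {f : ℝ → E3}, Function.Periodic f (4 * π) →
      Function.Periodic (fun s => f (τ s)) (2 * π) := by
    intro f hf s
    simp only [hadd]
    rcases hη with e | e
    · rw [e, one_mul, hf]
    · rw [e, neg_one_mul, ← sub_eq_add_neg, hf.sub_eq]
  set N : ℝ → E3 := fun s => donutNormal (τ s) 1 with hN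
  set K : ℝ → E3 := fun s => donutVelocity (τ s) 1 1 0 with hK
  have hNs : ContDiff ℝ ∞ N := contDiff_donutNormal.comp (hτ.prodMk contDiff_const)
  have hKs : ContDiff ℝ ∞ K := contDiff_donutTangent.comp hτ
  have hNp : Function.Periodic N (2 * π) := hper (donutNormal_periodic 1)
  have hKp : Function.Periodic K (2 * π) := hper donutTangent_periodic
  have hDp := radialDeriv_add_two_pi ρ
  have hDs := contDiff_radialDeriv hρ
  have hK0 : ∀ s, ‖K s‖ ^ 2 ≠ 0 := fun s => pow_ne_zero 2 (norm_ne_zero_iff.2 fun h =>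
    one_ne_zero (donutVelocity_eq_zero (by simp) h).1)
  -- The sign makes `a` positive, the disc lying outside the donut.
  set a : ℝ → ℝ := fun s => -inner ℝ (radialDeriv ρ s) (N s) with ha
  set b : ℝ → ℝ := fun s => inner ℝ (radialDeriv ρ s) (K s) / ‖K s‖ ^ 2 with hb
  have has : ContDiff ℝ ∞ a := (hDs.inner ℝ hNs).neg
  have hbs : ContDiff ℝ ∞ b := (hDs.inner ℝ hKs).div (hKs.norm_sq ℝ) hK0
  have hap : Function.Periodic a (2 * π) := fun s => by simp only [ha, hDp s, hNp s]
  have hbp : Function.Periodic b (2 * π) := fun s => by simp only [hb, hDp s, hKp s]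
  have hapos : ∀ s, 0 < a s := fun s => by
    have := hρ.outside _ (circlePt_mem_sphere s) (τ s) (hγ s)
    exact neg_pos.2 this
  obtain ⟨A, hA⟩ := exists_bound_of_periodic has.continuous hap
  have hA0 : 0 ≤ A := (abs_nonneg _).trans (hA 0)
  have hS : 0 < Real.sin (θ₀ / 2) :=
    Real.sin_pos_of_pos_of_lt_pi (by linarith) (by linarith)
  -- Large enough for `9/16 * a ≤ (1 + 2l) sin (θ₀/2)`, the upper bound required of `α`; the
  -- constant `-9/16` is the slope of `polarRadius` at the rim.
  set l : ℝ := 9 / 16 * A / Real.sin (θ₀ / 2) with hl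
  have hl0 : 0 ≤ l := by positivity
  have hl1 : 0 < 1 + 2 * l := by positivity
  -- Solves `c α = 9/16 * b` for `α = 9/16 * a / (1 + 2l)`.
  set c : ℝ → ℝ := fun s => b s / a s * (1 + 2 * l) with hc
  have hcs : ContDiff ℝ ∞ c := (hbs.div has fun s => (hapos s).ne').mul contDiff_const
  have hcp : Function.Periodic c (2 * π) := fun s => by simp only [hc, hap s, hbp s]
  have hcd : ContDiff ℝ ∞ (deriv c) := (contDiff_infty_iff_deriv.1 hcs).2
  -- The constant `N` of the collar: the quotient is continuous and periodic, hence bounded.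
  obtain ⟨B, hB⟩ := exists_bound_of_periodic (f := fun s => deriv c s / (η * deriv τ s))
    (hcd.continuous.div (continuous_const.mul hτd.continuous) fun s => (hητ s).ne') (fun s => by
      have h1 : deriv c (s + 2 * π) = deriv c s :=
        deriv_periodic (a := 0) (fun s => by rw [hcp s, add_zero]) s
      have h2 : deriv τ (s + 2 * π) = deriv τ s := deriv_periodic hadd s
      simp only [h1, h2])
  refine ⟨⟨η, τ, fun s => 9 / 16 * a s / (1 + 2 * l), c, l, B, hpos, hη, hτ, hadd, hητ,
    (contDiff_const.mul has).div_const _, fun s => by simp only [hap s],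
    fun s => by have := hapos s; positivity, fun s => ?_, hcs, hcp, fun s => ?_, hl0,
    (abs_nonneg _).trans (hB 0)⟩, hγ, fun s => ?_⟩
  · rw [div_le_iff₀ hl1]
    have h1 : a s ≤ A := (le_abs_self _).trans (hA s)
    have h2 : l * Real.sin (θ₀ / 2) = 9 / 16 * A := div_mul_cancel₀ _ hS.ne'
    nlinarith
  · have := hB s
    rwa [abs_div, abs_of_pos (hητ s), div_le_iff₀ (hητ s)] at this
  · have hdec : radialDeriv ρ s = (-a s) • N s + b s • K s := by
      have := radialDeriv_decomposition hρ hτ hγ s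
      simp only [ha, hb, neg_neg]
      exact this
    have e1 : (1 + 2 * l) * (9 / 16 * a s / (1 + 2 * l)) = 9 / 16 * a s := by field_simp
    have e2 : c s * (9 / 16 * a s / (1 + 2 * l)) = 9 / 16 * b s := by
      have := (hapos s).ne'
      simp only [hc]
      field_simp
    simp only [e1, e2]
    rw [hdec, smul_add, smul_smul, smul_smul, sub_eq_add_neg, ← neg_smul]
    congr 2
    · ring
    · ring

/-! ### Gluing the annulus to the disc -/

/-- A map that is differentiable on two closed pieces, with a common derivative that is continuous
on each of them, is continuously differentiable. -/
theorem contDiffOn_of_closed_pieces {E F : Type*} [NormedAddCommGroup E] [NormedSpace ℝ E]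
    [NormedAddCommGroup F] [NormedSpace ℝ F] {U A B : Set E} (hU : IsOpen U) (hA : IsClosed A)
    (hB : IsClosed B) (hAB : A ∪ B = univ) {k : E → F} {k' : E → E →L[ℝ] F}
    (h1 : ∀ x ∈ U ∩ A, HasFDerivWithinAt k (k' x) (U ∩ A) x)
    (h2 : ∀ x ∈ U ∩ B, HasFDerivWithinAt k (k' x) (U ∩ B) x)
    (c1 : ContinuousOn k' (U ∩ A)) (c2 : ContinuousOn k' (U ∩ B)) :
    (∀ x ∈ U, HasFDerivAt k (k' x) x) ∧ ContDiffOn ℝ 1 k U := by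
  have hUAB : U ∩ A ∪ U ∩ B = U := by rw [← inter_union_distrib_left, hAB, inter_univ]
  have hd : ∀ x ∈ U, HasFDerivAt k (k' x) x := by
    intro x hx
    -- At points outside the closure of a piece, the condition on that piece is vacuous.
    have e1 : HasFDerivWithinAt k (k' x) (U ∩ A) x := by
      by_cases hxA : x ∈ A
      · exact h1 x ⟨hx, hxA⟩
      · exact HasFDerivWithinAt.of_notMem_closure fun h =>
          hxA (hA.closure_subset (closure_mono inter_subset_right h))
    have e2 : HasFDerivWithinAt k (k' x) (U ∩ B) x := by
      by_cases hxB : x ∈ B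
      · exact h2 x ⟨hx, hxB⟩
      · exact HasFDerivWithinAt.of_notMem_closure fun h =>
          hxB (hB.closure_subset (closure_mono inter_subset_right h))
    have e3 := e1.union e2
    rw [hUAB] at e3
    exact e3.hasFDerivAt (hU.mem_nhds hx)
  have hc : ContinuousOn k' U := by
    intro x hx
    have e1 : ContinuousWithinAt k' (U ∩ A) x := by
      by_cases hxA : x ∈ A
      · exact c1 x ⟨hx, hxA⟩
      · exact continuousWithinAt_of_notMem_closure fun h =>
          hxA (hA.closure_subset (closure_mono inter_subset_right h))
    have e2 : ContinuousWithinAt k' (U ∩ B) x := by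
      by_cases hxB : x ∈ B
      · exact c2 x ⟨hx, hxB⟩
      · exact continuousWithinAt_of_notMem_closure fun h =>
          hxB (hB.closure_subset (closure_mono inter_subset_right h))
    have e3 := e1.union e2
    rwa [hUAB] at e3
  refine ⟨hd, ?_⟩
  rw [show (1 : WithTop ℕ∞) = 0 + 1 by rfl, contDiffOn_succ_iff_fderiv_of_isOpen hU]
  refine ⟨fun x hx => (hd x hx).differentiableAt.differentiableWithinAt, by simp, ?_⟩
  exact contDiffOn_zero.2 (hc.congr fun x hx => (hd x hx).fderiv)

/-- The radius, in the disc coordinate of a cap, of the circle at scaled height `h`. -/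
def polarRadius (h : ℝ) : ℝ := 5 / 4 * √(1 - (3 / 5 * h) ^ 2)

theorem polarRadius_one : polarRadius 1 = 1 := by
  rw [polarRadius, show (1 - (3 / 5 * 1 : ℝ) ^ 2) = (4 / 5) ^ 2 by norm_num,
    Real.sqrt_sq (by norm_num)]
  norm_num

theorem polarRadius_nonneg (h : ℝ) : 0 ≤ polarRadius h := by
  unfold polarRadius
  positivity

theorem polarRadius_le_one {h : ℝ} (hh : 1 ≤ h) : polarRadius h ≤ 1 := by
  rw [← polarRadius_one, polarRadius, polarRadius]
  gcongr

theorem contDiffAt_polarRadius {h : ℝ} (h1 : 1 ≤ h) (h2 : h < 5 / 3) :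
    ContDiffAt ℝ ∞ polarRadius h := by
  have : (1 - (3 / 5 * h) ^ 2 : ℝ) ≠ 0 := by nlinarith
  exact contDiffAt_const.mul (ContDiffAt.sqrt (by fun_prop) this)

theorem hasDerivAt_polarRadius_one : HasDerivAt polarRadius (-(9 / 16)) 1 := by
  have h1 : HasDerivAt (fun h : ℝ => 1 - (3 / 5 * h) ^ 2) (-(18 / 25)) 1 := by
    refine ((((hasDerivAt_id (1 : ℝ)).const_mul (3 / 5)).pow 2).const_sub 1).congr_deriv ?_
    norm_num
  refine ((h1.sqrt (by norm_num)).const_mul (5 / 4)).congr_deriv ?_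
  rw [show (1 - (3 / 5 * 1 : ℝ) ^ 2) = (4 / 5) ^ 2 by norm_num, Real.sqrt_sq (by norm_num)]
  norm_num

/-- The upper disc in polar coordinates. -/
def polarDisc (ρ : ℂ → E3) (θ s h : ℝ) : E3 := rotZ θ (ρ (polarRadius h • circlePt s))

/-- The domain of `polarDisc`, with time as first coordinate. -/
def polarDomain : Set (ℝ × ℝ × ℝ) := univ ×ˢ univ ×ˢ Ico 1 (5 / 3)

theorem uniqueDiffOn_polarDomain : UniqueDiffOn ℝ polarDomain :=
  uniqueDiffOn_univ.prod (uniqueDiffOn_univ.prod (uniqueDiffOn_Ico 1 (5 / 3)))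

theorem mem_polarDomain {q : ℝ × ℝ × ℝ} : q ∈ polarDomain ↔ 1 ≤ q.2.2 ∧ q.2.2 < 5 / 3 := by
  simp [polarDomain]

theorem polar_mem_closedBall {h : ℝ} (hh : 1 ≤ h) (s : ℝ) :
    polarRadius h • circlePt s ∈ closedBall (0 : ℂ) 1 := by
  rw [mem_closedBall_zero_iff, norm_smul, norm_circlePt, mul_one, Real.norm_eq_abs,
    abs_of_nonneg (polarRadius_nonneg h)]
  exact polarRadius_le_one hh

theorem contDiffOn_polarDisc {ρ : ℂ → E3} (hρ : IsSpanningDisc ρ) :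
    ContDiffOn ℝ ∞ (fun q : ℝ × ℝ × ℝ => polarDisc ρ q.1 q.2.1 q.2.2) polarDomain := by
  have hR : ContDiffOn ℝ ∞ (fun q : ℝ × ℝ × ℝ => polarRadius q.2.2) polarDomain := fun q hq => by
    rw [mem_polarDomain] at hq
    exact (ContDiffAt.comp q (contDiffAt_polarRadius hq.1 hq.2)
      (by fun_prop : ContDiffAt ℝ ∞ (fun q : ℝ × ℝ × ℝ => q.2.2) q)).contDiffWithinAt
  have hc : ContDiffOn ℝ ∞ (fun q : ℝ × ℝ × ℝ => circlePt q.2.1) polarDomain :=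
    (contDiff_circlePt.comp (by fun_prop : ContDiff ℝ ∞ (fun q : ℝ × ℝ × ℝ => q.2.1))).contDiffOn
  have h1 : ContDiffOn ℝ ∞ (fun q : ℝ × ℝ × ℝ => ρ (polarRadius q.2.2 • circlePt q.2.1))
      polarDomain := hρ.smooth.comp (hR.smul hc) fun q hq =>
    polar_mem_closedBall (mem_polarDomain.1 hq).1 _
  simp only [polarDisc]
  exact ContDiff.comp_contDiffOn (g := fun q : ℝ × E3 => rotZ q.1 q.2)
    (f := fun q : ℝ × ℝ × ℝ => (q.1, ρ (polarRadius q.2.2 • circlePt q.2.1))) contDiff_rotZ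
    (contDiffOn_fst.prodMk h1)

theorem polarDisc_one (ρ : ℂ → E3) (θ s : ℝ) : polarDisc ρ θ s 1 = rotZ θ (ρ (circlePt s)) := by
  rw [polarDisc, polarRadius_one, one_smul]

theorem hasDerivWithinAt_polarDisc_one {ρ : ℂ → E3} (hρ : IsSpanningDisc ρ) (θ s : ℝ) :
    HasDerivWithinAt (fun h => polarDisc ρ θ s h) (rotZ θ ((-(9 / 16) : ℝ) • radialDeriv ρ s))
      (Ico 1 (5 / 3)) 1 := by
  have h1 : HasDerivAt (fun h => polarRadius h • circlePt s) ((-(9 / 16) : ℝ) • circlePt s) 1 :=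
    hasDerivAt_polarRadius_one.smul_const _
  have e : polarRadius 1 • circlePt s = circlePt s := by rw [polarRadius_one, one_smul]
  have h2 := hasFDerivWithinAt_disc hρ (circlePt_mem_closedBall s)
  have h3 := h2.comp_hasDerivWithinAt_of_eq 1 (h1.hasDerivWithinAt (s := Ico 1 (5 / 3)))
    (fun h hh => polar_mem_closedBall hh.1 s) e.symm
  rw [map_smul] at h3
  exact (rotZL θ).hasFDerivAt.comp_hasDerivWithinAt 1 h3

namespace Collar

variable {θ₀ : ℝ} (κ : Collar θ₀)

/-- The collar `κ` fits the spanning disc `ρ`. -/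
structure Fits (ρ : ℂ → E3) : Prop where
  disc : IsSpanningDisc ρ
  boundary : ∀ s, ρ (circlePt s) = donut (κ.τ s) 1
  radial : ∀ s, (-(9 / 16) : ℝ) • radialDeriv ρ s =
    ((1 + 2 * κ.l) * κ.α s) • donutNormal (κ.τ s) 1 -
      (κ.c s * κ.α s) • donutVelocity (κ.τ s) 1 1 0

variable {κ} {ρ : ℂ → E3}

theorem Fits.bandMap_one (hf : κ.Fits ρ) (θ s : ℝ) : κ.bandMap θ s 1 = polarDisc ρ θ s 1 := by
  rw [Collar.bandMap_one, polarDisc_one, hf.boundary]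

/-- The two maps agree for all times and angles at `h = 1`, so their derivatives agree in those two
directions. In the remaining direction agreement is the collar condition. -/
theorem Fits.fderiv_eq (hf : κ.Fits ρ) {θ : ℝ} (hθ : 0 < Real.sin (θ / 2)) (s : ℝ) :
    fderiv ℝ (fun q : ℝ × ℝ × ℝ => κ.bandMap q.1 q.2.1 q.2.2) (θ, s, 1) =
      fderivWithin ℝ (fun q : ℝ × ℝ × ℝ => polarDisc ρ q.1 q.2.1 q.2.2) polarDomain (θ, s, 1) := by
  have hB := ((κ.contDiffAt_bandMap (s := s) hθ (h := 1) (by norm_num)).differentiableAt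
    (by simp)).hasFDerivAt
  have hmem : ∀ θ s : ℝ, (θ, s, (1 : ℝ)) ∈ polarDomain := fun θ s =>
    mem_polarDomain.2 ⟨le_rfl, by norm_num⟩
  have hP := ((contDiffOn_polarDisc hf.disc).differentiableOn (by simp) _
    (hmem θ s)).hasFDerivWithinAt
  set L₁ := fderiv ℝ (fun q : ℝ × ℝ × ℝ => κ.bandMap q.1 q.2.1 q.2.2) (θ, s, 1)
  set L₂ := fderivWithin ℝ (fun q : ℝ × ℝ × ℝ => polarDisc ρ q.1 q.2.1 q.2.2) polarDomain (θ, s, 1)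
  have hflat : ∀ a b : ℝ, L₁ (a, b, 0) = L₂ (a, b, 0) := by
    intro a b
    have hc : HasDerivAt (fun e : ℝ => (θ + e * a, s + e * b, (1 : ℝ))) (a, b, 0) 0 := by
      have h1 := ((hasDerivAt_id (0 : ℝ)).mul_const a).const_add θ
      have h2 := ((hasDerivAt_id (0 : ℝ)).mul_const b).const_add s
      simpa using h1.prodMk (h2.prodMk (hasDerivAt_const (0 : ℝ) (1 : ℝ)))
    have e0 : (θ, s, (1 : ℝ)) = (θ + 0 * a, s + 0 * b, (1 : ℝ)) := by simp
    have h1 : HasDerivAt (fun e : ℝ => κ.bandMap (θ + e * a) (s + e * b) 1) (L₁ (a, b, 0)) 0 :=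
      HasFDerivAt.comp_hasDerivAt_of_eq (l := fun q : ℝ × ℝ × ℝ => κ.bandMap q.1 q.2.1 q.2.2)
        (f := fun e : ℝ => (θ + e * a, s + e * b, (1 : ℝ))) 0 hB
        hc e0
    have h2 : HasDerivAt (fun e : ℝ => polarDisc ρ (θ + e * a) (s + e * b) 1) (L₂ (a, b, 0)) 0 :=
      HasFDerivWithinAt.comp_hasDerivAt_of_eq
        (l := fun q : ℝ × ℝ × ℝ => polarDisc ρ q.1 q.2.1 q.2.2)
        (f := fun e : ℝ => (θ + e * a, s + e * b, (1 : ℝ))) 0 hP hc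
        (Filter.Eventually.of_forall fun e => hmem _ _) e0
    simp only [hf.bandMap_one] at h1
    exact h1.unique h2
  have hvert : L₁ (0, 0, 1) = L₂ (0, 0, 1) := by
    have hc : HasDerivAt (fun h : ℝ => (θ, s, h)) (0, 0, 1) 1 :=
      (hasDerivAt_const 1 θ).prodMk ((hasDerivAt_const 1 s).prodMk (hasDerivAt_id 1))
    have h1 : HasDerivAt (fun h : ℝ => κ.bandMap θ s h) (L₁ (0, 0, 1)) 1 :=
      HasFDerivAt.comp_hasDerivAt (l := fun q : ℝ × ℝ × ℝ => κ.bandMap q.1 q.2.1 q.2.2)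
        (f := fun h : ℝ => (θ, s, h)) 1 hB hc
    have h2 : HasDerivWithinAt (fun h : ℝ => polarDisc ρ θ s h) (L₂ (0, 0, 1)) (Ico 1 (5 / 3)) 1 :=
      HasFDerivWithinAt.comp_hasDerivWithinAt
        (l := fun q : ℝ × ℝ × ℝ => polarDisc ρ q.1 q.2.1 q.2.2)
        (f := fun h : ℝ => (θ, s, h)) 1 hP hc.hasDerivWithinAt
        fun h hh => mem_polarDomain.2 hh
    have hu : UniqueDiffWithinAt ℝ (Ico (1 : ℝ) (5 / 3)) 1 :=
      uniqueDiffOn_Ico 1 (5 / 3) 1 ⟨le_rfl, by norm_num⟩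
    rw [h1.unique (κ.hasDerivAt_bandMap_one hθ s), ← hf.radial,
      hu.eq_deriv _ h2 (hasDerivWithinAt_polarDisc_one hf.disc θ s)]
  refine ContinuousLinearMap.ext fun v => ?_
  obtain ⟨a, b, c⟩ := v
  have e : ((a, b, c) : ℝ × ℝ × ℝ) = (a, b, 0) + c • (0, 0, 1) := by simp
  rw [e, map_add, map_add, map_smul, map_smul, hflat, hvert]

variable (κ ρ) in
/-- The annulus together with the upper disc, in polar coordinates. -/
def upperMap (θ s h : ℝ) : E3 := if h ≤ 1 then κ.bandMap θ s h else polarDisc ρ θ s h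

theorem Fits.upperMap_eq (hf : κ.Fits ρ) (θ s : ℝ) {h : ℝ} (hh : 1 ≤ h) :
    κ.upperMap ρ θ s h = polarDisc ρ θ s h := by
  unfold upperMap
  split_ifs with h1
  · rw [le_antisymm h1 hh, hf.bandMap_one]
  · rfl

theorem isOpen_upperDomain :
    IsOpen {q : ℝ × ℝ × ℝ | 0 < Real.sin (q.1 / 2) ∧ -1 < q.2.2 ∧ q.2.2 < 5 / 3} := by
  have h1 : IsOpen {q : ℝ × ℝ × ℝ | 0 < Real.sin (q.1 / 2)} :=
    isOpen_lt continuous_const (by fun_prop)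
  have h2 : IsOpen {q : ℝ × ℝ × ℝ | -1 < q.2.2} := isOpen_lt continuous_const (by fun_prop)
  have h3 : IsOpen {q : ℝ × ℝ × ℝ | q.2.2 < 5 / 3} := isOpen_lt (by fun_prop) continuous_const
  exact h1.inter (h2.inter h3)

theorem Fits.contDiffOn_upperMap (hf : κ.Fits ρ) :
    (∀ q : ℝ × ℝ × ℝ, 0 < Real.sin (q.1 / 2) → -1 < q.2.2 → q.2.2 ≤ 1 →
      HasFDerivAt (fun q : ℝ × ℝ × ℝ => κ.upperMap ρ q.1 q.2.1 q.2.2)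
        (fderiv ℝ (fun q : ℝ × ℝ × ℝ => κ.bandMap q.1 q.2.1 q.2.2) q) q) ∧
    ContDiffOn ℝ 1 (fun q : ℝ × ℝ × ℝ => κ.upperMap ρ q.1 q.2.1 q.2.2)
      {q | 0 < Real.sin (q.1 / 2) ∧ -1 < q.2.2 ∧ q.2.2 < 5 / 3} := by
  set U : Set (ℝ × ℝ × ℝ) := {q | 0 < Real.sin (q.1 / 2) ∧ -1 < q.2.2 ∧ q.2.2 < 5 / 3} with hUdef
  set A : Set (ℝ × ℝ × ℝ) := {q | q.2.2 ≤ 1} with hAdef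
  set B : Set (ℝ × ℝ × ℝ) := {q | 1 ≤ q.2.2} with hBdef
  have hU : IsOpen U := isOpen_upperDomain
  have hA : IsClosed A := isClosed_le (by fun_prop) (by fun_prop)
  have hB : IsClosed B := isClosed_le (by fun_prop) (by fun_prop)
  have hAB : A ∪ B = univ := by
    ext q
    simpa [hAdef, hBdef] using le_total q.2.2 1
  set fb := fun q : ℝ × ℝ × ℝ => κ.bandMap q.1 q.2.1 q.2.2 with hfb
  set fp := fun q : ℝ × ℝ × ℝ => polarDisc ρ q.1 q.2.1 q.2.2 with hfp
  have hband : ∀ q ∈ U ∩ A, ContDiffAt ℝ ∞ fb q := fun q hq =>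
    κ.contDiffAt_bandMap hq.1.1 (abs_le.2 ⟨hq.1.2.1.le, hq.2⟩)
  have hsub : U ∩ B ⊆ polarDomain := fun q hq => mem_polarDomain.2 ⟨hq.2, hq.1.2.2⟩
  classical
  set k' : ℝ × ℝ × ℝ → ℝ × ℝ × ℝ →L[ℝ] E3 := fun q =>
    if q.2.2 ≤ 1 then fderiv ℝ fb q else fderivWithin ℝ fp polarDomain q with hk'
  have hk'A : ∀ q ∈ U ∩ A, k' q = fderiv ℝ fb q := fun q hq => if_pos hq.2
  have hk'B : ∀ q ∈ U ∩ B, k' q = fderivWithin ℝ fp polarDomain q := fun q hq => by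
    by_cases h1 : q.2.2 ≤ 1
    · have h2 : q.2.2 = 1 := le_antisymm h1 hq.2
      have h3 : q = (q.1, q.2.1, 1) := by rw [← h2]
      rw [hk'A q ⟨hq.1, h1⟩, h3]
      exact hf.fderiv_eq hq.1.1 q.2.1
    · exact if_neg h1
  have hfpc := contDiffOn_polarDisc hf.disc
  have main := contDiffOn_of_closed_pieces (k := fun q : ℝ × ℝ × ℝ => κ.upperMap ρ q.1 q.2.1 q.2.2)
    (k' := k') hU hA hB hAB
    (fun q hq => by
      rw [hk'A q hq]
      exact ((hband q hq).differentiableAt (by simp)).hasFDerivAt.hasFDerivWithinAt.congr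
        (fun x hx => if_pos hx.2) (if_pos hq.2))
    (fun q hq => by
      rw [hk'B q hq]
      exact ((hfpc.differentiableOn (by simp) q (hsub hq)).hasFDerivWithinAt.mono hsub).congr
        (fun x hx => hf.upperMap_eq _ _ hx.2) (hf.upperMap_eq _ _ hq.2))
    (ContinuousOn.congr (fun q hq => ((hband q hq).fderiv_right (m := 0)
      (by simp)).continuousAt.continuousWithinAt) hk'A)
    (((hfpc.fderivWithin uniqueDiffOn_polarDomain (m := 0) (by simp)).continuousOn.mono hsub).congr
      hk'B)
  refine ⟨fun q h1 h2 h3 => ?_, main.2⟩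
  have hq : q ∈ U := ⟨h1, h2, h3.trans_lt (by norm_num)⟩
  have := main.1 q hq
  rwa [hk'A q ⟨hq, h3⟩] at this

theorem Fits.contDiffAt_upperMap (hf : κ.Fits ρ) {θ s h : ℝ} (hθ : 0 < Real.sin (θ / 2))
    (h1 : -1 < h) (h2 : h < 5 / 3) :
    ContDiffAt ℝ 1 (fun q : ℝ × ℝ × ℝ => κ.upperMap ρ q.1 q.2.1 q.2.2) (θ, s, h) := by
  exact hf.contDiffOn_upperMap.2.contDiffAt (isOpen_upperDomain.mem_nhds ⟨hθ, h1, h2⟩)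

/-- At a fixed time, the glued map has injective derivative on the annulus. -/
theorem Fits.injective_fderiv_upperMap (hf : κ.Fits ρ) {θ : ℝ} (hθ : θ ∈ Icc θ₀ (2 * π - θ₀))
    (s : ℝ) {h : ℝ} (h1 : -1 < h) (h2 : h ≤ 1) :
    Function.Injective (fderiv ℝ (fun q : ℝ × ℝ => κ.upperMap ρ θ q.1 q.2) (s, h)) := by
  have hs := sin_half_pos κ.θ₀_pos hθ
  have hi : HasFDerivAt (fun q : ℝ × ℝ => (θ, q)) (ContinuousLinearMap.inr ℝ ℝ (ℝ × ℝ)) (s, h) :=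
    hasFDerivAt_prodMk_right θ (s, h)
  have e1 : HasFDerivAt (fun q : ℝ × ℝ => κ.upperMap ρ θ q.1 q.2) _ (s, h) :=
    HasFDerivAt.comp (g := fun q : ℝ × ℝ × ℝ => κ.upperMap ρ q.1 q.2.1 q.2.2)
      (f := fun q : ℝ × ℝ => (θ, q)) (s, h)
      (hf.contDiffOn_upperMap.1 (θ, s, h) hs h1 h2) hi
  have e2 : HasFDerivAt (fun q : ℝ × ℝ => κ.bandMap θ q.1 q.2) _ (s, h) :=
    HasFDerivAt.comp (g := fun q : ℝ × ℝ × ℝ => κ.bandMap q.1 q.2.1 q.2.2)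
      (f := fun q : ℝ × ℝ => (θ, q)) (s, h)
      ((κ.contDiffAt_bandMap hs (abs_le.2 ⟨h1.le, h2⟩)).differentiableAt (by simp)).hasFDerivAt hi
  rw [e1.fderiv, ← e2.fderiv]
  exact κ.injective_fderiv_bandMap hθ s (abs_le.2 ⟨h1.le, h2⟩)

end Collar

/-! ### The parametrized spheres -/

/-- The projection of space to the horizontal plane, as a complex number. -/
def planar (p : E3) : ℂ := ⟨p 0, p 1⟩

theorem sphere_sq (x : S2) : (x : E3) 0 ^ 2 + (x : E3) 1 ^ 2 + (x : E3) 2 ^ 2 = 1 := by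
  have h : ‖(x : E3)‖ = 1 := by simp
  have h2 := EuclideanSpace.real_norm_sq_eq (x : E3)
  rw [h, Fin.sum_univ_three] at h2
  linarith

theorem norm_planar (x : S2) : ‖planar x‖ = √(1 - (x : E3) 2 ^ 2) := by
  rw [← Real.sqrt_sq (norm_nonneg (planar x)), Complex.sq_norm, Complex.normSq_apply]
  congr 1
  have := sphere_sq x
  simp only [planar]
  linarith

theorem capCoord_eq (x : S2) : capCoord x = (5 / 4 : ℝ) • planar x := by
  apply Complex.ext <;> simp [capCoord, planar]

/-- `s` is an angle of the horizontal projection of `p`. -/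
def HasAngle (p : E3) (s : ℝ) : Prop := planar p = ‖planar p‖ • circlePt s

theorem hasAngle_arg (p : E3) : HasAngle p (planar p).arg := by
  rw [HasAngle, Complex.real_smul]
  exact (Complex.norm_mul_exp_arg_mul_I _).symm

theorem HasAngle.circlePt_eq {p : E3} {s s' : ℝ} (h : HasAngle p s) (h' : HasAngle p s')
    (h0 : planar p ≠ 0) : circlePt s = circlePt s' := by
  have e := h.symm.trans h'
  rw [Complex.real_smul, Complex.real_smul] at e
  exact mul_left_cancel₀ (Complex.ofReal_ne_zero.2 (norm_ne_zero_iff.2 h0)) e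

theorem HasAngle.capCoord_eq {x : S2} {s : ℝ} (h : HasAngle x s) :
    capCoord x = polarRadius (5 / 3 * (x : E3) 2) • circlePt s := by
  rw [Holiverse.capCoord_eq, h, smul_smul, norm_planar, polarRadius]
  congr 4
  ring

theorem planar_ne_zero {x : S2} (hx : |(x : E3) 2| < 1) : planar x ≠ 0 := by
  rw [← norm_ne_zero_iff, norm_planar]
  have h2 : (x : E3) 2 ^ 2 < 1 := by
    rw [← sq_abs]
    nlinarith [abs_nonneg ((x : E3) 2)]
  exact (Real.sqrt_pos.2 (by linarith)).ne'

theorem sphere_ext {x y : S2} (h1 : planar x = planar y) (h2 : (x : E3) 2 = (y : E3) 2) :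
    x = y := by
  apply Subtype.ext
  ext i
  fin_cases i
  · exact congrArg Complex.re h1
  · exact congrArg Complex.im h1
  · exact h2

/-- The point of the sphere of angle `s` and scaled height `h`. -/
theorem exists_sphere_point (s : ℝ) {z : ℝ} (hz : |z| ≤ 1) :
    ∃ x : S2, (x : E3) 2 = z ∧ planar x = √(1 - z ^ 2) • circlePt s := by
  have h1 : 0 ≤ 1 - z ^ 2 := by rw [← sq_abs]; nlinarith [abs_nonneg z]
  have h2 := Real.sq_sqrt h1
  refine ⟨⟨!₂[√(1 - z ^ 2) * Real.cos s, √(1 - z ^ 2) * Real.sin s, z], ?_⟩, by simp, ?_⟩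
  · rw [mem_sphere_zero_iff_norm, ← sq_eq_sq₀ (norm_nonneg _) zero_le_one,
      EuclideanSpace.real_norm_sq_eq, Fin.sum_univ_three]
    simp only [Matrix.cons_val]
    linear_combination √(1 - z ^ 2) ^ 2 * Real.sin_sq_add_cos_sq s + h2
  · apply Complex.ext
    · simp [planar, circlePt, Complex.exp_ofReal_mul_I_re]
    · simp [planar, circlePt, Complex.exp_ofReal_mul_I_im]

theorem hasAngle_of_eq_smul {p : E3} {a s : ℝ} (ha : 0 ≤ a) (h : planar p = a • circlePt s) :
    HasAngle p s := by
  rw [HasAngle, h, norm_smul, norm_circlePt, mul_one, Real.norm_of_nonneg ha]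

theorem image_capCoord_upperCap : capCoord '' upperCap = closedBall 0 1 := by
  ext w
  rw [mem_closedBall_zero_iff]
  constructor
  · rintro ⟨x, hx, rfl⟩
    have hx' : 3 / 5 ≤ (x : E3) 2 := hx
    rw [(hasAngle_arg x).capCoord_eq, norm_smul, norm_circlePt, mul_one,
      Real.norm_of_nonneg (polarRadius_nonneg _)]
    exact polarRadius_le_one (by linarith)
  · intro hw
    have hw2 : ‖w‖ ^ 2 ≤ 1 := by nlinarith [norm_nonneg w]
    have h1 : (0 : ℝ) ≤ 1 - (4 / 5 * ‖w‖) ^ 2 := by nlinarith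
    obtain ⟨x, hx2, hxp⟩ := exists_sphere_point w.arg (z := √(1 - (4 / 5 * ‖w‖) ^ 2)) (by
      rw [abs_of_nonneg (Real.sqrt_nonneg _), Real.sqrt_le_one]
      nlinarith [sq_nonneg (4 / 5 * ‖w‖)])
    refine ⟨x, ?_, ?_⟩
    · change 3 / 5 ≤ (x : E3) 2
      rw [hx2, Real.le_sqrt (by norm_num) h1]
      nlinarith
    · rw [capCoord_eq, hxp, Real.sq_sqrt h1, sub_sub_cancel, Real.sqrt_sq (by positivity),
        smul_smul, ← mul_assoc, show (5 / 4 * (4 / 5) : ℝ) = 1 by norm_num, one_mul,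
        Complex.real_smul]
      exact Complex.norm_mul_exp_arg_mul_I w

theorem planar_mirror (x : S2) : planar (mirror x) = planar x := by
  simp [planar, mirror]

theorem mirror_two (x : S2) : (mirror x : E3) 2 = -(x : E3) 2 := by
  simp [mirror]

theorem image_capCoord_lowerCap : capCoord '' lowerCap = closedBall 0 1 := by
  rw [← image_capCoord_upperCap]
  ext w
  constructor
  · rintro ⟨x, hx, rfl⟩
    refine ⟨mirror x, ?_, by rw [capCoord_eq, capCoord_eq, planar_mirror]⟩
    change 3 / 5 ≤ (mirror x : E3) 2
    rw [mirror_two]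
    have hx' : (x : E3) 2 ≤ -(3 / 5) := hx
    linarith
  · rintro ⟨x, hx, rfl⟩
    refine ⟨mirror x, ?_, by rw [capCoord_eq, capCoord_eq, planar_mirror]⟩
    change (mirror x : E3) 2 ≤ -(3 / 5)
    rw [mirror_two]
    have hx' : 3 / 5 ≤ (x : E3) 2 := hx
    linarith

/-- The rotation of the circle of the sphere at height `z` by the angle `k z`. -/
def twist (k : ℝ → ℝ) (x : S2) : S2 :=
  ⟨rotZ (k ((x : E3) 2)) x, by rw [mem_sphere_zero_iff_norm, norm_rotZ]; simp⟩

theorem twist_two (k : ℝ → ℝ) (x : S2) : (twist k x : E3) 2 = (x : E3) 2 := by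
  simp [twist, rotZ]

theorem planar_rotZ (θ : ℝ) (p : E3) : planar (rotZ θ p) = circlePt θ * planar p := by
  apply Complex.ext <;>
    simp [planar, rotZ, circlePt, Complex.exp_ofReal_mul_I_re, Complex.exp_ofReal_mul_I_im]
  ring

theorem planar_twist (k : ℝ → ℝ) (x : S2) :
    planar (twist k x) = circlePt (k ((x : E3) 2)) * planar x := planar_rotZ _ _

theorem circlePt_mul (a b : ℝ) : circlePt a * circlePt b = circlePt (a + b) := by
  rw [circlePt, circlePt, circlePt, ← Complex.exp_add]
  push_cast
  ring_nf

theorem twist_twist (k k' : ℝ → ℝ) (x : S2) :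
    twist k (twist k' x) = twist (fun z => k z + k' z) x := by
  refine sphere_ext ?_ (by rw [twist_two, twist_two, twist_two])
  rw [planar_twist, planar_twist, planar_twist, twist_two, ← mul_assoc, circlePt_mul]

namespace Collar

variable {θ₀ : ℝ} (κ : Collar θ₀) (ρ : ℂ → E3)

/-- The parametrized sphere `S_θ`. -/
def sphereMap (θ : ℝ) (x : S2) : E3 :=
  if 3 / 5 ≤ (x : E3) 2 then rotZ θ (ρ (capCoord x))
  else if (x : E3) 2 ≤ -(3 / 5) then rotZ (-θ) (ρ (capCoord x))
  else κ.bandMap θ (planar x).arg (5 / 3 * (x : E3) 2)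

/-- The reflection of the sphere composed with the Dehn twist. -/
def deck (x : S2) : S2 := mirror (twist (fun z => κ.twistAngle (5 / 3 * z)) x)

theorem sphereMap_upper (θ : ℝ) {x : S2} (hx : 3 / 5 ≤ (x : E3) 2) :
    κ.sphereMap ρ θ x = rotZ θ (ρ (capCoord x)) := if_pos hx

theorem sphereMap_lower (θ : ℝ) {x : S2} (hx : (x : E3) 2 ≤ -(3 / 5)) :
    κ.sphereMap ρ θ x = rotZ (-θ) (ρ (capCoord x)) := by
  rw [sphereMap, if_neg (by linarith), if_pos hx]

variable {κ ρ}

theorem Fits.sphereMap_eq_upperMap (hf : κ.Fits ρ) (θ : ℝ) {x : S2} (hx : -(3 / 5) < (x : E3) 2)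
    {s : ℝ} (hs : HasAngle x s) : κ.sphereMap ρ θ x = κ.upperMap ρ θ s (5 / 3 * (x : E3) 2) := by
  by_cases h1 : 3 / 5 ≤ (x : E3) 2
  · rw [sphereMap_upper _ _ _ h1, hf.upperMap_eq _ _ (by linarith), polarDisc, hs.capCoord_eq]
  · push Not at h1
    rw [sphereMap, if_neg h1.not_ge, if_neg hx.not_ge, upperMap, if_pos (by linarith)]
    refine κ.bandMap_congr _ _ ((hasAngle_arg x).circlePt_eq hs (planar_ne_zero ?_))
    rw [abs_lt]
    constructor <;> linarith

theorem Fits.sphereMap_band (hf : κ.Fits ρ) {θ : ℝ} (hθ : θ ∈ Icc θ₀ (2 * π - θ₀)) {x : S2}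
    (hx : |(x : E3) 2| ≤ 3 / 5) {s : ℝ} (hs : HasAngle x s) :
    κ.sphereMap ρ θ x = κ.bandMap θ s (5 / 3 * (x : E3) 2) := by
  have hx' := abs_le.1 hx
  rcases hx'.1.lt_or_eq with h | h
  · rw [hf.sphereMap_eq_upperMap θ h hs, upperMap, if_pos (by linarith [hx'.2])]
  · have e : 5 / 3 * (x : E3) 2 = -1 := by linarith
    rw [sphereMap_lower _ _ _ h.ge, hs.capCoord_eq, e, κ.bandMap_neg_one hθ, ← hf.boundary]
    have : polarRadius (-1) = polarRadius 1 := by simp [polarRadius]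
    rw [this, polarRadius_one, one_smul]

variable (κ)

theorem deck_two (x : S2) : (κ.deck x : E3) 2 = -(x : E3) 2 := by
  rw [deck, mirror_two, twist_two]

theorem planar_deck (x : S2) :
    planar (κ.deck x) = circlePt (κ.twistAngle (5 / 3 * (x : E3) 2)) * planar x := by
  rw [deck, planar_mirror, planar_twist]

theorem hasAngle_deck {x : S2} {s : ℝ} (hs : HasAngle x s) :
    HasAngle (κ.deck x) (s + κ.twistAngle (5 / 3 * (x : E3) 2)) := by
  refine hasAngle_of_eq_smul (norm_nonneg (planar x)) ?_
  rw [planar_deck]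
  nth_rw 1 [hs]
  rw [mul_smul_comm, circlePt_mul, add_comm]

theorem circlePt_neg_η : circlePt (-κ.η * (2 * π)) = 1 := by
  rcases κ.η_eq with e | e
  · rw [e, circlePt, Complex.exp_eq_one_iff]
    exact ⟨-1, by push_cast; ring⟩
  · rw [e, circlePt, Complex.exp_eq_one_iff]
    exact ⟨1, by push_cast; ring⟩

/-- The twist angles at opposite heights add up to a full turn. -/
theorem deck_deck (x : S2) : κ.deck (κ.deck x) = x := by
  refine sphere_ext ?_ (by rw [deck_two, deck_two, neg_neg])
  rw [planar_deck, planar_deck, deck_two, ← mul_assoc, circlePt_mul, mul_neg, twistAngle_neg,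
    sub_add_cancel, circlePt_neg_η, one_mul]

theorem capCoord_deck {x : S2} (hx : 3 / 5 ≤ |(x : E3) 2|) : capCoord (κ.deck x) = capCoord x := by
  rw [capCoord_eq, capCoord_eq, planar_deck]
  rcases le_abs.1 hx with h | h
  · rw [κ.twistAngle_eq_zero (by linarith)]
    simp [circlePt]
  · rw [κ.twistAngle_eq (by linarith), circlePt_neg_η, one_mul]

variable {κ}

/-- The symmetry of the family of spheres. -/
theorem Fits.sphereMap_deck (hf : κ.Fits ρ) {θ : ℝ} (hθ : θ ∈ Icc θ₀ (2 * π - θ₀)) (x : S2) :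
    κ.sphereMap ρ θ (κ.deck x) = κ.sphereMap ρ (2 * π - θ) x := by
  by_cases h1 : 3 / 5 ≤ (x : E3) 2
  · rw [sphereMap_lower _ _ _ (by rw [deck_two]; linarith), sphereMap_upper _ _ _ h1,
      κ.capCoord_deck (h1.trans (le_abs_self _)), sub_eq_add_neg, add_comm, rotZ_add_two_pi]
  by_cases h2 : (x : E3) 2 ≤ -(3 / 5)
  · rw [sphereMap_upper _ _ _ (by rw [deck_two]; linarith), sphereMap_lower _ _ _ h2,
      κ.capCoord_deck (by rw [le_abs]; right; linarith), neg_sub, rotZ_sub_two_pi]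
  push Not at h1 h2
  have h3 : |(x : E3) 2| ≤ 3 / 5 := abs_le.2 ⟨h2.le, h1.le⟩
  have hs := hasAngle_arg (x : E3)
  rw [hf.sphereMap_band hθ (by rwa [deck_two, abs_neg]) (κ.hasAngle_deck hs),
    hf.sphereMap_band (two_pi_sub_mem hθ) h3 hs, deck_two, mul_neg, κ.bandMap_twist hθ]
  rw [abs_mul, abs_of_pos (by norm_num : (0 : ℝ) < 5 / 3)]
  linarith

theorem abs_scaled_le_one {x : S2} (hx : |(x : E3) 2| ≤ 3 / 5) : |5 / 3 * (x : E3) 2| ≤ 1 := by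
  rw [abs_mul, abs_of_pos (by norm_num : (0 : ℝ) < 5 / 3)]
  linarith

theorem Fits.image_band (hf : κ.Fits ρ) {θ : ℝ} (hθ : θ ∈ Icc θ₀ (2 * π - θ₀)) :
    κ.sphereMap ρ θ '' band = annulus (θ / 2) := by
  have hs := sin_half_pos κ.θ₀_pos hθ
  ext p
  constructor
  · rintro ⟨x, hx, rfl⟩
    rw [hf.sphereMap_band hθ hx (hasAngle_arg x)]
    exact κ.bandMap_mem_annulus hs _ (abs_scaled_le_one hx)
  · intro hp
    obtain ⟨s, h, hh, rfl⟩ := κ.exists_bandMap_eq hs hp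
    have hz : |3 / 5 * h| ≤ 3 / 5 := by
      rw [abs_mul, abs_of_pos (by norm_num : (0 : ℝ) < 3 / 5)]
      linarith
    obtain ⟨x, hx2, hxp⟩ := exists_sphere_point s (z := 3 / 5 * h) (hz.trans (by norm_num))
    have hx : |(x : E3) 2| ≤ 3 / 5 := by rwa [hx2]
    refine ⟨x, hx, ?_⟩
    rw [hf.sphereMap_band hθ hx (hasAngle_of_eq_smul (Real.sqrt_nonneg _) hxp), hx2]
    congr 1
    ring

/-- The double points of the band. -/
theorem Fits.sphereMap_eq_sphereMap (hf : κ.Fits ρ) {θ : ℝ} (hθ : θ ∈ Icc θ₀ (2 * π - θ₀))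
    {x y : S2} (hx : x ∈ band) (hy : y ∈ band) (h : κ.sphereMap ρ θ x = κ.sphereMap ρ θ y) :
    y = x ∨ θ = π ∧ y = κ.deck x := by
  have hsx := hasAngle_arg (x : E3)
  have hsy := hasAngle_arg (y : E3)
  have key : ∀ {x' : S2} {s s' : ℝ} (k : ℤ), HasAngle x' s → HasAngle y s' →
      s' = s + k * (2 * π) → (y : E3) 2 = (x' : E3) 2 → y = x' := by
    intro x' s s' k h1 h2 h3 h4
    refine sphere_ext ?_ h4
    rw [h1, h2, norm_planar, norm_planar, h4, circlePt_eq_iff.2 ⟨k, h3⟩]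
  rw [hf.sphereMap_band hθ hx hsx, hf.sphereMap_band hθ hy hsy] at h
  rcases κ.bandMap_eq_bandMap hθ (abs_scaled_le_one hx) (abs_scaled_le_one hy) h with
    ⟨h1, k, hk⟩ | ⟨h1, h2, k, hk⟩
  · exact Or.inl (key k hsx hsy hk (by linarith))
  · exact Or.inr ⟨h1, key k (κ.hasAngle_deck hsx) hsy hk (by rw [deck_two]; linarith)⟩

theorem Fits.parametrizes (hf : κ.Fits ρ) {θ : ℝ} (hθ : θ ∈ Icc θ₀ (2 * π - θ₀)) :
    Parametrizes ρ θ (κ.sphereMap ρ θ) where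
  range_eq := by
    have hU : (univ : Set S2) = lowerCap ∪ band ∪ upperCap := by
      refine (eq_univ_of_forall fun x => ?_).symm
      by_cases h1 : 3 / 5 ≤ (x : E3) 2
      · exact Or.inr h1
      by_cases h2 : (x : E3) 2 ≤ -(3 / 5)
      · exact Or.inl (Or.inl h2)
      push Not at h1 h2
      exact Or.inl (Or.inr (abs_le.2 ⟨h2.le, h1.le⟩))
    have hl : κ.sphereMap ρ θ '' lowerCap = rotZ (-θ) '' (ρ '' closedBall 0 1) := by
      rw [← image_capCoord_lowerCap, image_image, image_image]
      exact image_congr fun x hx => κ.sphereMap_lower ρ θ hx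
    have hu : κ.sphereMap ρ θ '' upperCap = rotZ θ '' (ρ '' closedBall 0 1) := by
      rw [← image_capCoord_upperCap, image_image, image_image]
      exact image_congr fun x hx => κ.sphereMap_upper ρ θ hx
    rw [← image_univ, hU, image_union, image_union, hf.image_band hθ, hl, hu]
    rfl
  upper x hx := κ.sphereMap_upper ρ θ hx
  lower x hx := κ.sphereMap_lower ρ θ hx
  band_image := hf.image_band hθ
  band_injOn hne x hx y hy h :=
    ((hf.sphereMap_eq_sphereMap hθ hx hy h).resolve_right fun h' => hne h'.1).symm

end Collar

/-! ### Smoothness and immersivity on the sphere -/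

theorem contDiff_planar : ContDiff ℝ ∞ planar := by
  have h0 : ContDiff ℝ ∞ (fun p : E3 => p 0) := by fun_prop
  have h1 : ContDiff ℝ ∞ (fun p : E3 => p 1) := by fun_prop
  exact Complex.equivRealProdCLM.symm.contDiff.comp (h0.prodMk h1)

theorem inner_eq (p v : E3) : inner ℝ p v = p 0 * v 0 + p 1 * v 1 + p 2 * v 2 := by
  simp [PiLp.inner_apply, Fin.sum_univ_three]
  ring

/-- The angle of the horizontal projection, on a neighbourhood of a point of angle `s₀`. -/
def localAngle (s₀ : ℝ) (p : E3) : ℝ := s₀ + (Complex.log (planar p * circlePt (-s₀))).im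

theorem hasAngle_localAngle (s₀ : ℝ) {p : E3} (hp : planar p ≠ 0) :
    HasAngle p (localAngle s₀ p) := by
  have hc : planar p * circlePt (-s₀) ≠ 0 := mul_ne_zero hp (Complex.exp_ne_zero _)
  refine hasAngle_of_eq_smul (norm_nonneg (planar p * circlePt (-s₀))) ?_
  have h := Complex.norm_mul_exp_arg_mul_I (planar p * circlePt (-s₀))
  rw [localAngle, Complex.log_im, ← circlePt_mul, Complex.real_smul, mul_left_comm]
  rw [show circlePt (planar p * circlePt (-s₀)).arg =
    Complex.exp ((planar p * circlePt (-s₀)).arg * Complex.I) from rfl, h, mul_left_comm,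
    circlePt_mul, add_neg_cancel]
  simp [circlePt]

/-- Turning back by `s₀` puts the point on the positive real axis, away from the cut of the
logarithm. -/
theorem localAngle_slit {s₀ : ℝ} {p : E3} (hp : planar p ≠ 0) (hs : HasAngle p s₀) :
    planar p * circlePt (-s₀) ∈ Complex.slitPlane := by
  rw [hs, smul_mul_assoc, circlePt_mul, add_neg_cancel]
  left
  simpa [circlePt] using hp

theorem contDiffAt_localAngle {s₀ : ℝ} {p : E3} (hp : planar p ≠ 0) (hs : HasAngle p s₀) :
    ContDiffAt ℝ ∞ (localAngle s₀) p := by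
  have h1 : ContDiffAt ℝ ∞ (fun p => planar p * circlePt (-s₀)) p :=
    (contDiff_planar.mul contDiff_const).contDiffAt
  have h2 : ContDiffAt ℝ ∞ Complex.log (planar p * circlePt (-s₀)) :=
    (Complex.contDiffAt_log (localAngle_slit hp hs)).restrict_scalars ℝ
  have h3 : ContDiffAt ℝ ∞ (fun p => Complex.log (planar p * circlePt (-s₀))) p :=
    ContDiffAt.comp (g := Complex.log) (f := fun p => planar p * circlePt (-s₀)) p h2 h1
  exact contDiffAt_const.add (Complex.imCLM.contDiff.contDiffAt.comp p h3)

/-- Local coordinates: angle and scaled height. -/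
def polarCoords (s₀ : ℝ) (p : E3) : ℝ × ℝ := (localAngle s₀ p, 5 / 3 * p 2)

theorem contDiffAt_polarCoords {s₀ : ℝ} {p : E3} (hp : planar p ≠ 0) (hs : HasAngle p s₀) :
    ContDiffAt ℝ ∞ (polarCoords s₀) p :=
  (contDiffAt_localAngle hp hs).prodMk (by fun_prop)

theorem polarCoords_self {s₀ : ℝ} {p : E3} (hs : HasAngle p s₀) :
    polarCoords s₀ p = (s₀, 5 / 3 * p 2) := by
  have : planar p * circlePt (-s₀) = (‖planar p‖ : ℂ) := by
    nth_rw 1 [hs]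
    rw [smul_mul_assoc, circlePt_mul, add_neg_cancel]
    simp [circlePt]
  rw [polarCoords, localAngle, this, Complex.log_im, Complex.arg_ofReal_of_nonneg (norm_nonneg _),
    add_zero]

theorem hasDerivAt_line (p v : E3) : HasDerivAt (fun e : ℝ => p + e • v) v 0 := by
  simpa using ((hasDerivAt_id (0 : ℝ)).smul_const v).const_add p

theorem planar_add_smul (p v : E3) (e : ℝ) : planar (p + e • v) = planar p + e • planar v := by
  apply Complex.ext <;> simp [planar]

/-- A vector that changes neither height nor angle is a multiple of the horizontal part of `p`. Off
the axis, such a multiple is orthogonal to `p` only if it is zero. -/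
theorem eq_zero_of_fderiv_polarCoords {s₀ : ℝ} {p v : E3} (hp : planar p ≠ 0) (hs : HasAngle p s₀)
    (hv : inner ℝ p v = 0) (h : fderiv ℝ (polarCoords s₀) p v = 0) : v = 0 := by
  have hd : HasDerivAt (fun e : ℝ => polarCoords s₀ (p + e • v)) 0 0 :=
    (HasFDerivAt.comp_hasDerivAt_of_eq (f := fun e : ℝ => p + e • v) 0
      ((contDiffAt_polarCoords hp hs).differentiableAt (by simp)).hasFDerivAt
      (hasDerivAt_line p v) (by simp)).congr_deriv h
  have hd1 : HasDerivAt (fun e : ℝ => localAngle s₀ (p + e • v)) 0 0 :=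
    (ContinuousLinearMap.fst ℝ ℝ ℝ).hasFDerivAt.comp_hasDerivAt (0 : ℝ) hd
  have hd2 : HasDerivAt (fun e : ℝ => 5 / 3 * (p + e • v) 2) 0 0 :=
    (ContinuousLinearMap.snd ℝ ℝ ℝ).hasFDerivAt.comp_hasDerivAt (0 : ℝ) hd
  have hd3 : HasDerivAt (fun e : ℝ => 5 / 3 * (p + e • v) 2) (5 / 3 * v 2) 0 :=
    (hasDerivAt_euclidean.1 (hasDerivAt_line p v) 2).const_mul _
  have hv2 : v 2 = 0 := by
    have := hd2.unique hd3
    linarith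
  have hl : HasDerivAt (fun e : ℝ => planar (p + e • v) * circlePt (-s₀))
      (planar v * circlePt (-s₀)) 0 := by
    simp only [planar_add_smul]
    simpa using (((hasDerivAt_id (0 : ℝ)).smul_const (planar v)).const_add (planar p)).mul_const
      (circlePt (-s₀))
  have hlog := hl.clog_real (by simpa using localAngle_slit hp hs)
  have him : HasDerivAt (fun e : ℝ => localAngle s₀ (p + e • v)) _ 0 :=
    (Complex.imCLM.hasFDerivAt.comp_hasDerivAt (0 : ℝ) hlog).const_add s₀
  have h0 := him.unique hd1
  rw [zero_smul, add_zero, mul_div_mul_right _ _ (show circlePt (-s₀) ≠ 0 from Complex.exp_ne_zero _)] at h0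
  have hpv : planar v = ((planar v / planar p).re : ℂ) * planar p := by
    have e : planar v / planar p = ((planar v / planar p).re : ℂ) :=
      Complex.ext (by simp) (by simpa using h0)
    rw [← e, div_mul_cancel₀ _ hp]
  set x := (planar v / planar p).re
  have e0 : v 0 = x * p 0 := by simpa [planar] using congrArg Complex.re hpv
  have e1 : v 1 = x * p 1 := by simpa [planar] using congrArg Complex.im hpv
  rw [inner_eq, e0, e1, hv2] at hv
  have hnz : p 0 ^ 2 + p 1 ^ 2 ≠ 0 := fun h => hp (Complex.ext
    (by simp only [planar, Complex.zero_re]; nlinarith [sq_nonneg (p 0), sq_nonneg (p 1)])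
    (by simp only [planar, Complex.zero_im]; nlinarith [sq_nonneg (p 0), sq_nonneg (p 1)]))
  have hx : x = 0 := by
    have : x * (p 0 ^ 2 + p 1 ^ 2) = 0 := by linarith
    exact (mul_eq_zero.1 this).resolve_right hnz
  ext i
  fin_cases i
  · simp [e0, hx]
  · simp [e1, hx]
  · exact hv2

/-! ### Maps of the sphere given locally by formulas in space -/

theorem fact_finrank_E3 : Fact (Module.finrank ℝ E3 = 2 + 1) := ⟨by simp⟩

theorem contMDiff_coe {n : WithTop ℕ∞} :
    ContMDiff (𝓡 2) 𝓘(ℝ, E3) n (fun x : S2 => (x : E3)) :=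
  have := fact_finrank_E3
  contMDiff_coe_sphere

theorem tangentVec_injective (x : S2) : Function.Injective (tangentVec x) := by
  intro v w h
  have := fact_finrank_E3
  have : Function.Injective (mfderiv (𝓡 2) 𝓘(ℝ, E3) (fun y : S2 => (y : E3)) x) := by
    convert! injective_mvfderiv_subtypeVal_sphere (n := 2) x
  exact this h

theorem inner_tangentVec (x : S2) (v : TangentSpace (𝓡 2) x) :
    inner ℝ (x : E3) (tangentVec x v) = 0 := by
  have := fact_finrank_E3
  have h := range_mvfderiv_subtypeVal (n := 2) x
  have h2 : tangentVec x v ∈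
      (mvfderiv (𝓡 2) ((↑) : S2 → E3) x).range := by
    refine ⟨v, ?_⟩
    rfl
  rw [h] at h2
  exact Submodule.mem_orthogonal_singleton_iff_inner_right.1 h2

theorem hasMFDerivAt_coe (x : S2) : HasMFDerivAt (𝓡 2) 𝓘(ℝ, E3) (fun y : S2 => (y : E3)) x
    (mfderiv (𝓡 2) 𝓘(ℝ, E3) (fun y : S2 => (y : E3)) x) :=
  ((contMDiff_coe (n := 1) x).mdifferentiableAt one_ne_zero).hasMFDerivAt

theorem mfderiv_of_eventuallyEq {f : S2 → E3} {g : E3 → E3} {x : S2}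
    (hfg : f =ᶠ[nhds x] fun y => g y) (hg : DifferentiableAt ℝ g x) (v : TangentSpace (𝓡 2) x) :
    mfderiv (𝓡 2) 𝓘(ℝ, E3) f x v = fderiv ℝ g x (tangentVec x v) := by
  have h : HasMFDerivAt (𝓡 2) 𝓘(ℝ, E3) (fun y : S2 => g y) x _ :=
    HasMFDerivAt.comp x hg.hasFDerivAt.hasMFDerivAt (hasMFDerivAt_coe x)
  rw [hfg.mfderiv_eq, h.mfderiv]
  rfl

theorem injective_mfderiv_of_eventuallyEq {f : S2 → E3} {g : E3 → E3} {x : S2}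
    (hfg : f =ᶠ[nhds x] fun y => g y) (hg : DifferentiableAt ℝ g x)
    (hker : ∀ w : E3, inner ℝ (x : E3) w = 0 → fderiv ℝ g x w = 0 → w = 0) :
    Function.Injective (mfderiv (𝓡 2) 𝓘(ℝ, E3) f x) := by
  rw [injective_iff_map_eq_zero]
  intro v hv
  rw [mfderiv_of_eventuallyEq hfg hg] at hv
  refine tangentVec_injective x ((hker _ (inner_tangentVec x v) hv).trans ?_)
  exact (map_zero (mfderiv (𝓡 2) 𝓘(ℝ, E3) (fun y : S2 => (y : E3)) x)).symm

theorem contMDiff_incl {n : WithTop ℕ∞} : ContMDiff (𝓘(ℝ, ℝ).prod (𝓡 2)) 𝓘(ℝ, ℝ × E3) n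
    (fun q : ℝ × S2 => (q.1, (q.2 : E3))) :=
  contMDiff_fst.prodMk_space (contMDiff_coe.comp contMDiff_snd)

theorem contMDiffAt_of_eventuallyEq {n : WithTop ℕ∞} {f : ℝ × S2 → E3} {g : ℝ × E3 → E3}
    {q : ℝ × S2} (hfg : f =ᶠ[nhds q] fun q => g (q.1, (q.2 : E3)))
    (hg : ContDiffAt ℝ n g (q.1, (q.2 : E3))) :
    ContMDiffAt (𝓘(ℝ, ℝ).prod (𝓡 2)) 𝓘(ℝ, E3) n f q :=
  ContMDiffAt.congr_of_eventuallyEq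
    (ContMDiffAt.comp q hg.contMDiffAt (contMDiff_incl q)) hfg

theorem continuous_height : Continuous (fun x : S2 => (x : E3) 2) := by fun_prop

theorem continuous_planar : Continuous (fun x : S2 => planar x) :=
  contDiff_planar.continuous.comp continuous_subtype_val

/-- `planar`, scaled, as a continuous linear map. -/
def capCLM : E3 →L[ℝ] ℂ :=
  LinearMap.toContinuousLinearMap
    { toFun := fun p => ⟨5 / 4 * p 0, 5 / 4 * p 1⟩
      map_add' := fun p q => by apply Complex.ext <;> simp <;> ring
      map_smul' := fun a p => by apply Complex.ext <;> simp <;> ring }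

theorem norm_capCoord_lt {x : S2} (hx : 3 / 5 < (x : E3) 2) : capCoord x ∈ ball (0 : ℂ) 1 := by
  rw [mem_ball_zero_iff, capCoord_eq, norm_smul, norm_planar, Real.norm_of_nonneg (by norm_num)]
  have h1 : √(1 - (x : E3) 2 ^ 2) < 4 / 5 := by
    rw [Real.sqrt_lt' (by norm_num)]
    nlinarith
  linarith

namespace Collar

variable {θ₀ : ℝ} {κ : Collar θ₀} {ρ : ℂ → E3}

theorem Fits.contDiffAt_disc (hf : κ.Fits ρ) {w : ℂ} (hw : w ∈ ball (0 : ℂ) 1) :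
    ContDiffAt ℝ ∞ ρ w :=
  hf.disc.smooth.contDiffAt (closedBall_mem_nhds_of_mem hw)

/-- Near a point that is neither on the lower cap nor a pole, the sphere is given by the annulus
with the upper disc attached. -/
theorem Fits.eventually_sphereMap_eq (hf : κ.Fits ρ) (s₀ : ℝ) {x : S2}
    (h1 : -(3 / 5) < (x : E3) 2) (h0 : planar x ≠ 0) :
    ∀ᶠ y in nhds x, ∀ θ, κ.sphereMap ρ θ y =
      κ.upperMap ρ θ (polarCoords s₀ y).1 (polarCoords s₀ y).2 := by
  filter_upwards [continuous_height.continuousAt.eventually_const_lt h1,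
    continuous_planar.continuousAt.eventually_ne h0] with y hy1 hy0 θ
  exact hf.sphereMap_eq_upperMap θ hy1 (hasAngle_localAngle s₀ hy0)

theorem eventually_sphereMap_eq_disc {x : S2} (h1 : 3 / 5 < (x : E3) 2) :
    ∀ᶠ y in nhds x, ∀ θ, κ.sphereMap ρ θ y = rotZ θ (ρ (capCLM y)) := by
  filter_upwards [continuous_height.continuousAt.eventually_const_lt h1] with y hy θ
  exact κ.sphereMap_upper ρ θ hy.le

/-- Polar coordinates fail at the pole, but inside the cap the disc formula is smooth; on the band
up to its upper rim the glued polar map is `C¹`. The lower cap is left to the symmetry. -/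
theorem Fits.contMDiffAt_sphereMap (hf : κ.Fits ρ) {θ : ℝ} (hθ : 0 < Real.sin (θ / 2)) {x : S2}
    (hx : -(3 / 5) < (x : E3) 2) :
    ContMDiffAt (𝓘(ℝ, ℝ).prod (𝓡 2)) 𝓘(ℝ, E3) 1
      (fun q : ℝ × S2 => κ.sphereMap ρ q.1 q.2) (θ, x) := by
  rcases lt_or_ge (3 / 5) ((x : E3) 2) with h1 | h1
  · refine contMDiffAt_of_eventuallyEq (g := fun q => rotZ q.1 (ρ (capCLM q.2))) ?_ ?_
    · filter_upwards [continuous_snd.continuousAt.eventually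
        (eventually_sphereMap_eq_disc (κ := κ) (ρ := ρ) h1)] with q hq
      exact hq q.1
    · have h2 : ContDiffAt ℝ 1 (fun q : ℝ × E3 => ρ (capCLM q.2)) (θ, (x : E3)) :=
        ContDiffAt.comp (θ, (x : E3)) (g := ρ) (f := fun q : ℝ × E3 => capCLM q.2)
          ((hf.contDiffAt_disc (norm_capCoord_lt h1)).of_le (by simp))
          (capCLM.contDiff.contDiffAt.comp (θ, (x : E3)) contDiffAt_snd)
      exact ContDiffAt.comp (θ, (x : E3)) (g := fun q : ℝ × E3 => rotZ q.1 q.2)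
        (f := fun q : ℝ × E3 => (q.1, ρ (capCLM q.2))) (contDiff_rotZ.contDiffAt.of_le (by simp))
        (contDiffAt_fst.prodMk h2)
  · have h0 : planar x ≠ 0 := planar_ne_zero (abs_lt.2 ⟨by linarith, by linarith⟩)
    have hs := hasAngle_arg (x : E3)
    set s₀ := (planar x).arg
    refine contMDiffAt_of_eventuallyEq
      (g := fun q => κ.upperMap ρ q.1 (polarCoords s₀ q.2).1 (polarCoords s₀ q.2).2) ?_ ?_
    · filter_upwards [continuous_snd.continuousAt.eventually
        (hf.eventually_sphereMap_eq s₀ hx h0)] with q hq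
      exact hq q.1
    · have hself := polarCoords_self hs
      have h2 : ContDiffAt ℝ 1 (fun q : ℝ × E3 => (q.1, polarCoords s₀ q.2)) (θ, (x : E3)) :=
        contDiffAt_fst.prodMk (ContDiffAt.comp (θ, (x : E3)) (g := polarCoords s₀)
          (f := fun q : ℝ × E3 => q.2) ((contDiffAt_polarCoords h0 hs).of_le (by simp))
          contDiffAt_snd)
      refine ContDiffAt.comp (θ, (x : E3)) (g := fun q : ℝ × ℝ × ℝ => κ.upperMap ρ q.1 q.2.1 q.2.2)
        (f := fun q : ℝ × E3 => (q.1, polarCoords s₀ q.2)) ?_ h2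
      simp only [hself]
      exact hf.contDiffAt_upperMap hθ (by linarith) (by linarith)

theorem Fits.injective_mfderiv_sphereMap (hf : κ.Fits ρ) {θ : ℝ}
    (hθ : θ ∈ Icc θ₀ (2 * π - θ₀)) {x : S2} (hx : -(3 / 5) < (x : E3) 2) :
    Function.Injective (mfderiv (𝓡 2) 𝓘(ℝ, E3) (κ.sphereMap ρ θ) x) := by
  rcases lt_or_ge (3 / 5) ((x : E3) 2) with h1 | h1
  · have hb := norm_capCoord_lt h1
    have hρd := ((hf.contDiffAt_disc hb).differentiableAt (by simp)).hasFDerivAt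
    have hd : HasFDerivAt (fun y : E3 => rotZ θ (ρ (capCLM y)))
        ((rotZL θ).comp ((fderiv ℝ ρ (capCoord x)).comp capCLM)) (x : E3) :=
      (rotZL θ).hasFDerivAt.comp (x : E3) (HasFDerivAt.comp (g := ρ) (f := capCLM) (x : E3) hρd
        capCLM.hasFDerivAt)
    refine injective_mfderiv_of_eventuallyEq (g := fun y => rotZ θ (ρ (capCLM y))) ?_
      hd.differentiableAt ?_
    · filter_upwards [eventually_sphereMap_eq_disc (κ := κ) (ρ := ρ) h1] with y hy using hy θ
    · intro w hw hw0
      rw [hd.fderiv] at hw0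
      have h2 : fderiv ℝ ρ (capCoord x) (capCLM w) = 0 := by
        apply rotZ_injective θ
        have : rotZ θ 0 = 0 := map_zero (rotZL θ)
        rw [this]
        exact hw0
      have h3 : fderivWithin ℝ ρ (closedBall 0 1) (capCoord x) = fderiv ℝ ρ (capCoord x) :=
        fderivWithin_of_mem_nhds (closedBall_mem_nhds_of_mem hb)
      have h4 := hf.disc.immersed _ (ball_subset_closedBall hb)
      rw [h3] at h4
      have h5 : capCLM w = 0 := h4 (h2.trans (map_zero _).symm)
      have e0 : w 0 = 0 := by
        have : 5 / 4 * w 0 = 0 := congrArg Complex.re h5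
        linarith
      have e1 : w 1 = 0 := by
        have : 5 / 4 * w 1 = 0 := congrArg Complex.im h5
        linarith
      rw [inner_eq, e0, e1, mul_zero, mul_zero, zero_add, zero_add] at hw
      -- The tangent plane contains no vertical vector, because `x` has positive height.
      have e2 : w 2 = 0 := (mul_eq_zero.1 hw).resolve_left (by linarith)
      ext i
      fin_cases i
      · exact e0
      · exact e1
      · exact e2
  · have h0 : planar x ≠ 0 := planar_ne_zero (abs_lt.2 ⟨by linarith, by linarith⟩)
    have hs := hasAngle_arg (x : E3)
    set s₀ := (planar x).arg
    have hself := polarCoords_self hs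
    have hinj := hf.injective_fderiv_upperMap hθ s₀ (h := 5 / 3 * (x : E3) 2) (by linarith)
      (by linarith)
    have hU : DifferentiableAt ℝ (fun q : ℝ × ℝ => κ.upperMap ρ θ q.1 q.2)
        (s₀, 5 / 3 * (x : E3) 2) :=
      (ContDiffAt.comp (s₀, 5 / 3 * (x : E3) 2)
        (g := fun q : ℝ × ℝ × ℝ => κ.upperMap ρ q.1 q.2.1 q.2.2)
        (f := fun q : ℝ × ℝ => (θ, q.1, q.2)) (hf.contDiffAt_upperMap
          (sin_half_pos κ.θ₀_pos hθ) (by linarith) (by linarith)) (by fun_prop)).differentiableAt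
        one_ne_zero
    rw [← hself] at hU hinj
    have hd : HasFDerivAt (fun y : E3 => κ.upperMap ρ θ (polarCoords s₀ y).1 (polarCoords s₀ y).2)
        _ (x : E3) :=
      HasFDerivAt.comp (g := fun q : ℝ × ℝ => κ.upperMap ρ θ q.1 q.2) (f := polarCoords s₀)
        (x : E3) hU.hasFDerivAt
        ((contDiffAt_polarCoords h0 hs).differentiableAt (by simp)).hasFDerivAt
    refine injective_mfderiv_of_eventuallyEq
      (g := fun y => κ.upperMap ρ θ (polarCoords s₀ y).1 (polarCoords s₀ y).2) ?_
      hd.differentiableAt ?_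
    · filter_upwards [hf.eventually_sphereMap_eq s₀ hx h0] with y hy using hy θ
    · intro w hw hw0
      rw [hd.fderiv] at hw0
      exact eq_zero_of_fderiv_polarCoords h0 hs hw (hinj (hw0.trans (map_zero _).symm))

/-! #### Smoothness on the pieces -/

theorem Fits.contMDiffOn_upperCap (hf : κ.Fits ρ) (T : Set ℝ) :
    ContMDiffOn (𝓘(ℝ, ℝ).prod (𝓡 2)) 𝓘(ℝ, E3) ∞
      (fun q : ℝ × S2 => κ.sphereMap ρ q.1 q.2) (T ×ˢ upperCap) := by
  have hg : ContDiffOn ℝ ∞ (fun q : ℝ × E3 => rotZ q.1 (ρ (capCLM q.2)))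
      {q | capCLM q.2 ∈ closedBall (0 : ℂ) 1} :=
    ContDiff.comp_contDiffOn (g := fun q : ℝ × E3 => rotZ q.1 q.2)
      (f := fun q : ℝ × E3 => (q.1, ρ (capCLM q.2))) contDiff_rotZ
      (contDiffOn_fst.prodMk (hf.disc.smooth.comp
        (capCLM.contDiff.comp contDiff_snd).contDiffOn fun q hq => hq))
  have h := ContMDiffOn.comp (s := T ×ˢ upperCap) hg.contMDiffOn contMDiff_incl.contMDiffOn
    (fun q hq => by
      have : capCoord q.2 ∈ capCoord '' upperCap := mem_image_of_mem _ hq.2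
      rwa [image_capCoord_upperCap] at this)
  exact h.congr fun q hq => κ.sphereMap_upper ρ q.1 hq.2

theorem Fits.contMDiffOn_lowerCap (hf : κ.Fits ρ) (T : Set ℝ) :
    ContMDiffOn (𝓘(ℝ, ℝ).prod (𝓡 2)) 𝓘(ℝ, E3) ∞
      (fun q : ℝ × S2 => κ.sphereMap ρ q.1 q.2) (T ×ˢ lowerCap) := by
  have hg : ContDiffOn ℝ ∞ (fun q : ℝ × E3 => rotZ (-q.1) (ρ (capCLM q.2)))
      {q | capCLM q.2 ∈ closedBall (0 : ℂ) 1} :=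
    ContDiff.comp_contDiffOn (g := fun q : ℝ × E3 => rotZ q.1 q.2)
      (f := fun q : ℝ × E3 => (-q.1, ρ (capCLM q.2))) contDiff_rotZ
      (contDiffOn_fst.neg.prodMk (hf.disc.smooth.comp
        (capCLM.contDiff.comp contDiff_snd).contDiffOn fun q hq => hq))
  have h := ContMDiffOn.comp (s := T ×ˢ lowerCap) hg.contMDiffOn contMDiff_incl.contMDiffOn
    (fun q hq => by
      have : capCoord q.2 ∈ capCoord '' lowerCap := mem_image_of_mem _ hq.2
      rwa [image_capCoord_lowerCap] at this)
  exact h.congr fun q hq => κ.sphereMap_lower ρ q.1 hq.2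

/-- The formula of the annulus is smooth in a neighbourhood of each point of the closed band, rims
included. -/
theorem Fits.contMDiffOn_band (hf : κ.Fits ρ) :
    ContMDiffOn (𝓘(ℝ, ℝ).prod (𝓡 2)) 𝓘(ℝ, E3) ∞
      (fun q : ℝ × S2 => κ.sphereMap ρ q.1 q.2) (Icc θ₀ (2 * π - θ₀) ×ˢ band) := by
  rintro ⟨θ, x⟩ ⟨hθ, hx⟩
  have hx' : |(x : E3) 2| ≤ 3 / 5 := hx
  have h0 : planar x ≠ 0 := planar_ne_zero (hx'.trans_lt (by norm_num))
  have hs := hasAngle_arg (x : E3)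
  set s₀ := (planar x).arg
  have hself := polarCoords_self hs
  have h2 : ContDiffAt ℝ ∞ (fun q : ℝ × E3 => (q.1, polarCoords s₀ q.2)) (θ, (x : E3)) :=
    contDiffAt_fst.prodMk (ContDiffAt.comp (θ, (x : E3)) (g := polarCoords s₀)
      (f := fun q : ℝ × E3 => q.2) (contDiffAt_polarCoords h0 hs) contDiffAt_snd)
  have h3 : ContDiffAt ℝ ∞ (fun q : ℝ × E3 =>
      κ.bandMap q.1 (polarCoords s₀ q.2).1 (polarCoords s₀ q.2).2) (θ, (x : E3)) := by
    refine ContDiffAt.comp (θ, (x : E3)) (g := fun q : ℝ × ℝ × ℝ => κ.bandMap q.1 q.2.1 q.2.2)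
      (f := fun q : ℝ × E3 => (q.1, polarCoords s₀ q.2)) ?_ h2
    simp only [hself]
    exact κ.contDiffAt_bandMap (sin_half_pos κ.θ₀_pos hθ) (abs_scaled_le_one hx)
  have h4 := contMDiffAt_of_eventuallyEq (q := (θ, x)) Filter.EventuallyEq.rfl h3
  refine h4.contMDiffWithinAt.congr (fun q hq => ?_) ?_
  · have : |(q.2 : E3) 2| < 1 := lt_of_le_of_lt hq.2 (by norm_num)
    exact hf.sphereMap_band hq.1 hq.2 (hasAngle_localAngle s₀ (planar_ne_zero this))
  · exact hf.sphereMap_band hθ hx (hasAngle_localAngle s₀ h0)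

end Collar

/-! ### Diffeomorphisms of the sphere -/

/-- The extension of `twist k` to space. -/
def spaceTwist (k : ℝ → ℝ) (p : E3) : E3 := rotZ (k (p 2)) p

theorem contDiff_spaceTwist {k : ℝ → ℝ} (hk : ContDiff ℝ ∞ k) : ContDiff ℝ ∞ (spaceTwist k) :=
  ContDiff.comp (g := fun q : ℝ × E3 => rotZ q.1 q.2) (f := fun p : E3 => (k (p 2), p))
    contDiff_rotZ ((hk.comp (by fun_prop : ContDiff ℝ ∞ (fun p : E3 => p 2))).prodMk contDiff_id)

/-- The extension of `mirror` to space. -/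
def spaceMirror (p : E3) : E3 := !₂[p 0, p 1, -p 2]

theorem contDiff_spaceMirror : ContDiff ℝ ∞ spaceMirror := by
  rw [contDiff_euclidean]
  intro i
  fin_cases i <;> simp [spaceMirror] <;> fun_prop

theorem contMDiff_twist {k : ℝ → ℝ} (hk : ContDiff ℝ ∞ k) :
    ContMDiff (𝓡 2) (𝓡 2) ∞ (twist k) := by
  have := fact_finrank_E3
  exact ContMDiff.codRestrict_sphere (f := fun x : S2 => spaceTwist k x)
    ((contDiff_spaceTwist hk).contMDiff.comp contMDiff_coe) fun x => (twist k x).2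

theorem contMDiff_mirror : ContMDiff (𝓡 2) (𝓡 2) ∞ mirror := by
  have := fact_finrank_E3
  exact ContMDiff.codRestrict_sphere (f := fun x : S2 => spaceMirror x)
    (contDiff_spaceMirror.contMDiff.comp contMDiff_coe) fun x => (mirror x).2

theorem twist_neg_twist (k : ℝ → ℝ) (x : S2) : twist (-k) (twist k x) = x := by
  rw [twist_twist]
  exact Subtype.ext (by simp [twist, rotZ_zero])

/-- `twist k` as a diffeomorphism. -/
def twistDiffeo {k : ℝ → ℝ} (hk : ContDiff ℝ ∞ k) : S2 ≃ₘ^∞⟮𝓡 2, 𝓡 2⟯ S2 where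
  toEquiv := ⟨twist k, twist (-k), twist_neg_twist k, fun x => by
    simpa using twist_neg_twist (-k) x⟩
  contMDiff_toFun := contMDiff_twist hk
  contMDiff_invFun := contMDiff_twist (k := -k) hk.neg

theorem injective_mfderiv_diffeomorph (e : S2 ≃ₘ^∞⟮𝓡 2, 𝓡 2⟯ S2) (x : S2) :
    Function.Injective (mfderiv (𝓡 2) (𝓡 2) e x) := by
  have h1 : HasMFDerivAt (𝓡 2) (𝓡 2) (e.symm ∘ e) x _ :=
    HasMFDerivAt.comp x (e.symm.mdifferentiable (by simp) (e x)).hasMFDerivAt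
      (e.mdifferentiable (by simp) x).hasMFDerivAt
  have h2 : e.symm ∘ e = id := funext e.symm_apply_apply
  rw [h2] at h1
  have h3 := hasMFDerivAt_unique h1 (hasMFDerivAt_id x)
  refine Function.LeftInverse.injective (g := mfderiv (𝓡 2) (𝓡 2) e.symm (e x)) fun v => ?_
  exact congrArg (fun L => L v) h3

theorem injective_mfderiv_comp {f : S2 → E3} (e : S2 ≃ₘ^∞⟮𝓡 2, 𝓡 2⟯ S2) {x : S2}
    (hf : MDifferentiableAt (𝓡 2) 𝓘(ℝ, E3) f (e x))
    (hi : Function.Injective (mfderiv (𝓡 2) 𝓘(ℝ, E3) f (e x))) :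
    Function.Injective (mfderiv (𝓡 2) 𝓘(ℝ, E3) (fun y => f (e y)) x) := by
  have h : HasMFDerivAt (𝓡 2) 𝓘(ℝ, E3) (fun y => f (e y)) x _ :=
    HasMFDerivAt.comp x hf.hasMFDerivAt (e.mdifferentiable (by simp) x).hasMFDerivAt
  rw [h.mfderiv]
  exact hi.comp (injective_mfderiv_diffeomorph e x)

theorem IsImmersedSphere.comp_diffeomorph {f : S2 → E3} (hf : IsImmersedSphere f)
    (e : S2 ≃ₘ^∞⟮𝓡 2, 𝓡 2⟯ S2) : IsImmersedSphere fun x => f (e x) :=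
  ⟨hf.1.comp (e.contMDiff.of_le (by simp)), fun x =>
    injective_mfderiv_comp e ((hf.1 (e x)).mdifferentiableAt one_ne_zero) (hf.2 (e x))⟩

/-! #### Orientation -/

theorem det_basisFun (a b c : E3) : (EuclideanSpace.basisFun (Fin 3) ℝ).toBasis.det ![a, b, c] =
    a 0 * (b 1 * c 2 - b 2 * c 1) - a 1 * (b 0 * c 2 - b 2 * c 0) +
      a 2 * (b 0 * c 1 - b 1 * c 0) := by
  rw [Module.Basis.det_apply, Matrix.det_fin_three]
  simp [Module.Basis.toMatrix_apply]
  ring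

theorem fderiv_mirror_twist {k : ℝ → ℝ} (hk : ContDiff ℝ ∞ k) (p v : E3) :
    fderiv ℝ (fun p => spaceMirror (spaceTwist k p)) p v =
      !₂[Real.cos (k (p 2)) * v 0 - Real.sin (k (p 2)) * v 1 -
          deriv k (p 2) * v 2 * (Real.sin (k (p 2)) * p 0 + Real.cos (k (p 2)) * p 1),
        Real.sin (k (p 2)) * v 0 + Real.cos (k (p 2)) * v 1 +
          deriv k (p 2) * v 2 * (Real.cos (k (p 2)) * p 0 - Real.sin (k (p 2)) * p 1), -v 2] := by
  have hd : DifferentiableAt ℝ (fun p => spaceMirror (spaceTwist k p)) p :=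
    (contDiff_spaceMirror.comp (contDiff_spaceTwist hk)).differentiable (by simp) p
  have h1 : HasDerivAt (fun e : ℝ => spaceMirror (spaceTwist k (p + e • v))) _ 0 :=
    HasFDerivAt.comp_hasDerivAt_of_eq (l := fun p => spaceMirror (spaceTwist k p))
      (f := fun e : ℝ => p + e • v) 0 hd.hasFDerivAt (hasDerivAt_line p v) (by simp)
  refine h1.unique ?_
  have hc := hasDerivAt_euclidean.1 (hasDerivAt_line p v)
  have hk2 : HasDerivAt (fun e : ℝ => k ((p + e • v) 2)) (deriv k (p 2) * v 2) 0 :=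
    HasDerivAt.comp_of_eq (0 : ℝ) (hk.differentiable (by simp) (p 2)).hasDerivAt (hc 2) (by simp)
  rw [hasDerivAt_euclidean]
  intro i
  fin_cases i
  · refine ((hk2.cos.mul (hc 0)).sub (hk2.sin.mul (hc 1))).congr_deriv ?_
    simp
    ring
  · refine ((hk2.sin.mul (hc 0)).add (hk2.cos.mul (hc 1))).congr_deriv ?_
    simp
    ring
  · exact (hc 2).neg

theorem tangentVec_mfderiv {f : S2 → S2} (hf : ContMDiff (𝓡 2) (𝓡 2) ∞ f) {G : E3 → E3}
    (hG : ContDiff ℝ ∞ G) (hfG : ∀ x : S2, (f x : E3) = G x) (x : S2) (v : TangentSpace (𝓡 2) x) :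
    tangentVec (f x) (mfderiv (𝓡 2) (𝓡 2) f x v) = fderiv ℝ G x (tangentVec x v) := by
  have h1 : HasMFDerivAt (𝓡 2) 𝓘(ℝ, E3) (fun y => (f y : E3)) x _ :=
    HasMFDerivAt.comp x (hasMFDerivAt_coe (f x))
      ((hf x).mdifferentiableAt (by simp)).hasMFDerivAt
  rw [← mfderiv_of_eventuallyEq (f := fun y => (f y : E3)) (Filter.Eventually.of_forall hfG)
    (hG.differentiable (by simp) _), h1.mfderiv]
  rfl

/-- A twist composed with the reflection in the equator reverses orientation. -/
theorem reversesOrientation_mirror_twist {k : ℝ → ℝ} (hk : ContDiff ℝ ∞ k) :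
    ReversesOrientation fun x => mirror (twist k x) := by
  intro x v w hpos
  have hf : ContMDiff (𝓡 2) (𝓡 2) ∞ fun x => mirror (twist k x) :=
    contMDiff_mirror.comp (contMDiff_twist hk)
  have hG := contDiff_spaceMirror.comp (contDiff_spaceTwist hk)
  have ht := tangentVec_mfderiv (G := fun p => spaceMirror (spaceTwist k p)) hf hG (fun _ => rfl) x
  have hxv := inner_tangentVec x v
  have hxw := inner_tangentVec x w
  rw [inner_eq] at hxv hxw
  -- The twist shears the sphere along its circles of latitude and so preserves area; only the
  -- reflection contributes a sign.
  have key : areaForm (mirror (twist k x))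
      (mfderiv (𝓡 2) (𝓡 2) (fun x => mirror (twist k x)) x v)
      (mfderiv (𝓡 2) (𝓡 2) (fun x => mirror (twist k x)) x w) = -areaForm x v w := by
    have hx : ((mirror (twist k x) : S2) : E3) = spaceMirror (spaceTwist k x) := rfl
    rw [areaForm, ht v, ht w, areaForm, hx, fderiv_mirror_twist hk, fderiv_mirror_twist hk,
      det_basisFun, det_basisFun]
    set a := tangentVec x v
    set b := tangentVec x w
    simp only [spaceMirror, spaceTwist, rotZ, PiLp.toLp_apply, Matrix.cons_val]
    set y : E3 := (x : E3)
    set d := deriv k (y 2)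
    linear_combination (-(y 0 * (a 1 * b 2 - a 2 * b 1) - y 1 * (a 0 * b 2 - a 2 * b 0) +
      y 2 * (a 0 * b 1 - a 1 * b 0) + d * y 2 * (b 2 * (y 0 * a 0 + y 1 * a 1 + y 2 * a 2) -
        a 2 * (y 0 * b 0 + y 1 * b 1 + y 2 * b 2)))) * Real.sin_sq_add_cos_sq (k (y 2)) -
      d * y 2 * b 2 * hxv + d * y 2 * a 2 * hxw
  rw [key]
  linarith

namespace Collar

variable {θ₀ : ℝ} (κ : Collar θ₀)

theorem contDiff_twistAngle : ContDiff ℝ ∞ (fun z => κ.twistAngle (5 / 3 * z)) := by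
  have : ContDiff ℝ ∞ (fun z : ℝ => sweep (5 / 3 * z)) := contDiff_sweep.comp (by fun_prop)
  exact (contDiff_const.mul (contDiff_const.sub this)).neg

/-- The deck transformation as a diffeomorphism. -/
def deckDiffeo : S2 ≃ₘ^∞⟮𝓡 2, 𝓡 2⟯ S2 where
  toFun := κ.deck
  invFun := κ.deck
  left_inv := κ.deck_deck
  right_inv := κ.deck_deck
  contMDiff_toFun := contMDiff_mirror.comp (contMDiff_twist κ.contDiff_twistAngle)
  contMDiff_invFun := contMDiff_mirror.comp (contMDiff_twist κ.contDiff_twistAngle)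

theorem deckDiffeo_apply (x : S2) : κ.deckDiffeo x = κ.deck x := rfl

theorem isDehnTwist : IsDehnTwist (twist fun z => κ.twistAngle (5 / 3 * z)) := by
  refine ⟨_, -κ.η, κ.contDiff_twistAngle, ?_, fun z hz => κ.twistAngle_eq_zero (by linarith),
    fun z hz => κ.twistAngle_eq (by linarith), fun x => rfl⟩
  rcases κ.η_eq with e | e
  · exact Or.inr (by rw [e])
  · exact Or.inl (by rw [e, neg_neg])

theorem contDiff_halfTwist : ContDiff ℝ ∞ (fun z => κ.η * (π / 2) * sweep (5 / 3 * z)) :=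
  contDiff_const.mul (contDiff_sweep.comp (by fun_prop))

/-- A diffeomorphism that conjugates the deck transformation to the antipodal map. -/
def straighten : S2 ≃ₘ^∞⟮𝓡 2, 𝓡 2⟯ S2 := twistDiffeo κ.contDiff_halfTwist

theorem circlePt_sub_η (a : ℝ) : circlePt (a - κ.η * π) = -circlePt a := by
  rw [sub_eq_add_neg, ← circlePt_mul]
  have : circlePt (-(κ.η * π)) = -1 := by
    rcases κ.η_eq with e | e <;> simp [e, circlePt, Complex.exp_neg]
  rw [this, mul_neg_one]

theorem straighten_apply (x : S2) :
    κ.straighten x = twist (fun z => κ.η * (π / 2) * sweep (5 / 3 * z)) x := rfl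

/-- The antipodal map is the reflection in the equator followed by a half turn. The diffeomorphism
carries half of the sweep of the twist: at height `-z`, added to the twist at `z`, it differs from
its own value at `z` by `-ηπ`. -/
theorem straighten_deck (x : S2) : κ.straighten (κ.deck x) = -κ.straighten x := by
  have hneg : ∀ y : S2, planar ((-y : S2) : E3) = -planar y := fun y => by
    apply Complex.ext <;> simp [planar]
  rw [straighten_apply, straighten_apply]
  refine sphere_ext ?_ ?_
  · rw [hneg, planar_twist, planar_twist, planar_deck, deck_two, ← mul_assoc, circlePt_mul, mul_neg,
      sweep_neg, ← neg_mul, ← circlePt_sub_η]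
    congr 2
    rw [twistAngle]
    ring
  · rw [twist_two, deck_two, ← twist_two (fun z => κ.η * (π / 2) * sweep (5 / 3 * z)) x]
    rfl

/-! ### The regular homotopy -/

variable {κ} {ρ : ℂ → E3}

theorem Fits.contMDiffOn_sphereMap (hf : κ.Fits ρ) :
    ContMDiffOn (𝓘(ℝ, ℝ).prod (𝓡 2)) 𝓘(ℝ, E3) 1 (fun q : ℝ × S2 => κ.sphereMap ρ q.1 q.2)
      (Icc θ₀ (2 * π - θ₀) ×ˢ univ) := by
  rintro ⟨θ, x⟩ ⟨hθ, -⟩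
  by_cases hx : -(3 / 5) < (x : E3) 2
  · exact (hf.contMDiffAt_sphereMap (sin_half_pos κ.θ₀_pos hθ) hx).contMDiffWithinAt
  -- The map `(θ, x) ↦ (2π - θ, r x)` takes the lower cap into the upper one, where regularity is
  -- known.
  · have hr : ContMDiff (𝓘(ℝ, ℝ).prod (𝓡 2)) (𝓘(ℝ, ℝ).prod (𝓡 2)) 1
        (fun q : ℝ × S2 => (2 * π - q.1, κ.deckDiffeo q.2)) := by
      have h1 : ContDiff ℝ 1 (fun t : ℝ => 2 * π - t) := by fun_prop
      exact (h1.contMDiff.comp contMDiff_fst).prodMk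
        ((κ.deckDiffeo.contMDiff.of_le (by simp)).comp contMDiff_snd)
    have h2 := hf.contMDiffAt_sphereMap (x := κ.deck x)
      (sin_half_pos κ.θ₀_pos (two_pi_sub_mem hθ)) (by rw [deck_two]; linarith)
    have h3 := ContMDiffAt.comp (θ, x) (f := fun q : ℝ × S2 => (2 * π - q.1, κ.deckDiffeo q.2))
      (g := fun q : ℝ × S2 => κ.sphereMap ρ q.1 q.2) h2 (hr (θ, x))
    have h4 : ∀ θ ∈ Icc θ₀ (2 * π - θ₀), ∀ x : S2,
        κ.sphereMap ρ θ x = κ.sphereMap ρ (2 * π - θ) (κ.deck x) := fun θ hθ x => by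
      rw [hf.sphereMap_deck (two_pi_sub_mem hθ), sub_sub_cancel]
    exact h3.contMDiffWithinAt.congr (fun q hq => h4 q.1 hq.1 q.2) (h4 θ hθ x)

theorem Fits.isImmersedSphere (hf : κ.Fits ρ) {θ : ℝ} (hθ : θ ∈ Icc θ₀ (2 * π - θ₀)) :
    IsImmersedSphere (κ.sphereMap ρ θ) := by
  have hc : ∀ θ ∈ Icc θ₀ (2 * π - θ₀), ContMDiff (𝓡 2) 𝓘(ℝ, E3) 1 (κ.sphereMap ρ θ) :=
    fun θ hθ => hf.contMDiffOn_sphereMap.comp_contMDiff (f := fun x : S2 => (θ, x))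
      (contMDiff_const.prodMk contMDiff_id) fun x => ⟨hθ, mem_univ _⟩
  refine ⟨hc θ hθ, fun x => ?_⟩
  by_cases hx : -(3 / 5) < (x : E3) 2
  · exact hf.injective_mfderiv_sphereMap hθ hx
  · have h1 := two_pi_sub_mem hθ
    have h2 : κ.sphereMap ρ θ = fun x => κ.sphereMap ρ (2 * π - θ) (κ.deckDiffeo x) := by
      funext x
      rw [deckDiffeo_apply, hf.sphereMap_deck h1, sub_sub_cancel]
    rw [h2]
    exact injective_mfderiv_comp κ.deckDiffeo ((hc _ h1 _).mdifferentiableAt one_ne_zero)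
      (hf.injective_mfderiv_sphereMap h1 (by rw [deckDiffeo_apply, deck_two]; linarith))

theorem Fits.isRegularHomotopy (hf : κ.Fits ρ) (hlt : θ₀ < π) :
    IsRegularHomotopy θ₀ (2 * π - θ₀) (κ.sphereMap ρ) (κ.sphereMap ρ θ₀)
      (fun x => κ.sphereMap ρ θ₀ (κ.deckDiffeo x)) where
  le := by linarith
  contMDiffOn := hf.contMDiffOn_sphereMap
  immersed _ ht := hf.isImmersedSphere ht
  source := rfl
  target := funext fun x => (hf.sphereMap_deck ⟨le_rfl, by linarith⟩ x).symm

/-! ### The middle sphere and the projective plane -/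

theorem pi_mem (hlt : θ₀ < π) : π ∈ Icc θ₀ (2 * π - θ₀) := ⟨hlt.le, by linarith⟩

theorem Fits.sphereMap_pi_deck (hf : κ.Fits ρ) (hlt : θ₀ < π) (x : S2) :
    κ.sphereMap ρ π (κ.deck x) = κ.sphereMap ρ π x := by
  rw [hf.sphereMap_deck (pi_mem hlt), two_mul, add_sub_cancel_right]

/-- The middle sphere, as a map of the projective plane. -/
def projectiveMap (hf : κ.Fits ρ) (hlt : θ₀ < π) : RP2 → E3 :=
  Quotient.lift (fun y => κ.sphereMap ρ π (κ.straighten.symm y)) fun y y' h => by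
    rcases h with h | h
    · rw [h]
    · have e : κ.straighten.symm y' = κ.deck (κ.straighten.symm y) := by
        rw [h, ← κ.straighten.symm_apply_apply (κ.deck _), straighten_deck,
          κ.straighten.apply_symm_apply]
      rw [e, hf.sphereMap_pi_deck hlt]

theorem projectiveMap_toRP2 (hf : κ.Fits ρ) (hlt : θ₀ < π) (y : S2) :
    projectiveMap hf hlt (toRP2 y) = κ.sphereMap ρ π (κ.straighten.symm y) := rfl

theorem range_projectiveMap (hf : κ.Fits ρ) (hlt : θ₀ < π) :
    range (projectiveMap hf hlt) = moebius ∪ disc ρ π := by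
  have h1 : range (projectiveMap hf hlt) = range (κ.sphereMap ρ π) := by
    ext p
    constructor
    · rintro ⟨y, rfl⟩
      obtain ⟨y, rfl⟩ := Quotient.exists_rep y
      exact ⟨_, rfl⟩
    · rintro ⟨x, rfl⟩
      exact ⟨toRP2 (κ.straighten x), by
        rw [projectiveMap_toRP2, κ.straighten.symm_apply_apply]⟩
  have h2 : disc ρ (-π) = disc ρ π := by
    refine image_congr fun p _ => ?_
    rw [← rotZ_add_two_pi (-π)]
    congr 1
    ring
  rw [h1, (hf.parametrizes (pi_mem hlt)).range_eq, sphereImage, h2, annulus_pi_div_two,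
    union_comm (disc ρ π), union_assoc, union_self]

end Collar

end

end Holiverse

/-! ### The proposition -/

theorem mainTheorem4 (ρ : ℂ → Holiverse.E3) (hρ : Holiverse.IsSpanningDisc ρ)
    (θ₀ : ℝ) (hpos : 0 < θ₀) (hlt : θ₀ < π) :
    ∃ (F : ℝ → Holiverse.S2 → Holiverse.E3)
      (r : Holiverse.S2 ≃ₘ^∞⟮𝓡 2, 𝓡 2⟯ Holiverse.S2),
      -- the parametrized spheres `S_θ` form a regular homotopy
      -- from `S_{θ₀}` to itself with orientation reversed
      Holiverse.IsRegularHomotopy θ₀ (2 * π - θ₀) F (F θ₀) (fun x => F θ₀ (r x)) ∧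
      Holiverse.ReversesOrientation r ∧
      (∀ θ ∈ Icc θ₀ (2 * π - θ₀), Holiverse.Parametrizes ρ θ (F θ)) ∧
      -- the homotopy is smooth on each of the three closed pieces
      (∀ P ∈ ({Holiverse.upperCap, Holiverse.band, Holiverse.lowerCap} : Set (Set Holiverse.S2)),
        ContMDiffOn (𝓘(ℝ, ℝ).prod (𝓡 2)) 𝓘(ℝ, Holiverse.E3) ∞
          (fun q : ℝ × Holiverse.S2 => F q.1 q.2) (Icc θ₀ (2 * π - θ₀) ×ˢ P)) ∧
      -- the two discs trade places, and the annulus comes back after a Dehn twist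
      (∃ D : Holiverse.S2 → Holiverse.S2, Holiverse.IsDehnTwist D ∧
        ∀ x, r x = Holiverse.mirror (D x)) ∧
      -- the middle sphere double covers an immersed projective plane, with deck transformation `r`
      (∃ (ψ : Holiverse.S2 ≃ₘ^∞⟮𝓡 2, 𝓡 2⟯ Holiverse.S2) (g : Holiverse.RP2 → Holiverse.E3),
        (∀ x, ψ (r x) = -ψ x) ∧
        Holiverse.IsImmersedRP2 g ∧
        (∀ x, F π x = g (Holiverse.toRP2 (ψ x))) ∧
        range g = Holiverse.moebius ∪ Holiverse.disc ρ π) ∧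
      -- at that time the annulus double covers the Möbius band
      F π '' Holiverse.band = Holiverse.moebius ∧
      (∀ x ∈ Holiverse.band, ∀ y ∈ Holiverse.band, F π x = F π y ↔ y = x ∨ y = r x) := by
  obtain ⟨κ, hb, hr⟩ := Holiverse.exists_collar hρ hpos hlt
  have hf : κ.Fits ρ := ⟨hρ, hb, hr⟩
  have hπ := Holiverse.Collar.pi_mem hlt
  -- Composed with `toRP2`, the map of the projective plane is by definition the middle sphere after
  -- the inverse of `straighten`, which is an immersion.
  refine ⟨κ.sphereMap ρ, κ.deckDiffeo, hf.isRegularHomotopy hlt,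
    Holiverse.reversesOrientation_mirror_twist κ.contDiff_twistAngle, fun θ hθ => hf.parametrizes hθ, ?_,
    ⟨_, κ.isDehnTwist, fun _ => rfl⟩, ⟨κ.straighten, Holiverse.Collar.projectiveMap hf hlt,
      κ.straighten_deck, (hf.isImmersedSphere hπ).comp_diffeomorph κ.straighten.symm, fun x => ?_,
      Holiverse.Collar.range_projectiveMap hf hlt⟩, ?_, fun x hx y hy => ⟨fun h => ?_, ?_⟩⟩
  · rintro P (rfl | rfl | rfl)
    · exact hf.contMDiffOn_upperCap _
    · exact hf.contMDiffOn_band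
    · exact hf.contMDiffOn_lowerCap _
  · rw [Holiverse.Collar.projectiveMap_toRP2, κ.straighten.symm_apply_apply]
  · rw [hf.image_band hπ, Holiverse.annulus_pi_div_two]
  · exact (hf.sphereMap_eq_sphereMap hπ hx hy h).imp id fun h => h.2
  · rintro (rfl | rfl)
    · rfl
    · exact (hf.sphereMap_pi_deck hlt x).symm
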